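/- **Notation.** Let $N\ge 1$ and let $\Omega\subset\mathbf R^N$ be a bounded domain of class $C^2$. Write $\delta(x)=\operatorname{dist}(x,\partial\Omega)$, and for $\eta>0$ put $\Omega_\eta=\{x\in\Omega:\delta(x)<\eta\}$ and $\Sigma_\eta=\{x\in\Omega:\delta(x)=\eta\}$. For $1<p<\infty$ and $\alpha\in\mathbf R$ let $\Lambda_{\alpha,p}=|1-\tfrac1p-\alpha|^p$ if $\alpha\ne1-\tfrac1p$ and $\Lambda_{\alpha,p}=(1-\tfrac1p)^p$ if $\alpha=1-\tfrac1p$. For $R>0$ let $A_1(t)=\log(R/t)$ and $A_2(t)=\log A_1(t)$. Let $W^{1,p}_{\alpha,0}(\Omega)$ be the completion of $C_c^\infty(\Omega)$ (real-valued functions) with respect to the norm $$\Big(\int_\Omega|\nabla u|^p\delta^{\alpha p}\,dx\Big)^{1/p}+\Big(\int_\Omega|u|^p\delta^{\alpha p}\,dx\Big)^{1/p}.$$ Integrals over $\Omega_\eta$ are with respect to Lebesgue measure, and integrals over $\Sigma_\eta$ with respect to the $(N-1)$-dimensional surface measure. On $\Sigma_\eta$ a function $u\in W^{1,p}_{\alpha,0}(\Omega)$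 is understood in the sense of traces, i.e. through the continuous extension to $W^{1,p}_{\alpha,0}(\Omega)$, with values in $L^p(\Sigma_\eta)$, of the restriction map $\varphi\mapsto\varphi|_{\Sigma_\eta}$ on $C_c^\infty(\Omega)$. **Theorem 2.5 (critical case).** Let $1<p<\infty$ and $R>0$. 1. Let $\alpha>1-\frac1p$. There are positive numbers $C_2=C_2(\alpha,p,R,\eta)$ and $L=L(\alpha,p,R,\eta)$, defined for all $\eta>0$, such that the following holds. For every $N\ge1$ and every bounded domain $\Omega\subset\mathbf R^N$ of class $C^2$ with $R>e^e\cdot\sup_{x\in\Omega}\delta(x)$ there is $\eta_0>0$ such that, for every $\eta\in(0,\eta_0)$ and every $u\in W^{1,p}_{\alpha,0}(\Omega)$, the trace of $u$ on $\Sigma_\eta$ exists, all integrals below are finite, and $$\int_{\Omega_\eta}\Big(|\nabla u|^p-\Lambda_{\alpha,p}\Big|\frac u\delta\Big|^p\Big)\delta^{\alpha p}+L\int_{\Sigma_\eta}|u|^p\delta^{\alpha p}\ \ge\ C_2\int_{\Omega_\eta}\Big|\frac u\delta\Big|^p\frac{\delta^{\alpha p}}{A_1(\delta)^2}.$$ 2.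 Let $\alpha=1-\frac1p$. There are positive numbers $C_2=C_2(\alpha,p,R,\eta)$ and $L=L(\alpha,p,R,\eta)$, defined for all $\eta>0$, such that the following holds. For every $N\ge1$ and every bounded domain $\Omega\subset\mathbf R^N$ of class $C^2$ with $R>e^e\cdot\sup_{x\in\Omega}\delta(x)$ there is $\eta_0>0$ such that, for every $\eta\in(0,\eta_0)$ and every $u\in W^{1,p}_{\alpha,0}(\Omega)$, the trace of $u$ on $\Sigma_\eta$ exists, all integrals below are finite, and $$\int_{\Omega_\eta}\Big(|\nabla u|^p-\Lambda_{\alpha,p}\Big|\frac u\delta\Big|^p\frac1{A_1(\delta)^p}\Big)\delta^{p-1}+L\int_{\Sigma_\eta}|u|^p\delta^{p-1}\ \ge\ C_2\int_{\Omega_\eta}\Big|\frac u\delta\Big|^p\frac1{A_1(\delta)^p}\frac1{A_2(\delta)^2}\,\delta^{p-1}.$$ -/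

import Mathlib

open Set Filter Topology MeasureTheory
open scoped ENNReal Gradient

noncomputable section

namespace CriticalHardy

/-- `ℝ^N` with the Euclidean norm. -/
abbrev Eu (N : ℕ) : Type := EuclideanSpace ℝ (Fin N)

/-- The boundary of `Ω` is of class `C²`: near each boundary point there are a unit vector `ν`
and a `C²` function `γ` such that `Ω` is, inside a ball around that point, the set of points
lying above the graph of `γ` in the direction `ν`. Only the values of `γ` on the hyperplane
orthogonal to `ν` are used; `x - ⟪ν, x⟫ ν` is the orthogonal projection of `x` to it. -/
def HasC2Boundary {N : ℕ} (Ω : Set (Eu N)) : Prop :=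
  ∀ x₀ ∈ frontier Ω, ∃ r : ℝ, 0 < r ∧ ∃ ν : Eu N, ‖ν‖ = 1 ∧ ∃ γ : Eu N → ℝ, ContDiff ℝ 2 γ ∧
    ∀ x ∈ Metric.ball x₀ r, (x ∈ Ω ↔ γ (x - (inner ℝ ν x : ℝ) • ν) < inner ℝ ν x)

/-- A bounded domain (nonempty, open, connected set) of class `C²`. -/
structure IsBoundedC2Domain {N : ℕ} (Ω : Set (Eu N)) : Prop where
  isOpen : IsOpen Ω
  isConnected : IsConnected Ω
  isBounded : Bornology.IsBounded Ω
  boundary : HasC2Boundary Ω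

/-- The distance `δ(x)` to the boundary of `Ω`. -/
def δ {N : ℕ} (Ω : Set (Eu N)) (x : Eu N) : ℝ := Metric.infDist x (frontier Ω)

/-- The one-sided neighbourhood `Ω_η = {x ∈ Ω : δ(x) < η}` of the boundary. -/
def nbhd {N : ℕ} (Ω : Set (Eu N)) (η : ℝ) : Set (Eu N) := {x | x ∈ Ω ∧ δ Ω x < η}

/-- The parallel surface `Σ_η = {x ∈ Ω : δ(x) = η}`. -/
def parallelSurface {N : ℕ} (Ω : Set (Eu N)) (η : ℝ) : Set (Eu N) := {x | x ∈ Ω ∧ δ Ω x = η}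

/-- `A₁(t) = log (R / t)`. -/
def A₁ (R t : ℝ) : ℝ := Real.log (R / t)

/-- `A₂(t) = log A₁(t)`. -/
def A₂ (R t : ℝ) : ℝ := Real.log (A₁ R t)

/-- The constant `Λ_{α,p}`. -/
def Λ (α p : ℝ) : ℝ := if α = 1 - 1 / p then (1 - 1 / p) ^ p else |1 - 1 / p - α| ^ p

/-- The measure `δ(x)^{αp} dx` on `Ω`; its `L^p` space is `L^p(Ω, δ^{pα})`. -/
def weightedMeasure {N : ℕ} (Ω : Set (Eu N)) (α p : ℝ) : Measure (Eu N) :=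
  (volume.restrict Ω).withDensity fun x => ENNReal.ofReal (δ Ω x ^ (α * p))

/-- The surface measure of `Σ_η`: the normalized `(N-1)`-dimensional Hausdorff measure,
restricted to `Σ_η` (the counting measure when `N = 1`). -/
def surfaceMeasure {N : ℕ} (Ω : Set (Eu N)) (η : ℝ) : Measure (Eu N) :=
  (Measure.euclideanHausdorffMeasure (N - 1)).restrict (parallelSurface Ω η)

/-- `φ ∈ C_c^∞(Ω)`. -/
def IsTestFunction {N : ℕ} (Ω : Set (Eu N)) (φ : Eu N → ℝ) : Prop :=
  ContDiff ℝ ((⊤ : ℕ∞) : WithTop ℕ∞) φ ∧ HasCompactSupport φ ∧ tsupport φ ⊆ Ω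

/-- Test functions `φ k ∈ C_c^∞(Ω)` converge to `u`, with gradient `g`, in the norm
`‖ |∇u| ‖_{L^p(Ω, δ^{pα})} + ‖u‖_{L^p(Ω, δ^{pα})}`. -/
def TestApproximates {N : ℕ} (Ω : Set (Eu N)) (α p : ℝ) (φ : ℕ → Eu N → ℝ)
    (u : Eu N → ℝ) (g : Eu N → Eu N) : Prop :=
  (∀ k, IsTestFunction Ω (φ k)) ∧
    Tendsto (fun k =>
      eLpNorm (fun x => ∇ (φ k) x - g x) (ENNReal.ofReal p) (weightedMeasure Ω α p) +
      eLpNorm (fun x => φ k x - u x) (ENNReal.ofReal p) (weightedMeasure Ω α p)) atTop (𝓝 0)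

/-- `u ∈ W^{1,p}_{α,0}(Ω)` with gradient `∇u = g`. The completion of `C_c^∞(Ω)` is realized as
the closure of `{(φ, ∇φ)}` in the Banach space `L^p(Ω, δ^{pα}) × L^p(Ω, δ^{pα}; ℝ^N)`. Since `δ`
is bounded above and below by positive constants on compact subsets of `Ω`, for such a pair `g` is
the weak gradient of `u` in `Ω`; in particular `u` determines `g` almost everywhere in `Ω`. -/
def MemW {N : ℕ} (Ω : Set (Eu N)) (α p : ℝ) (u : Eu N → ℝ) (g : Eu N → Eu N) : Prop :=
  MemLp u (ENNReal.ofReal p) (weightedMeasure Ω α p) ∧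
  MemLp g (ENNReal.ofReal p) (weightedMeasure Ω α p) ∧
  ∃ φ : ℕ → Eu N → ℝ, TestApproximates Ω α p φ u g

/-- `τ` is the trace on `Σ_η` of `u ∈ W^{1,p}_{α,0}(Ω)` (with `∇u = g`), that is, the value at `u`
of the continuous extension to `W^{1,p}_{α,0}(Ω)`, with values in `L^p(Σ_η)`, of the restriction
map `φ ↦ φ|_{Σ_η}` on `C_c^∞(Ω)`. (The weight `δ^{αp}` is constant on `Σ_η`.) As every `u` in the
space is approximated by some sequence of test functions, `τ` is unique almost everywhere on
`Σ_η`. -/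
def IsTrace {N : ℕ} (Ω : Set (Eu N)) (α p η : ℝ) (u : Eu N → ℝ) (g : Eu N → Eu N)
    (τ : Eu N → ℝ) : Prop :=
  MemLp τ (ENNReal.ofReal p) (surfaceMeasure Ω η) ∧
  ∀ φ : ℕ → Eu N → ℝ, TestApproximates Ω α p φ u g →
    Tendsto (fun k => eLpNorm (fun x => φ k x - τ x) (ENNReal.ofReal p) (surfaceMeasure Ω η))
      atTop (𝓝 0)

end CriticalHardy

end

/-!
The proof tests against a vector field. Near the boundary take `q(δ) ∇δ`, where `q` comes from a
radial supersolution `δ^(-β)` (for `α > 1 - 1/p`) or `A₁(δ)^(1 - 1/p)` (for `α = 1 - 1/p`),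
perturbed by a factor `1 + a / A₁(δ)`, respectively `1 + a / A₂(δ)`. If `Δδ ≥ -K`, the divergence
of the field is at least `q'(δ) - K q(δ)`. Integration by parts against `|u|^p` and Young's
inequality then bound `∫ V(δ) |u|^p` by `∫ |∇u|^p δ^(αp)` plus a multiple of the integral of `|u|^p`
over `Σ_η`, with `V = q' - K q - (p - 1) z`, `q^p ≤ δ^(αp) z^(p-1)`. The perturbation yields in `V`
the remainder with `1 / A₁²` or `1 / A₂²` beyond the Hardy term; the curvature term `K q` is of
lower order as `δ → 0` (`exists_radialField_supercritical`, `exists_radialField_critical`).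

The regularity of `δ` enters only through one-sided bounds. A `C²` boundary has touching balls of a
uniform radius `ρ` (`exists_uniform_isPatch`). The inner balls make `δ` semiconvex
(`semiconvex_δ`), so that `Δδ ≥ -2N/ρ` holds weakly: this follows from difference quotients and
Rademacher's theorem, without second derivatives of `δ` (`integral_deriv_comp_δ_le`).

The boundary term arises from a cutoff in the shell `η - ε ≤ δ ≤ η`. In a patch `δ` grows at a
definite rate in a fixed direction `ν` (`δ_growth`), so `Σ_η` is there a Lipschitz graph over
`ν^⊥`, and Fubini's theorem compares shell and surface (`exists_parallelSurface_bounds`). The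
comparison constant `C` depends on `Ω`, while `L` may not. But `η₀` may depend on `Ω`: with a
factor `1 / η` in `L`, the constant is absorbed as soon as `η` is at most a multiple of `1 / C`
(`exists_hardy_of_radialField`).

The same graphs give the `L¹` trace inequality, applied to `|φ|^p`, and hence the trace operator
(`exists_trace_bound`, `exists_isTrace`). The inequality passes from test functions to
`W^{1,p}_{α,0}(Ω)` by Fatou's lemma along an almost everywhere convergent subsequence, which also
proves that the integrals are finite (`hardy_of_forall_isTestFunction`).
-/

namespace CriticalHardy

/-! ### Touching balls at the boundary -/

/-- Balls of radius `ρ` touching the boundary of `Ω` at `y` from inside and from outside, with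
inner unit normal `n`. -/
def TouchingBalls {N : ℕ} (Ω : Set (Eu N)) (ρ : ℝ) (y n : Eu N) : Prop :=
  ‖n‖ = 1 ∧ Metric.ball (y + ρ • n) ρ ⊆ Ω ∧ Disjoint (Metric.ball (y - ρ • n) ρ) Ω

/-- All boundary points within distance `r` of `x₀` admit touching balls of radius `ρ` whose
normals make with the fixed unit vector `ν` an angle of cosine at least `c`. -/
def IsPatch {N : ℕ} (Ω : Set (Eu N)) (ρ c r : ℝ) (ν x₀ : Eu N) : Prop :=
  ‖ν‖ = 1 ∧ ∀ y ∈ frontier Ω, dist y x₀ < r → ∃ n, TouchingBalls Ω ρ y n ∧ c ≤ inner ℝ ν n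

lemma exists_taylor_bound {E : Type*} [NormedAddCommGroup E] [NormedSpace ℝ E] {γ : E → ℝ}
    (hγ : ContDiff ℝ 2 γ) (x₀ : E) :
    ∃ M > 0, ∃ r > 0, (∀ a ∈ Metric.ball x₀ r, ‖fderiv ℝ γ a‖ ≤ M) ∧
      ∀ a ∈ Metric.ball x₀ r, ∀ b ∈ Metric.ball x₀ r,
        |γ b - γ a - fderiv ℝ γ a (b - a)| ≤ M * ‖b - a‖ ^ 2 := by
  have hd : ContDiff ℝ 1 (fderiv ℝ γ) := hγ.fderiv_right (by norm_num)
  obtain ⟨K, t, ht, hK⟩ := hd.contDiffAt.exists_lipschitzOnWith (x := x₀)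
  obtain ⟨r, hr, hrt⟩ := Metric.mem_nhds_iff.1 ht
  set M : ℝ := K * (2 * r) + ‖fderiv ℝ γ x₀‖ + K + 1 with hM
  have hx₀ : x₀ ∈ t := hrt (Metric.mem_ball_self hr)
  refine ⟨M, by positivity, r, hr, ?_, ?_⟩
  · intro a ha
    have h1 := hK.norm_sub_le (hrt ha) hx₀
    have h2 : ‖a - x₀‖ ≤ 2 * r := by
      rw [← dist_eq_norm]; linarith [Metric.mem_ball.1 ha]
    have h3 : ‖fderiv ℝ γ a‖ ≤ ‖fderiv ℝ γ a - fderiv ℝ γ x₀‖ + ‖fderiv ℝ γ x₀‖ := by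
      simpa using norm_add_le (fderiv ℝ γ a - fderiv ℝ γ x₀) (fderiv ℝ γ x₀)
    have h4 : (K : ℝ) * ‖a - x₀‖ ≤ K * (2 * r) := by gcongr
    have : (0 : ℝ) ≤ K := K.2
    linarith
  · intro a ha b hb
    have hseg : segment ℝ a b ⊆ Metric.ball x₀ r := (convex_ball x₀ r).segment_subset ha hb
    have key := Convex.norm_image_sub_le_of_norm_hasFDerivWithin_le
      (f := fun x => γ x - fderiv ℝ γ a x) (f' := fun x => fderiv ℝ γ x - fderiv ℝ γ a)
      (s := segment ℝ a b) (C := K * ‖b - a‖) (x := a) (y := b) (𝕜 := ℝ)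
      (fun x _ => (((hγ.differentiable (by norm_num)) x).hasFDerivAt.sub
        (fderiv ℝ γ a).hasFDerivAt).hasFDerivWithinAt)
      (fun x hx => (hK.norm_sub_le (hrt (hseg hx)) (hrt ha)).trans (by
        gcongr
        obtain ⟨θ, hθ, rfl⟩ := segment_eq_image' ℝ a b ▸ hx
        simp only [add_sub_cancel_left, norm_smul, Real.norm_eq_abs, abs_of_nonneg hθ.1]
        exact mul_le_of_le_one_left (norm_nonneg _) hθ.2))
      (convex_segment a b) (left_mem_segment ℝ a b) (right_mem_segment ℝ a b)
    rw [Real.norm_eq_abs] at key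
    have e : γ b - γ a - fderiv ℝ γ a (b - a)
        = γ b - fderiv ℝ γ a b - (γ a - fderiv ℝ γ a a) := by
      rw [map_sub]; ring
    rw [e]
    refine key.trans ?_
    rw [mul_assoc, ← sq]
    gcongr
    have : (0 : ℝ) ≤ K * (2 * r) := by positivity
    have := norm_nonneg (fderiv ℝ γ x₀)
    linarith

lemma norm_sub_inner_smul_le {E : Type*} [NormedAddCommGroup E] [InnerProductSpace ℝ E] {ν : E}
    (hν : ‖ν‖ = 1) (v : E) : ‖v - (inner ℝ ν v : ℝ) • ν‖ ≤ ‖v‖ := by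
  have h : ‖v - (inner ℝ ν v : ℝ) • ν‖ ^ 2 ≤ ‖v‖ ^ 2 := by
    rw [norm_sub_sq_real, norm_smul, hν, inner_smul_right, real_inner_comm, Real.norm_eq_abs,
      mul_one, sq_abs]
    nlinarith [sq_nonneg (inner ℝ v ν : ℝ)]
  exact le_of_sq_le_sq h (norm_nonneg _)

lemma TouchingBalls.mono {N : ℕ} {Ω : Set (Eu N)} {ρ ρ' : ℝ} {y n : Eu N}
    (h : TouchingBalls Ω ρ y n) (hρ : ρ' ≤ ρ) : TouchingBalls Ω ρ' y n := by
  obtain ⟨hn, h1, h2⟩ := h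
  refine ⟨hn, (Metric.ball_subset_ball' ?_).trans h1, h2.mono_left (Metric.ball_subset_ball' ?_)⟩
  · rw [dist_add_left, dist_eq_norm, ← sub_smul, norm_smul, hn, Real.norm_eq_abs,
      abs_of_nonpos (by linarith)]
    linarith
  · rw [dist_sub_left, dist_eq_norm, ← sub_smul, norm_smul, hn, Real.norm_eq_abs,
      abs_of_nonpos (by linarith)]
    linarith

lemma IsPatch.mono {N : ℕ} {Ω : Set (Eu N)} {ρ ρ' c c' r r' : ℝ} {ν x₀ x₁ : Eu N}
    (h : IsPatch Ω ρ c r ν x₀) (hρ : ρ' ≤ ρ) (hc : c' ≤ c) (hr : r' + dist x₁ x₀ ≤ r) :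
    IsPatch Ω ρ' c' r' ν x₁ := by
  refine ⟨h.1, fun y hy hyr => ?_⟩
  obtain ⟨n, hn, hcn⟩ := h.2 y hy (by linarith [dist_triangle y x₁ x₀])
  exact ⟨n, hn.mono hρ, hc.trans hcn⟩

/-- A `C²` graph separates the two balls of a small radius that touch it at a given point. -/
lemma exists_isPatch {N : ℕ} {Ω : Set (Eu N)} (hΩ : IsOpen Ω) (hb : HasC2Boundary Ω)
    {x₀ : Eu N} (hx₀ : x₀ ∈ frontier Ω) :
    ∃ ρ > 0, ∃ c > 0, ∃ r > 0, ∃ ν, IsPatch Ω ρ c r ν x₀ := by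
  obtain ⟨r, hr, ν, hν, γ, hγ, hiff⟩ := hb x₀ hx₀
  set P : Eu N →L[ℝ] Eu N :=
    ContinuousLinearMap.id ℝ (Eu N) - (innerSL ℝ ν).smulRight ν with hP
  have hPa : ∀ v, P v = v - (inner ℝ ν v : ℝ) • ν := fun v => by simp [hP]
  have hPn : ∀ v, ‖P v‖ ≤ ‖v‖ := fun v => by rw [hPa]; exact norm_sub_inner_smul_le hν v
  have hPν : P ν = 0 := by rw [hPa, real_inner_self_eq_norm_sq, hν]; simp
  have hPball : ∀ x s, x ∈ Metric.ball x₀ s → P x ∈ Metric.ball (P x₀) s := by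
    intro x s hx
    rw [mem_ball_iff_norm, ← map_sub]
    exact (hPn _).trans_lt (mem_ball_iff_norm.1 hx)
  simp only [← hPa] at hiff
  -- Boundary points near `x₀` lie on the graph, since the points strictly below it are an open
  -- set outside `Ω`.
  have hfr : ∀ y ∈ frontier Ω, y ∈ Metric.ball x₀ r → γ (P y) = inner ℝ ν y := by
    intro y hy hyr
    have hyΩ : y ∉ Ω := fun h => (hΩ.frontier_eq ▸ hy).2 h
    refine le_antisymm ?_ (not_lt.1 fun h => hyΩ ((hiff y hyr).2 h))
    by_contra! hlt
    have hopen : IsOpen {x | inner ℝ ν x < γ (P x)} :=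
      isOpen_lt (by fun_prop) (hγ.continuous.comp P.continuous)
    have hnhds : {x | inner ℝ ν x < γ (P x)} ∩ Metric.ball x₀ r ∈ 𝓝 y :=
      (hopen.inter Metric.isOpen_ball).mem_nhds ⟨hlt, hyr⟩
    obtain ⟨z, hz, hzΩ⟩ := mem_closure_iff_nhds.1 (frontier_subset_closure hy) _ hnhds
    exact lt_asymm hz.1 ((hiff z hz.2).1 hzΩ)
  obtain ⟨M, hM, r₁, hr₁, hbd, htay⟩ := exists_taylor_bound hγ (P x₀)
  set r₂ := min r r₁ with hr₂
  have hr₂0 : 0 < r₂ := lt_min hr hr₁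
  -- The touching balls have diameter `2 ρ`: they stay inside the chart, and on them the Taylor
  -- error is dominated by the linear part.
  set ρ := min (r₂ / 4) (1 / (2 * M)) with hρ
  have hρ0 : 0 < ρ := by positivity
  have hρM : 2 * ρ * M ≤ 1 := by
    have : ρ ≤ 1 / (2 * M) := min_le_right _ _
    rw [le_div_iff₀ (by positivity)] at this
    linarith
  refine ⟨ρ, hρ0, 1 / (1 + M), by positivity, r₂ / 2, by positivity, ν, hν, ?_⟩
  intro y hy hyr
  have hyr₂ : y ∈ Metric.ball x₀ r₂ := by rw [Metric.mem_ball]; linarith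
  have hPy : P y ∈ Metric.ball (P x₀) r₁ :=
    hPball _ _ (Metric.ball_subset_ball (min_le_right _ _) hyr₂)
  -- `m` is the gradient at `y` of the defining function `x ↦ ⟪ν, x⟫ - γ (P x)`; normalized, it is
  -- the inner normal.
  set ℓ : Eu N →L[ℝ] ℝ := innerSL ℝ ν - (fderiv ℝ γ (P y)).comp P with hℓ
  set m : Eu N := (InnerProductSpace.toDual ℝ (Eu N)).symm ℓ with hm
  have hmv : ∀ v, inner ℝ m v = inner ℝ ν v - fderiv ℝ γ (P y) (P v) := by
    intro v
    rw [hm, InnerProductSpace.toDual_symm_apply]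
    simp [hℓ]
  have hmν : inner ℝ m ν = (1 : ℝ) := by
    rw [hmv, hPν, real_inner_self_eq_norm_sq, hν]; simp
  have hm1 : 1 ≤ ‖m‖ := by
    have := real_inner_le_norm m ν
    rw [hmν, hν] at this; linarith
  have hmM : ‖m‖ ≤ 1 + M := by
    rw [hm, LinearIsometryEquiv.norm_map]
    refine ContinuousLinearMap.opNorm_le_bound _ (by positivity) fun v => ?_
    have h1 : ‖(inner ℝ ν v : ℝ)‖ ≤ ‖v‖ := by
      have := norm_inner_le_norm (𝕜 := ℝ) ν v
      rwa [hν, one_mul] at this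
    have h2 : ‖fderiv ℝ γ (P y) (P v)‖ ≤ M * ‖v‖ :=
      ((fderiv ℝ γ (P y)).le_opNorm _).trans
        (mul_le_mul (hbd _ hPy) (hPn v) (norm_nonneg _) hM.le)
    calc ‖ℓ v‖ = ‖(inner ℝ ν v : ℝ) - fderiv ℝ γ (P y) (P v)‖ := by simp [hℓ]
      _ ≤ _ := (norm_sub_le _ _).trans (by linarith)
  set n : Eu N := ‖m‖⁻¹ • m with hn
  have hm0 : 0 < ‖m‖ := by linarith
  have hmn : m = ‖m‖ • n := by rw [hn, smul_smul, mul_inv_cancel₀ hm0.ne', one_smul]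
  have hn1 : ‖n‖ = 1 := by rw [hn, norm_smul, norm_inv, norm_norm, inv_mul_cancel₀ hm0.ne']
  -- The defining function of the graph against its linearization at `y`.
  have hF : ∀ x ∈ Metric.ball x₀ r₂,
      |(inner ℝ ν x - γ (P x)) - ‖m‖ * inner ℝ n (x - y)| ≤ M * ‖x - y‖ ^ 2 := by
    intro x hx
    have hPx : P x ∈ Metric.ball (P x₀) r₁ :=
      hPball _ _ (Metric.ball_subset_ball (min_le_right _ _) hx)
    have h1 := htay _ hPy _ hPx
    have h2 : ‖m‖ * inner ℝ n (x - y)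
        = inner ℝ ν x - inner ℝ ν y - fderiv ℝ γ (P y) (P x - P y) := by
      rw [← real_inner_smul_left, ← hmn, hmv, inner_sub_right, map_sub P]
    have h3 := hfr y hy (Metric.ball_subset_ball (min_le_left _ _) hyr₂)
    rw [h2, ← h3, show (inner ℝ ν x - γ (P x)) - (inner ℝ ν x - γ (P y)
      - fderiv ℝ γ (P y) (P x - P y)) = -(γ (P x) - γ (P y) - fderiv ℝ γ (P y) (P x - P y)) by ring,
      abs_neg]
    refine h1.trans ?_
    rw [← map_sub]
    gcongr
    exact hPn _
  have hclose : ∀ x, ‖x - y‖ ≤ 2 * ρ → x ∈ Metric.ball x₀ r₂ := by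
    intro x hx
    rw [Metric.mem_ball]
    have h1 : 2 * ρ ≤ r₂ / 2 := by linarith [min_le_left (r₂ / 4) (1 / (2 * M))]
    have h2 := dist_triangle x y x₀
    rw [dist_eq_norm x y] at h2
    linarith
  refine ⟨n, ⟨hn1, ?_, ?_⟩, ?_⟩
  · intro x hx
    rw [mem_ball_iff_norm, ← sub_sub] at hx
    have hxy : ‖x - y‖ ≤ 2 * ρ := by
      have := norm_add_le (x - y - ρ • n) (ρ • n)
      rw [sub_add_cancel, norm_smul, hn1, Real.norm_eq_abs, abs_of_pos hρ0] at this
      linarith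
    have hxr := hclose x hxy
    have h1 : ‖x - y - ρ • n‖ ^ 2 < ρ ^ 2 := by gcongr
    rw [norm_sub_sq_real, norm_smul, hn1, inner_smul_right, real_inner_comm, Real.norm_eq_abs,
      mul_one, sq_abs] at h1
    have h2 : ‖x - y‖ ^ 2 < 2 * ρ * inner ℝ n (x - y) := by linarith
    have h3 : 0 < (inner ℝ n (x - y) : ℝ) :=
      pos_of_mul_pos_right ((sq_nonneg _).trans_lt h2) (by positivity)
    have h4 : M * ‖x - y‖ ^ 2 < inner ℝ n (x - y) := by nlinarith
    have h5 : (inner ℝ n (x - y) : ℝ) ≤ ‖m‖ * inner ℝ n (x - y) := by nlinarith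
    have h6 := (abs_le.1 (hF x hxr)).1
    exact (hiff x (Metric.ball_subset_ball (min_le_left _ _) hxr)).2 (by linarith)
  · rw [Set.disjoint_left]
    intro x hx hxΩ
    rw [mem_ball_iff_norm, sub_sub_eq_add_sub, add_sub_right_comm] at hx
    have hxy : ‖x - y‖ ≤ 2 * ρ := by
      have := norm_sub_le (x - y + ρ • n) (ρ • n)
      rw [add_sub_cancel_right, norm_smul, hn1, Real.norm_eq_abs, abs_of_pos hρ0] at this
      linarith
    have hxr := hclose x hxy
    have h1 : ‖x - y + ρ • n‖ ^ 2 < ρ ^ 2 := by gcongr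
    rw [norm_add_sq_real, norm_smul, hn1, inner_smul_right, real_inner_comm, Real.norm_eq_abs,
      mul_one, sq_abs] at h1
    have h2 : ‖x - y‖ ^ 2 < 2 * ρ * -inner ℝ n (x - y) := by linarith
    have h3 : 0 < -(inner ℝ n (x - y) : ℝ) :=
      pos_of_mul_pos_right ((sq_nonneg _).trans_lt h2) (by positivity)
    have h4 : M * ‖x - y‖ ^ 2 < -inner ℝ n (x - y) := by nlinarith
    have h5 : -(inner ℝ n (x - y) : ℝ) ≤ ‖m‖ * -inner ℝ n (x - y) := by nlinarith
    have h6 := (abs_le.1 (hF x hxr)).2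
    have h7 := (hiff x (Metric.ball_subset_ball (min_le_left _ _) hxr)).1 hxΩ
    linarith
  · rw [hn, real_inner_smul_right, real_inner_comm, hmν, mul_one, ← one_div]
    exact one_div_le_one_div_of_le hm0 hmM

/-- By compactness of the boundary the constants of `exists_isPatch` may be taken uniform. -/
lemma exists_uniform_isPatch {N : ℕ} {Ω : Set (Eu N)} (hΩ : IsBoundedC2Domain Ω) :
    ∃ ρ > 0, ∃ c > 0, ∃ r > 0, ∀ x₀ ∈ frontier Ω, ∃ ν, IsPatch Ω ρ c r ν x₀ := by
  have hcomp : IsCompact (frontier Ω) :=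
    Metric.isCompact_of_isClosed_isBounded isClosed_frontier
      (hΩ.isBounded.closure.subset frontier_subset_closure)
  refine hcomp.induction_on
    (p := fun S => ∃ ρ > 0, ∃ c > 0, ∃ r > 0, ∀ x₀ ∈ S, ∃ ν, IsPatch Ω ρ c r ν x₀) ?_ ?_ ?_ ?_
  · exact ⟨1, one_pos, 1, one_pos, 1, one_pos, fun x₀ h => h.elim⟩
  · rintro S T hST ⟨ρ, hρ, c, hc, r, hr, h⟩
    exact ⟨ρ, hρ, c, hc, r, hr, fun x₀ hx₀ => h x₀ (hST hx₀)⟩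
  · rintro S T ⟨ρ, hρ, c, hc, r, hr, h⟩ ⟨ρ', hρ', c', hc', r', hr', h'⟩
    refine ⟨min ρ ρ', lt_min hρ hρ', min c c', lt_min hc hc', min r r', lt_min hr hr', ?_⟩
    rintro x₀ (hx | hx)
    · obtain ⟨ν, hν⟩ := h x₀ hx
      exact ⟨ν, hν.mono (min_le_left _ _) (min_le_left _ _) (by simp)⟩
    · obtain ⟨ν, hν⟩ := h' x₀ hx
      exact ⟨ν, hν.mono (min_le_right _ _) (min_le_right _ _) (by simp)⟩
  · intro x₀ hx₀
    obtain ⟨ρ, hρ, c, hc, r, hr, ν, h⟩ := exists_isPatch hΩ.isOpen hΩ.boundary hx₀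
    refine ⟨_, mem_nhdsWithin_of_mem_nhds (Metric.ball_mem_nhds x₀ (half_pos hr)),
      ρ, hρ, c, hc, r / 2, half_pos hr, fun x₁ hx₁ => ⟨ν, h.mono le_rfl le_rfl ?_⟩⟩
    linarith [Metric.mem_ball.1 hx₁]

/-! ### The distance to the boundary -/

lemma IsBoundedC2Domain.frontier_nonempty {N : ℕ} {Ω : Set (Eu N)} (hΩ : IsBoundedC2Domain Ω)
    (hN : 1 ≤ N) : (frontier Ω).Nonempty := by
  have : Nonempty (Fin N) := ⟨⟨0, hN⟩⟩
  refine nonempty_frontier_iff.2 ⟨hΩ.isConnected.nonempty, fun h => ?_⟩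
  exact NormedSpace.unbounded_univ ℝ (Eu N) (h ▸ hΩ.isBounded)

lemma lipschitzWith_δ {N : ℕ} (Ω : Set (Eu N)) : LipschitzWith 1 (δ Ω) :=
  Metric.lipschitz_infDist_pt _

lemma continuous_δ {N : ℕ} (Ω : Set (Eu N)) : Continuous (δ Ω) := (lipschitzWith_δ Ω).continuous

lemma δ_nonneg {N : ℕ} (Ω : Set (Eu N)) (x : Eu N) : 0 ≤ δ Ω x := Metric.infDist_nonneg

lemma δ_sub_le {N : ℕ} (Ω : Set (Eu N)) (x y : Eu N) : δ Ω x - ‖x - y‖ ≤ δ Ω y := by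
  have := (lipschitzWith_δ Ω).dist_le_mul x y
  rw [Real.dist_eq, dist_eq_norm] at this
  have := (abs_le.1 this).2
  simp at this
  linarith

lemma notMem_frontier_of_δ_pos {N : ℕ} {Ω : Set (Eu N)} {x : Eu N} (h : 0 < δ Ω x) :
    x ∉ frontier Ω := fun hx => by
  rw [δ, Metric.infDist_zero_of_mem hx] at h
  exact lt_irrefl _ h

lemma δ_pos {N : ℕ} {Ω : Set (Eu N)} (hΩ : IsBoundedC2Domain Ω) (hN : 1 ≤ N) {x : Eu N}
    (hx : x ∈ Ω) : 0 < δ Ω x :=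
  (isClosed_frontier.notMem_iff_infDist_pos (hΩ.frontier_nonempty hN)).1
    fun h => (hΩ.isOpen.frontier_eq ▸ h).2 hx

lemma subset_of_isPreconnected_of_disjoint_frontier {X : Type*} [TopologicalSpace X] {Ω S : Set X}
    (hΩ : IsOpen Ω) (hS : IsPreconnected S) (hd : Disjoint S (frontier Ω))
    (hne : (S ∩ Ω).Nonempty) : S ⊆ Ω := by
  refine hS.subset_left_of_subset_union hΩ isClosed_closure.isOpen_compl
    (disjoint_compl_right.mono_left subset_closure) (fun x hx => ?_) hne
  by_contra! h
  simp only [mem_union, mem_compl_iff, not_or, not_not] at h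
  exact Set.disjoint_left.1 hd hx (hΩ.frontier_eq ▸ ⟨h.2, h.1⟩)

lemma ball_δ_subset {N : ℕ} {Ω : Set (Eu N)} (hΩ : IsBoundedC2Domain Ω) (hN : 1 ≤ N) {x : Eu N}
    (hx : x ∈ Ω) : Metric.ball x (δ Ω x) ⊆ Ω :=
  subset_of_isPreconnected_of_disjoint_frontier hΩ.isOpen (convex_ball _ _).isPreconnected
    Metric.disjoint_ball_infDist ⟨x, Metric.mem_ball_self (δ_pos hΩ hN hx), hx⟩

lemma segment_subset_of_δ_pos {N : ℕ} {Ω : Set (Eu N)} (hΩ : IsBoundedC2Domain Ω)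
    {x v : Eu N} (hx : x ∈ Ω) {s : ℝ} (hs : 0 ≤ s) (h : ∀ t ∈ Icc 0 s, 0 < δ Ω (x + t • v)) :
    ∀ t ∈ Icc 0 s, x + t • v ∈ Ω := by
  have hc : IsPreconnected ((fun t : ℝ => x + t • v) '' Icc 0 s) :=
    isPreconnected_Icc.image _ (by fun_prop)
  have := subset_of_isPreconnected_of_disjoint_frontier hΩ.isOpen hc
    (Set.disjoint_left.2 (by
      rintro _ ⟨t, ht, rfl⟩
      exact notMem_frontier_of_δ_pos (h t ht)))
    ⟨x, ⟨0, ⟨le_rfl, hs⟩, by simp⟩, hx⟩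
  exact fun t ht => this ⟨t, ht, rfl⟩

/-- The segment from `x` to its nearest boundary point `y` is normal to the boundary: the ball
around `x` of radius `δ(x)` and the outer touching ball at `y` are disjoint, so the triangle
inequality between their centres is an equality. -/
lemma eq_add_smul_normal {N : ℕ} {Ω : Set (Eu N)} (hΩ : IsBoundedC2Domain Ω) (hN : 1 ≤ N)
    {x y n : Eu N} {ρ : ℝ} (hρ : 0 < ρ) (hx : x ∈ Ω) (hxy : δ Ω x = dist x y)
    (hn : TouchingBalls Ω ρ y n) : x = y + δ Ω x • n := by
  have hd := δ_pos hΩ hN hx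
  have hdisj : Disjoint (Metric.ball x (δ Ω x)) (Metric.ball (y - ρ • n) ρ) :=
    hn.2.2.symm.mono_left (ball_δ_subset hΩ hN hx)
  have h1 := (disjoint_ball_ball_iff hd hρ).1 hdisj
  have hn1 : ‖ρ • n‖ = ρ := by rw [norm_smul, hn.1, Real.norm_eq_abs, abs_of_pos hρ, mul_one]
  rw [dist_eq_norm] at h1 hxy
  have h2 : ‖(x - y) + ρ • n‖ = ‖x - y‖ + ‖ρ • n‖ := by
    refine le_antisymm (norm_add_le _ _) ?_
    rw [hn1, ← hxy]
    rwa [show x - (y - ρ • n) = x - y + ρ • n by abel] at h1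
  have h3 := (sameRay_iff_norm_add.2 h2).norm_smul_eq
  rw [hn1, ← hxy, smul_comm] at h3
  have h4 := smul_right_injective (Eu N) hρ.ne' h3
  rw [← sub_eq_iff_eq_add', ← h4]

lemma TouchingBalls.le_δ {N : ℕ} {Ω : Set (Eu N)} {ρ : ℝ} {y n : Eu N}
    (hn : TouchingBalls Ω ρ y n) (hΩ : IsBoundedC2Domain Ω) (hN : 1 ≤ N) (x' : Eu N) :
    ρ - ‖x' - (y + ρ • n)‖ ≤ δ Ω x' := by
  have hz : ρ ≤ δ Ω (y + ρ • n) := by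
    refine (Metric.le_infDist (hΩ.frontier_nonempty hN)).2 fun w hw => ?_
    by_contra! hlt
    exact (hΩ.isOpen.frontier_eq ▸ hw).2 (hn.2.1 (Metric.mem_ball'.2 hlt))
  have := δ_sub_le Ω (y + ρ • n) x'
  rw [norm_sub_rev] at this
  linarith

/-- Near the boundary, `δ` is touched from below by `x' ↦ ρ - ‖x' - z‖`, where `z` is the centre
of the inner touching ball at the nearest boundary point. -/
lemma exists_inner_center {N : ℕ} {Ω : Set (Eu N)} (hΩ : IsBoundedC2Domain Ω) (hN : 1 ≤ N)
    {ρ c r : ℝ} (hρ : 0 < ρ) {ν x₀ x : Eu N} (hp : IsPatch Ω ρ c r ν x₀) (hx : x ∈ Ω)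
    (hxr : dist x x₀ + δ Ω x < r) :
    ∃ z n : Eu N, ‖n‖ = 1 ∧ c ≤ inner ℝ ν n ∧ x - z = -((ρ - δ Ω x) • n) ∧
      ∀ x', ρ - ‖x' - z‖ ≤ δ Ω x' := by
  obtain ⟨y, hy, hxy⟩ := isClosed_frontier.exists_infDist_eq_dist (hΩ.frontier_nonempty hN) x
  change δ Ω x = _ at hxy
  obtain ⟨n, hn, hcn⟩ := hp.2 y hy (by
    have := dist_triangle_left y x₀ x
    linarith)
  have hxn := eq_add_smul_normal hΩ hN hρ hx hxy hn
  refine ⟨y + ρ • n, n, hn.1, hcn, ?_, fun x' => ?_⟩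
  · nth_rewrite 1 [hxn]
    module
  · exact hn.le_δ hΩ hN x'

/-- Uniform patches around every boundary point. -/
def HasUniformPatches {N : ℕ} (Ω : Set (Eu N)) (ρ c r : ℝ) : Prop :=
  0 < ρ ∧ 0 < c ∧ 0 < r ∧ ∀ x₀ ∈ frontier Ω, ∃ ν, IsPatch Ω ρ c r ν x₀

/-- Semiconvexity of `δ` near the boundary: `δ` is touched from below by a function whose second
differences are controlled because the centre of the inner touching ball is at distance at least
`ρ / 2`. -/
lemma semiconvex_δ {N : ℕ} {Ω : Set (Eu N)} (hΩ : IsBoundedC2Domain Ω) (hN : 1 ≤ N)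
    {ρ c r : ℝ} (hu : HasUniformPatches Ω ρ c r) {x : Eu N} (hx : x ∈ Ω) (hxρ : δ Ω x ≤ ρ / 2)
    (v : Eu N) : -(2 / ρ * ‖v‖ ^ 2) ≤ δ Ω (x + v) + δ Ω (x - v) - 2 * δ Ω x := by
  obtain ⟨hρ, hc, hr, hu⟩ := hu
  obtain ⟨y, hy, hxy⟩ := isClosed_frontier.exists_infDist_eq_dist (hΩ.frontier_nonempty hN) x
  change δ Ω x = _ at hxy
  obtain ⟨ν, hν⟩ := hu y hy
  obtain ⟨n, hn, -⟩ := hν.2 y hy (by simpa using hr)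
  have hxn := eq_add_smul_normal hΩ hN hρ hx hxy hn
  have hz := hn.le_δ hΩ hN
  set a := x - (y + ρ • n) with ha
  have ha' : a = -((ρ - δ Ω x) • n) := by
    rw [ha]; nth_rewrite 1 [hxn]; module
  have hna : ‖a‖ = ρ - δ Ω x := by
    rw [ha', norm_neg, norm_smul, hn.1, Real.norm_eq_abs, abs_of_nonneg (by linarith), mul_one]
  have h1 := hz (x + v)
  have h2 := hz (x - v)
  rw [show x + v - (y + ρ • n) = a + v by rw [ha]; abel] at h1
  rw [show x - v - (y + ρ • n) = a - v by rw [ha]; abel] at h2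
  have hap : 0 < ‖a‖ := by linarith
  have h3 : ‖a + v‖ + ‖a - v‖ ≤ 2 * ‖a‖ + 2 / ρ * ‖v‖ ^ 2 := by
    have hpar := parallelogram_law_with_norm ℝ a v
    have h4 : (‖a + v‖ + ‖a - v‖) ^ 2 ≤ (2 * ‖a‖ + 2 / ρ * ‖v‖ ^ 2) ^ 2 := by
      have h5 : ‖v‖ ^ 2 ≤ ‖a‖ * (2 / ρ * ‖v‖ ^ 2) := by
        rw [← mul_assoc]
        refine le_mul_of_one_le_left (sq_nonneg _) ?_
        rw [mul_div_assoc', le_div_iff₀ hρ]; linarith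
      nlinarith [sq_nonneg (‖a + v‖ - ‖a - v‖), sq_nonneg (2 / ρ * ‖v‖ ^ 2)]
    exact le_of_sq_le_sq h4 (by positivity)
  linarith

/-- Inside a patch, `δ` grows at a definite rate in the direction `ν`. -/
lemma δ_growth {N : ℕ} {Ω : Set (Eu N)} (hΩ : IsBoundedC2Domain Ω) (hN : 1 ≤ N)
    {ρ c r : ℝ} (hρ : 0 < ρ) (hc : 0 < c) {ν x₀ x : Eu N} (hp : IsPatch Ω ρ c r ν x₀)
    (hx : x ∈ Ω) (hxr : dist x x₀ + δ Ω x < r) (hxρ : δ Ω x ≤ ρ / 2) {s : ℝ} (hs : 0 ≤ s)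
    (hsρ : s ≤ c * ρ / 2) : δ Ω x + c / 2 * s ≤ δ Ω (x + s • ν) := by
  obtain ⟨z, n, hn, hcn, hxz, hz⟩ := exists_inner_center hΩ hN hρ hp hx hxr
  refine le_trans ?_ (hz _)
  have hc1 : c ≤ 1 := by
    have := real_inner_le_norm ν n
    rw [hp.1, hn] at this; linarith
  have hna : ‖x - z‖ = ρ - δ Ω x := by
    rw [hxz, norm_neg, norm_smul, hn, Real.norm_eq_abs, abs_of_nonneg (by linarith), mul_one]
  have h1 : ‖x + s • ν - z‖ ≤ ‖x - z‖ - c / 2 * s := by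
    have h2 : ‖x + s • ν - z‖ ^ 2 ≤ (‖x - z‖ - c / 2 * s) ^ 2 := by
      rw [show x + s • ν - z = (x - z) + s • ν by abel, norm_add_sq_real, norm_smul, hp.1,
        Real.norm_eq_abs, mul_one, sq_abs, inner_smul_right]
      have h3 : (inner ℝ (x - z) ν : ℝ) ≤ -(‖x - z‖ * c) := by
        rw [hna, hxz, inner_neg_left, real_inner_smul_left, real_inner_comm]
        have : 0 ≤ ρ - δ Ω x := by linarith
        nlinarith
      have h4 : s * inner ℝ (x - z) ν ≤ s * -(‖x - z‖ * c) := by gcongr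
      have h5 : s * s ≤ s * (‖x - z‖ * c) := by
        gcongr
        rw [hna]; nlinarith
      nlinarith [sq_nonneg (c / 2 * s)]
    refine le_of_sq_le_sq h2 ?_
    rw [hna]; nlinarith
  linarith

/-- Two points of one level set of `δ` in a patch differ mostly in directions orthogonal
to `ν`. -/
lemma inner_le_of_δ_eq {N : ℕ} {Ω : Set (Eu N)} (hΩ : IsBoundedC2Domain Ω) (hN : 1 ≤ N)
    {ρ c r : ℝ} (hρ : 0 < ρ) (hc : 0 < c) {ν x₀ x x' : Eu N} (hp : IsPatch Ω ρ c r ν x₀)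
    (hx : x ∈ Ω) (hxr : dist x x₀ + δ Ω x < r) (hxρ : δ Ω x ≤ ρ / 2) (hδ : δ Ω x' = δ Ω x)
    (hd : ‖x' - x‖ ≤ c * ρ / 2) :
    (inner ℝ ν (x' - x) : ℝ) ≤ 2 / c * ‖(x' - x) - (inner ℝ ν (x' - x) : ℝ) • ν‖ := by
  set s : ℝ := inner ℝ ν (x' - x) with hs
  rcases le_or_gt s 0 with h0 | h0
  · exact h0.trans (by positivity)
  have hs1 : s ≤ c * ρ / 2 := by
    have := real_inner_le_norm ν (x' - x)
    rw [hp.1, one_mul] at this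
    exact this.trans hd
  have h1 := δ_growth hΩ hN hρ hc hp hx hxr hxρ h0.le hs1
  have h2 := δ_sub_le Ω (x + s • ν) x'
  rw [hδ, norm_sub_rev, ← sub_sub] at h2
  rw [div_mul_eq_mul_div, le_div_iff₀ hc]
  linarith

/-- The eikonal equation: towards its nearest boundary point, `δ` decreases at unit speed. -/
lemma norm_fderiv_δ {N : ℕ} {Ω : Set (Eu N)} (hΩ : IsBoundedC2Domain Ω) (hN : 1 ≤ N) {x : Eu N}
    (hx : x ∈ Ω) (hd : DifferentiableAt ℝ (δ Ω) x) : ‖fderiv ℝ (δ Ω) x‖ = 1 := by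
  refine le_antisymm (by simpa using norm_fderiv_le_of_lipschitz ℝ (lipschitzWith_δ Ω)) ?_
  obtain ⟨y, hy, hxy⟩ := isClosed_frontier.exists_infDist_eq_dist (hΩ.frontier_nonempty hN) x
  change δ Ω x = _ at hxy
  have hpos := δ_pos hΩ hN hx
  have hn : ‖y - x‖ = δ Ω x := by rw [hxy, dist_eq_norm, norm_sub_rev]
  have hlim := (hd.hasFDerivAt.hasLineDerivAt (y - x)).tendsto_slope_zero_right
  have hle : fderiv ℝ (δ Ω) x (y - x) ≤ -δ Ω x := by
    refine le_of_tendsto hlim ?_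
    filter_upwards [Ioo_mem_nhdsGT (zero_lt_one' ℝ)] with t ht
    have h1 : δ Ω (x + t • (y - x)) ≤ (1 - t) * δ Ω x := by
      refine (Metric.infDist_le_dist_of_mem hy).trans_eq ?_
      rw [dist_eq_norm, show x + t • (y - x) - y = -((1 - t) • (y - x)) by module, norm_neg,
        norm_smul, hn, Real.norm_eq_abs, abs_of_pos (by linarith [ht.2])]
    rw [smul_eq_mul, inv_mul_le_iff₀ ht.1]
    linarith
  have h2 := (fderiv ℝ (δ Ω) x).le_opNorm (y - x)
  rw [hn, Real.norm_eq_abs] at h2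
  have h3 := neg_le_abs (fderiv ℝ (δ Ω) x (y - x))
  by_contra! hlt
  nlinarith

/-! ### Integration by parts against the semiconvex function `δ` -/

section
variable {E : Type*} [NormedAddCommGroup E] [NormedSpace ℝ E] [FiniteDimensional ℝ E]
  [MeasurableSpace E] [BorelSpace E] {μ : Measure E} [μ.IsAddHaarMeasure]

/-- The weak form of `∂²f/∂v² ≥ -K`, tested with a Lipschitz function `ζ ≥ 0`, for a Lipschitz
function `f` whose second differences in the direction `v` are bounded below on `{ζ ≠ 0}`. -/
lemma integral_lineDeriv_mul_lineDeriv_le {f ζ : E → ℝ} {C D : NNReal} (hf : LipschitzWith C f)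
    (hζ : LipschitzWith D ζ) (hζc : HasCompactSupport ζ) (hζ0 : ∀ x, 0 ≤ ζ x) (v : E) {K : ℝ}
    (hK : ∀ x, ζ x ≠ 0 → ∀ t : ℝ, 0 < t →
      -(K * t ^ 2) ≤ f (x + t • v) + f (x - t • v) - 2 * f x) :
    ∫ x, lineDeriv ℝ f x v * lineDeriv ℝ ζ x v ∂μ ≤ K * ∫ x, ζ x ∂μ := by
  have hlim : Tendsto (fun t : ℝ => ∫ x, (t⁻¹ • (f (x + t • v) - f x)) *
      (t⁻¹ • (ζ (x + t • v) - ζ x)) ∂μ) (𝓝[>] 0)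
      (𝓝 (∫ x, lineDeriv ℝ f x v * lineDeriv ℝ ζ x v ∂μ)) := by
    let T := Metric.cthickening ‖v‖ (tsupport ζ)
    have hT : IsCompact T := IsCompact.cthickening hζc
    apply tendsto_integral_filter_of_dominated_convergence
      (T.indicator (fun _ => (C * ‖v‖) * (D * ‖v‖)))
    · filter_upwards with t
      have := hf.continuous
      have := hζ.continuous
      exact (by fun_prop : Continuous _).aestronglyMeasurable
    · filter_upwards [Ioc_mem_nhdsGT zero_lt_one] with t ht
      filter_upwards with x
      by_cases hx : x ∈ T
      · rw [indicator_of_mem hx, norm_mul]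
        have aux : ∀ {g : E → ℝ} {B : NNReal}, LipschitzWith B g →
            ‖t⁻¹ • (g (x + t • v) - g x)‖ ≤ B * ‖v‖ := by
          intro g B hg
          rw [norm_smul, norm_inv, Real.norm_of_nonneg ht.1.le, inv_mul_le_iff₀ ht.1]
          refine (hg.norm_sub_le _ _).trans_eq ?_
          rw [add_sub_cancel_left, norm_smul, Real.norm_of_nonneg ht.1.le]; ring
        exact mul_le_mul (aux hf) (aux hζ) (norm_nonneg _) (by positivity)
      · have h1 : ζ x = 0 := by
          rw [← Function.notMem_support]
          contrapose hx
          exact Metric.self_subset_cthickening _ (subset_tsupport _ hx)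
        have h2 : ζ (x + t • v) = 0 := by
          rw [← Function.notMem_support]
          contrapose hx
          apply Metric.mem_cthickening_of_dist_le _ _ (‖v‖) (tsupport ζ) (subset_tsupport _ hx)
          simp only [dist_eq_norm, sub_add_cancel_left, norm_neg, norm_smul, Real.norm_eq_abs,
            abs_of_nonneg ht.1.le]
          exact mul_le_of_le_one_left (norm_nonneg v) ht.2
        simp [h1, h2, indicator_of_notMem hx]
    · rw [integrable_indicator_iff hT.measurableSet]
      exact continuousOn_const.integrableOn_compact hT
    · filter_upwards [hf.ae_lineDifferentiableAt v, hζ.ae_lineDifferentiableAt v] with x hx hx'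
      exact hx.hasLineDerivAt.tendsto_slope_zero_right.mul
        hx'.hasLineDerivAt.tendsto_slope_zero_right
  refine le_of_tendsto hlim ?_
  filter_upwards [self_mem_nhdsWithin] with t ht
  rw [mem_Ioi] at ht
  have hfc := hf.continuous
  have hζcont := hζ.continuous
  set A : E → ℝ := fun x => (f x - f (x - t • v)) * ζ x with hA
  set B : E → ℝ := fun x => (f (x + t • v) - f x) * ζ x with hB
  have hAi : Integrable A μ :=
    (by fun_prop : Continuous A).integrable_of_hasCompactSupport hζc.mul_left
  have hBi : Integrable B μ :=
    (by fun_prop : Continuous B).integrable_of_hasCompactSupport hζc.mul_left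
  have hζi : Integrable ζ μ := hζcont.integrable_of_hasCompactSupport hζc
  -- Summation by parts turns the product of difference quotients into a second difference.
  calc ∫ x, (t⁻¹ • (f (x + t • v) - f x)) * (t⁻¹ • (ζ (x + t • v) - ζ x)) ∂μ
      = ∫ x, t⁻¹ ^ 2 * (A (x + t • v) - B x) ∂μ := by
        congr 1 with x
        simp only [hA, hB, add_sub_cancel_right, smul_eq_mul]; ring
    _ = t⁻¹ ^ 2 * (∫ x, A x ∂μ - ∫ x, B x ∂μ) := by
        rw [integral_const_mul, integral_sub (hAi.comp_add_right _) hBi,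
          integral_add_right_eq_self A]
    _ = ∫ x, t⁻¹ ^ 2 * (A x - B x) ∂μ := by rw [integral_const_mul, integral_sub hAi hBi]
    _ ≤ ∫ x, K * ζ x ∂μ := by
        refine integral_mono ((hAi.sub hBi).const_mul _) (hζi.const_mul _) fun x => ?_
        simp only [hA, hB]
        by_cases hx : ζ x = 0
        · simp [hx]
        have h1 := hK x hx t ht
        have h2 := mul_le_mul_of_nonneg_right h1 (hζ0 x)
        rw [inv_pow, inv_mul_le_iff₀ (by positivity)]
        linarith
    _ = K * ∫ x, ζ x ∂μ := integral_const_mul _ _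

end

lemma sum_mul_apply_basis {ι E : Type*} [Fintype ι] [NormedAddCommGroup E] [InnerProductSpace ℝ E]
    [CompleteSpace E] (b : OrthonormalBasis ι ℝ E) (L L' : E →L[ℝ] ℝ) :
    ∑ i, L (b i) * L' (b i) = inner ℝ ((InnerProductSpace.toDual ℝ E).symm L)
      ((InnerProductSpace.toDual ℝ E).symm L') := by
  rw [← b.sum_inner_mul_inner]
  refine Finset.sum_congr rfl fun i _ => ?_
  rw [InnerProductSpace.toDual_symm_apply, real_inner_comm, InnerProductSpace.toDual_symm_apply]

lemma lipschitzWith_mul_of_bounded {X : Type*} [PseudoMetricSpace X] {f g : X → ℝ} {C D : NNReal}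
    {A B : ℝ} (hf : LipschitzWith C f) (hg : LipschitzWith D g) (hfb : ∀ x, |f x| ≤ A)
    (hgb : ∀ x, |g x| ≤ B) : ∃ L : NNReal, LipschitzWith L fun x => f x * g x := by
  refine ⟨Real.toNNReal (A * D + B * C), LipschitzWith.of_dist_le_mul fun x y => ?_⟩
  refine le_trans ?_ (mul_le_mul_of_nonneg_right (Real.le_coe_toNNReal _) dist_nonneg)
  have h1 := hf.dist_le_mul x y
  have h2 := hg.dist_le_mul x y
  have hA := (abs_nonneg _).trans (hfb x)
  rw [Real.dist_eq] at *
  calc |f x * g x - f y * g y| = |f x * (g x - g y) + g y * (f x - f y)| := by congr 1; ring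
    _ ≤ |f x| * |g x - g y| + |g y| * |f x - f y| := by
      simpa only [abs_mul] using abs_add_le (f x * (g x - g y)) (g y * (f x - f y))
    _ ≤ A * (D * dist x y) + B * (C * dist x y) := by
      gcongr
      · exact hfb x
      · exact (abs_nonneg _).trans (hgb y)
      · exact hgb y
    _ = _ := by ring

/-- The weak form of `Δδ ≥ -2N/ρ`, tested with `|φ|^p Q(δ)`; the term with `Q'` carries the factor
`|∇δ|² = 1`. -/
lemma integral_deriv_comp_δ_le {N : ℕ} {Ω : Set (Eu N)} (hΩ : IsBoundedC2Domain Ω) (hN : 1 ≤ N)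
    {ρ c r : ℝ} (hu : HasUniformPatches Ω ρ c r) {p : ℝ} (hp : 1 < p) {Q : ℝ → ℝ}
    (hQ : ContDiff ℝ 1 Q) (hQc : HasCompactSupport Q) (hQ0 : ∀ t, 0 ≤ Q t)
    (hQρ : ∀ t, Q t ≠ 0 → t ≤ ρ / 2) {φ : Eu N → ℝ} (hφ : IsTestFunction Ω φ) :
    ∫ x, |φ x| ^ p * deriv Q (δ Ω x) ≤
      ∫ x, (N * (2 / ρ) * |φ x| ^ p + p * |φ x| ^ (p - 1) * ‖fderiv ℝ φ x‖) * Q (δ Ω x) := by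
  have hφ1 : ContDiff ℝ 1 φ := hφ.1.of_le (by exact_mod_cast le_top)
  have hφd : Differentiable ℝ φ := hφ1.differentiable one_ne_zero
  set g : Eu N → ℝ := fun x => ‖φ x‖ ^ p with hg
  have hg1 : ContDiff ℝ 1 g := (contDiff_norm_rpow hp).comp hφ1
  have hsupp : ∀ {x}, φ x ≠ 0 → x ∈ Ω := fun {x} hx => hφ.2.2 (subset_tsupport _ hx)
  have hgc : HasCompactSupport g := by
    refine hφ.2.1.comp_left (g := fun t : ℝ => ‖t‖ ^ p) ?_
    simp [Real.zero_rpow (by linarith : p ≠ 0)]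
  have hg0 : ∀ x, 0 ≤ g x := fun x => by positivity
  obtain ⟨C₁, hgL⟩ := hg1.lipschitzWith_of_hasCompactSupport hgc one_ne_zero
  obtain ⟨C₂, hQL⟩ := hQ.lipschitzWith_of_hasCompactSupport hQc one_ne_zero
  obtain ⟨A, hA⟩ := hg1.continuous.bounded_above_of_compact_support hgc
  obtain ⟨B, hB⟩ := hQ.continuous.bounded_above_of_compact_support hQc
  have hδL := lipschitzWith_δ Ω
  have hδc := continuous_δ Ω
  obtain ⟨D, hζL⟩ := lipschitzWith_mul_of_bounded hgL (hQL.comp hδL) hA (fun x => hB (δ Ω x))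
  set ζ : Eu N → ℝ := fun x => g x * (Q ∘ δ Ω) x with hζ
  have hζc : HasCompactSupport ζ := hgc.mul_right
  have hζ0 : ∀ x, 0 ≤ ζ x := fun x => mul_nonneg (hg0 x) (hQ0 _)
  have hφ0 : ∀ {x}, g x ≠ 0 → φ x ≠ 0 := fun {x} h h' => h (by
    simp [hg, h', Real.zero_rpow (by linarith : p ≠ 0)])
  let b := EuclideanSpace.basisFun (Fin N) ℝ
  have hbound : ∑ i, ∫ x, lineDeriv ℝ (δ Ω) x (b i) * lineDeriv ℝ ζ x (b i)
      ≤ N * (2 / ρ) * ∫ x, ζ x := by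
    refine (Finset.sum_le_card_nsmul _ _ (2 / ρ * ∫ x, ζ x) fun i _ => ?_).trans_eq ?_
    · refine integral_lineDeriv_mul_lineDeriv_le hδL hζL hζc hζ0 (b i) fun x hx t ht => ?_
      have h1 := left_ne_zero_of_mul hx
      have h2 := right_ne_zero_of_mul hx
      have := semiconvex_δ hΩ hN hu (hsupp (hφ0 h1)) (hQρ _ h2) (t • b i)
      rwa [norm_smul, b.norm_eq_one, mul_one, Real.norm_eq_abs, sq_abs] at this
    · simp [nsmul_eq_mul, mul_assoc]
  have hint : ∀ i, Integrable (fun x => lineDeriv ℝ (δ Ω) x (b i) * lineDeriv ℝ ζ x (b i)) := by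
    intro i
    refine Integrable.bdd_mul (c := 1) ?_ ?_ (ae_of_all _ fun x => ?_)
    · refine (integrableOn_iff_integrable_of_support_subset fun x hx => ?_).1
        ((hζL.locallyIntegrable_lineDeriv (b i)).integrableOn_isCompact hζc)
      by_contra h
      have : ζ =ᶠ[𝓝 x] fun _ => 0 := notMem_tsupport_iff_eventuallyEq.1 h
      apply hx
      rw [this.lineDeriv_eq]
      simp [lineDeriv]
    · exact aestronglyMeasurable_lineDeriv hδc _
    · simpa [b.norm_eq_one] using norm_lineDeriv_le_of_lipschitz ℝ hδL (x₀ := x) (v := b i)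
  rw [← integral_finsetSum _ fun i _ => hint i] at hbound
  have hdQ : Continuous (deriv Q) := hQ.continuous_deriv le_rfl
  have hdφ : Continuous (fderiv ℝ φ) := hφ1.continuous_fderiv one_ne_zero
  have hi1 : Integrable fun x => g x * deriv Q (δ Ω x) :=
    (hg1.continuous.mul (hdQ.comp hδc)).integrable_of_hasCompactSupport hgc.mul_right
  have hi2 : Integrable fun x => (p * |φ x| ^ (p - 1) * ‖fderiv ℝ φ x‖) * Q (δ Ω x) := by
    refine Continuous.integrable_of_hasCompactSupport ?_ ?_
    · have hc : Continuous fun x => |φ x| ^ (p - 1) :=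
        hφ1.continuous.abs.rpow_const fun x => Or.inr (by linarith)
      have := hQ.continuous
      fun_prop
    · refine HasCompactSupport.mul_right (HasCompactSupport.mul_right ?_)
      refine hφ.2.1.comp_left (g := fun t : ℝ => p * |t| ^ (p - 1)) ?_
      simp [Real.zero_rpow (by linarith : p - 1 ≠ 0)]
  have hi3 : Integrable ζ := hζL.continuous.integrable_of_hasCompactSupport hζc
  have hpt : ∀ᵐ x : Eu N, g x * deriv Q (δ Ω x) -
      (p * |φ x| ^ (p - 1) * ‖fderiv ℝ φ x‖) * Q (δ Ω x) ≤
      ∑ i, lineDeriv ℝ (δ Ω) x (b i) * lineDeriv ℝ ζ x (b i) := by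
    filter_upwards [hδL.ae_differentiableAt] with x hx
    have hgx : HasFDerivAt g (fderiv ℝ g x) x :=
      (hg1.differentiable one_ne_zero x).hasFDerivAt
    have hQx : HasFDerivAt (Q ∘ δ Ω) (deriv Q (δ Ω x) • fderiv ℝ (δ Ω) x) x :=
      ((hQ.differentiable one_ne_zero _).hasDerivAt).comp_hasFDerivAt x hx.hasFDerivAt
    have hζx : HasFDerivAt ζ _ x := hgx.mul hQx
    have hsum : ∑ i, lineDeriv ℝ (δ Ω) x (b i) * lineDeriv ℝ ζ x (b i) =
        g x * deriv Q (δ Ω x) * ∑ i, fderiv ℝ (δ Ω) x (b i) * fderiv ℝ (δ Ω) x (b i) +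
        Q (δ Ω x) * ∑ i, fderiv ℝ (δ Ω) x (b i) * fderiv ℝ g x (b i) := by
      rw [Finset.mul_sum, Finset.mul_sum, ← Finset.sum_add_distrib]
      refine Finset.sum_congr rfl fun i _ => ?_
      rw [(hx.hasFDerivAt.hasLineDerivAt _).lineDeriv, (hζx.hasLineDerivAt _).lineDeriv]
      simp only [add_apply, smul_apply, smul_eq_mul,
        Function.comp]
      ring
    rw [hsum, sum_mul_apply_basis, sum_mul_apply_basis]
    set d := (InnerProductSpace.toDual ℝ (Eu N)).symm (fderiv ℝ (δ Ω) x)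
    set e := (InnerProductSpace.toDual ℝ (Eu N)).symm (fderiv ℝ g x) with he
    have hd1 : ‖d‖ ≤ 1 := by
      rw [LinearIsometryEquiv.norm_map]
      simpa using norm_fderiv_le_of_lipschitz ℝ hδL (x₀ := x)
    have h1 : g x * deriv Q (δ Ω x) * inner ℝ d d = g x * deriv Q (δ Ω x) := by
      by_cases h : g x = 0
      · simp [h]
      · rw [real_inner_self_eq_norm_sq, LinearIsometryEquiv.norm_map,
          norm_fderiv_δ hΩ hN (hsupp (hφ0 h)) hx]
        simp
    have h2 : -(p * |φ x| ^ (p - 1) * ‖fderiv ℝ φ x‖) ≤ inner ℝ d e := by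
      have h3 := norm_fderiv_norm_rpow_le hφd (x := x) hp
      have h4 := abs_real_inner_le_norm d e
      rw [show ‖e‖ = ‖fderiv ℝ g x‖ from LinearIsometryEquiv.norm_map _ _] at h4
      have h5 := (abs_le.1 h4).1
      rw [Real.norm_eq_abs (φ x)] at h3
      have h6 : ‖d‖ * ‖fderiv ℝ g x‖ ≤ 1 * ‖fderiv ℝ g x‖ := by gcongr
      change ‖fderiv ℝ g x‖ ≤ _ at h3
      linarith
    rw [h1]
    nlinarith [mul_le_mul_of_nonneg_left h2 (hQ0 (δ Ω x))]
  have hmono := integral_mono_ae (hi1.sub hi2) (integrable_finsetSum _ fun i _ => hint i) hpt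
  simp only [Pi.sub_apply] at hmono
  rw [integral_sub hi1 hi2] at hmono
  have hsplit : ∫ x, (N * (2 / ρ) * |φ x| ^ p + p * |φ x| ^ (p - 1) * ‖fderiv ℝ φ x‖) *
      Q (δ Ω x) = N * (2 / ρ) * (∫ x, ζ x) +
      ∫ x, (p * |φ x| ^ (p - 1) * ‖fderiv ℝ φ x‖) * Q (δ Ω x) := by
    rw [← integral_const_mul, ← integral_add (hi3.const_mul _) hi2]
    congr 1 with x
    simp only [hζ, hg, Real.norm_eq_abs, Function.comp]
    ring
  rw [hsplit]
  have hfin := hmono.trans hbound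
  simp only [hg, Real.norm_eq_abs] at hfin
  linarith

/-! ### Graphs over a hyperplane and Hausdorff measure -/

section Graph

variable {N : ℕ} {ν : Eu N}

/-- The hyperplane orthogonal to `ν`. -/
noncomputable abbrev Hyp (ν : Eu N) : Submodule ℝ (Eu N) := (ℝ ∙ ν)ᗮ

/-- The orthogonal projection onto the hyperplane orthogonal to the unit vector `ν`. -/
noncomputable def toHyp (hν : ‖ν‖ = 1) (x : Eu N) : Hyp ν :=
  ⟨x - (inner ℝ ν x : ℝ) • ν, Submodule.mem_orthogonal_singleton_iff_inner_right.2 (by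
    rw [inner_sub_right, inner_smul_right, real_inner_self_eq_norm_sq, hν]; ring)⟩

lemma inner_hyp (e : Hyp ν) : inner ℝ ν (e : Eu N) = (0 : ℝ) :=
  Submodule.mem_orthogonal_singleton_iff_inner_right.1 e.2

lemma toHyp_add_smul (hν : ‖ν‖ = 1) (e : Hyp ν) (t : ℝ) : toHyp hν ((e : Eu N) + t • ν) = e := by
  ext1
  simp only [toHyp, inner_add_right, inner_hyp, inner_smul_right, real_inner_self_eq_norm_sq, hν]
  simp

lemma inner_hyp_add_smul (hν : ‖ν‖ = 1) (e : Hyp ν) (t : ℝ) :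
    inner ℝ ν ((e : Eu N) + t • ν) = t := by
  simp [inner_add_right, inner_hyp, inner_smul_right, hν]

lemma toHyp_sub (hν : ‖ν‖ = 1) (x y : Eu N) :
    ‖toHyp hν x - toHyp hν y‖ = ‖(x - y) - (inner ℝ ν (x - y) : ℝ) • ν‖ := by
  rw [← Submodule.norm_coe, Submodule.coe_sub]
  congr 1
  simp only [toHyp, inner_sub_right]
  module

lemma lipschitzWith_toHyp (hν : ‖ν‖ = 1) : LipschitzWith 1 (toHyp hν) :=
  LipschitzWith.of_dist_le_mul fun x y => by
    rw [dist_eq_norm, dist_eq_norm, toHyp_sub, NNReal.coe_one, one_mul]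
    exact norm_sub_inner_smul_le hν _

lemma finrank_hyp (hν : ‖ν‖ = 1) : Module.finrank ℝ (Hyp ν) = N - 1 := by
  have h0 : ν ≠ 0 := by rintro rfl; simp at hν
  have := (ℝ ∙ ν).finrank_add_finrank_orthogonal
  rw [finrank_span_singleton h0, finrank_euclideanSpace_fin] at this
  change 1 + Module.finrank ℝ (Hyp ν) = N at this
  omega

/-- Fubini's theorem along the lines of direction `ν`. -/
lemma lintegral_eq_lintegral_hyp (hν : ‖ν‖ = 1) {k : Eu N → ℝ≥0∞} (hk : Measurable k) :
    ∫⁻ x, k x = ∫⁻ e : Hyp ν, ∫⁻ t : ℝ, k ((e : Eu N) + t • ν) := by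
  have hmp := ((ℝ ∙ ν).measurePreserving_measurableEquivProd (0 : Eu N)).symm
  rw [InnerProductSpace.euclideanHausdorffMeasure_eq_volume] at hmp
  rw [← hmp.lintegral_comp hk, Measure.volume_eq_prod, lintegral_prod_symm]
  · refine lintegral_congr fun e => ?_
    rw [← (LinearIsometryEquiv.toSpanUnitSingleton ν hν).measurePreserving.lintegral_comp]
    · refine lintegral_congr fun t => ?_
      congr 1
      simp [add_comm]
    · fun_prop
  · exact (hk.comp (MeasurableEquiv.measurable _)).aemeasurable

lemma euclideanHausdorffMeasure_image_le {X Y : Type*} [MetricSpace X]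
    [MeasurableSpace X] [BorelSpace X] [MetricSpace Y] [MeasurableSpace Y] [BorelSpace Y]
    {K : NNReal} {f : X → Y} (hf : LipschitzWith K f) (d : ℕ) (s : Set X) :
    (Measure.euclideanHausdorffMeasure d : Measure Y) (f '' s) ≤
      (K : ℝ≥0∞) ^ (d : ℝ) * (Measure.euclideanHausdorffMeasure d : Measure X) s := by
  simp only [Measure.euclideanHausdorffMeasure_def, Measure.smul_apply]
  rw [mul_smul_comm]
  gcongr
  exact hf.hausdorffMeasure_image_le (Nat.cast_nonneg d) s

/-- A set whose chords have bounded slope relative to `ν` is contained in the graph over the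
hyperplane `ν^⊥` of a Lipschitz function `h`, with graph map `e ↦ e + h(e) ν`. -/
lemma exists_graph (hν : ‖ν‖ = 1) {S : Set (Eu N)} {K : NNReal}
    (hS : ∀ x ∈ S, ∀ x' ∈ S, (inner ℝ ν (x' - x) : ℝ) ≤ K * ‖toHyp hν x' - toHyp hν x‖) :
    ∃ h : Hyp ν → ℝ, LipschitzWith K h ∧
      ∀ x ∈ S, (toHyp hν x : Eu N) + h (toHyp hν x) • ν = x := by
  classical
  have hinj : InjOn (toHyp hν) S := by
    intro x hx x' hx' h
    have h1 := hS x hx x' hx'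
    have h2 := hS x' hx' x hx
    rw [h, sub_self, norm_zero, mul_zero, inner_sub_right] at h1 h2
    have h3 := congrArg (Subtype.val) h
    simp only [toHyp] at h3
    rw [show (inner ℝ ν x : ℝ) = inner ℝ ν x' by linarith] at h3
    exact sub_left_injective h3
  rcases S.eq_empty_or_nonempty with rfl | hne
  · exact ⟨fun _ => 0, LipschitzWith.const' 0, by simp⟩
  have : Nonempty (Eu N) := ⟨0⟩
  set h₀ : Hyp ν → ℝ := fun e => inner ℝ ν (Function.invFunOn (toHyp hν) S e) with hh₀
  have hinv : ∀ x ∈ S, Function.invFunOn (toHyp hν) S (toHyp hν x) = x := fun x hx =>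
    hinj.leftInvOn_invFunOn hx
  have hlip : LipschitzOnWith K h₀ (toHyp hν '' S) := by
    refine LipschitzOnWith.of_dist_le_mul ?_
    rintro _ ⟨x, hx, rfl⟩ _ ⟨x', hx', rfl⟩
    simp only [hh₀]
    rw [hinv x hx, hinv x' hx', Real.dist_eq, ← inner_sub_right, dist_eq_norm, abs_le]
    have h1 := hS x hx x' hx'
    rw [norm_sub_rev, ← neg_sub, inner_neg_right] at h1
    exact ⟨by linarith, hS x' hx' x hx⟩
  obtain ⟨h, hh, heq⟩ := hlip.extend_real
  refine ⟨h, hh, fun x hx => ?_⟩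
  rw [← heq ⟨x, hx, rfl⟩]
  simp only [hh₀]
  rw [hinv x hx]
  simp only [toHyp, sub_add_cancel]

lemma lipschitzWith_graph (hν : ‖ν‖ = 1) {K : NNReal} {h : Hyp ν → ℝ} (hh : LipschitzWith K h) :
    LipschitzWith (1 + K) fun e : Hyp ν => (e : Eu N) + h e • ν := by
  refine LipschitzWith.add (LipschitzWith.subtype_val _)
    (LipschitzWith.of_dist_le_mul fun e e' => ?_)
  rw [dist_eq_norm, ← sub_smul, norm_smul, hν, mul_one, ← dist_eq_norm]
  exact hh.dist_le_mul e e'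

/-- Surface integrals over a Lipschitz graph dominate integrals over its projection. -/
lemma lintegral_graph_le (hν : ‖ν‖ = 1) {S : Set (Eu N)} {K : NNReal}
    {h : Hyp ν → ℝ} (hh : LipschitzWith K h)
    (hgr : ∀ x ∈ S, (toHyp hν x : Eu N) + h (toHyp hν x) • ν = x) {G : Eu N → ℝ≥0∞}
    (hG : Measurable G) :
    ∫⁻ e in toHyp hν '' S, G ((e : Eu N) + h e • ν) ≤
      ∫⁻ x in S, G x ∂(Measure.euclideanHausdorffMeasure (N - 1)) := by
  have hσ := (lipschitzWith_graph hν hh).continuous.measurable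
  rw [← lintegral_map hG hσ]
  refine lintegral_mono' ?_ le_rfl
  refine Measure.le_iff.2 fun A hA => ?_
  rw [Measure.map_apply hσ hA, Measure.restrict_apply (hσ hA), Measure.restrict_apply hA,
    ← InnerProductSpace.euclideanHausdorffMeasure_eq_volume, finrank_hyp hν]
  have := euclideanHausdorffMeasure_image_le (lipschitzWith_toHyp hν) (N - 1) (A ∩ S)
  simp only [ENNReal.coe_one, ENNReal.one_rpow, one_mul] at this
  refine (measure_mono ?_).trans this
  rintro e ⟨heA, x, hx, rfl⟩
  rw [mem_preimage, hgr x hx] at heA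
  exact ⟨x, ⟨heA, hx⟩, rfl⟩

/-- Surface integrals over a Lipschitz graph are dominated by integrals over its projection. -/
lemma lintegral_le_lintegral_graph (hν : ‖ν‖ = 1) {S : Set (Eu N)} {K : NNReal}
    {h : Hyp ν → ℝ} (hh : LipschitzWith K h)
    (hgr : ∀ x ∈ S, (toHyp hν x : Eu N) + h (toHyp hν x) • ν = x) {G : Eu N → ℝ≥0∞}
    (hG : Measurable G) :
    ∫⁻ x in S, G x ∂(Measure.euclideanHausdorffMeasure (N - 1)) ≤
      ((1 + K : NNReal) : ℝ≥0∞) ^ ((N - 1 : ℕ) : ℝ) *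
        ∫⁻ e in toHyp hν '' S, G ((e : Eu N) + h e • ν) := by
  have hσl := lipschitzWith_graph hν hh
  have hσ := hσl.continuous.measurable
  rw [← lintegral_map hG hσ, ← smul_eq_mul, ← lintegral_smul_measure]
  refine lintegral_mono' ?_ le_rfl
  refine Measure.le_iff.2 fun A hA => ?_
  rw [Measure.smul_apply, Measure.map_apply hσ hA, Measure.restrict_apply (hσ hA),
    Measure.restrict_apply hA,
    ← InnerProductSpace.euclideanHausdorffMeasure_eq_volume, finrank_hyp hν, smul_eq_mul]
  refine (measure_mono ?_).trans (euclideanHausdorffMeasure_image_le hσl (N - 1) _)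
  rintro x ⟨hxA, hxS⟩
  exact ⟨toHyp hν x, ⟨by rwa [mem_preimage, hgr x hxS], x, hxS, rfl⟩, hgr x hxS⟩

end Graph

/-! ### Parallel surfaces: shells and traces -/

lemma isCompact_parallelSurface {N : ℕ} {Ω : Set (Eu N)} (hΩ : IsBoundedC2Domain Ω) {η : ℝ}
    (hη : 0 < η) : IsCompact (parallelSurface Ω η) := by
  have h : parallelSurface Ω η = closure Ω ∩ {x | δ Ω x = η} := by
    ext x
    refine ⟨fun hx => ⟨subset_closure hx.1, hx.2⟩, fun hx => ⟨?_, hx.2⟩⟩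
    by_contra hxΩ
    have hx2 : δ Ω x = η := hx.2
    exact notMem_frontier_of_δ_pos (hx2.symm ▸ hη) (hΩ.isOpen.frontier_eq ▸ ⟨hx.1, hxΩ⟩)
  rw [h]
  exact Metric.isCompact_of_isClosed_isBounded
    (isClosed_closure.inter (isClosed_eq (continuous_δ Ω) continuous_const))
    (hΩ.isBounded.closure.subset inter_subset_left)

/-- The part of the parallel surface inside a patch is a Lipschitz graph over `ν^⊥`, by
`exists_graph`. -/
lemma inner_sub_le_of_mem_surface {N : ℕ} {Ω : Set (Eu N)} (hΩ : IsBoundedC2Domain Ω) (hN : 1 ≤ N)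
    {ρ c r d η : ℝ} (hρ : 0 < ρ) (hc : 0 < c) {ν x₀ : Eu N} (hp : IsPatch Ω ρ c r ν x₀)
    (hν : ‖ν‖ = 1) (hdr : d + η < r) (hdρ : 2 * d ≤ c * ρ / 2) (hηρ : η ≤ ρ / 2) :
    ∀ x ∈ parallelSurface Ω η ∩ Metric.closedBall x₀ d,
      ∀ x' ∈ parallelSurface Ω η ∩ Metric.closedBall x₀ d,
        (inner ℝ ν (x' - x) : ℝ) ≤
          (2 / c).toNNReal * ‖toHyp hν x' - toHyp hν x‖ := by
  rintro x ⟨⟨hx, hxη⟩, hxd⟩ x' ⟨⟨hx', hxη'⟩, hxd'⟩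
  rw [Metric.mem_closedBall] at hxd hxd'
  rw [toHyp_sub, Real.coe_toNNReal _ (by positivity)]
  refine inner_le_of_δ_eq hΩ hN hρ hc hp hx (by linarith) (by linarith) (by rw [hxη, hxη']) ?_
  rw [← dist_eq_norm]
  linarith [dist_triangle_right x' x x₀]

/-- Points just below the level `η` are moved onto the parallel surface by a short translation
in the direction `ν`. -/
lemma exists_add_smul_mem_parallelSurface {N : ℕ} {Ω : Set (Eu N)} (hΩ : IsBoundedC2Domain Ω)
    (hN : 1 ≤ N) {ρ c r d η ε : ℝ} (hρ : 0 < ρ) (hc : 0 < c) {ν x₀ x : Eu N}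
    (hp : IsPatch Ω ρ c r ν x₀) (hdr : d + η < r) (hηρ : η ≤ ρ / 2) (hε : 0 ≤ ε)
    (hεd : 2 * ε / c ≤ d / 2) (hερ : 2 * ε / c ≤ c * ρ / 2) (hx : x ∈ Ω)
    (hx1 : η - ε ≤ δ Ω x) (hx2 : δ Ω x ≤ η) (hxd : x ∈ Metric.ball x₀ (d / 2)) :
    ∃ s ∈ Icc 0 (2 * ε / c), x + s • ν ∈ parallelSurface Ω η ∩ Metric.closedBall x₀ d := by
  rw [Metric.mem_ball] at hxd
  have hs0 : 0 ≤ 2 * ε / c := by positivity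
  have hgrow : ∀ s, 0 ≤ s → s ≤ 2 * ε / c → δ Ω x + c / 2 * s ≤ δ Ω (x + s • ν) :=
    fun s h0 h1 => δ_growth hΩ hN hρ hc hp hx (by linarith [δ_nonneg Ω x]) (by linarith) h0
      (h1.trans hερ)
  have hcont : ContinuousOn (fun s : ℝ => δ Ω (x + s • ν)) (Icc 0 (2 * ε / c)) := by
    have := continuous_δ Ω
    fun_prop
  have hmem : η ∈ Icc (δ Ω (x + (0 : ℝ) • ν)) (δ Ω (x + (2 * ε / c) • ν)) := by
    refine ⟨by simpa using hx2, ?_⟩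
    refine le_trans ?_ (hgrow _ hs0 le_rfl)
    rw [show c / 2 * (2 * ε / c) = ε by field_simp]
    linarith
  obtain ⟨s, hs, hsη⟩ := intermediate_value_Icc hs0 hcont hmem
  refine ⟨s, hs, ⟨?_, hsη⟩, ?_⟩
  · refine segment_subset_of_δ_pos hΩ hx hs.1 (fun t ht => ?_) s ⟨hs.1, le_rfl⟩
    have h1 := hgrow t ht.1 (ht.2.trans hs.2)
    have h2 := δ_pos hΩ hN hx
    have h3 : 0 ≤ c / 2 * t := mul_nonneg (by positivity) ht.1
    linarith
  · rw [Metric.mem_closedBall]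
    have h1 : dist (x + s • ν) x = s := by
      rw [dist_eq_norm, add_sub_cancel_left, norm_smul, hp.1, Real.norm_of_nonneg hs.1, mul_one]
    linarith [dist_triangle (x + s • ν) x x₀, hs.2]

/-- The integral over a thin shell below the parallel surface is bounded by the width of the shell
times a surface integral. -/
lemma lintegral_shell_patch_le {N : ℕ} {Ω : Set (Eu N)} (hΩ : IsBoundedC2Domain Ω)
    (hN : 1 ≤ N) {ρ c r d η ε : ℝ} (hρ : 0 < ρ) (hc : 0 < c) {ν x₀ : Eu N}
    (hp : IsPatch Ω ρ c r ν x₀) (hη : 0 < η) (hdr : d + η < r) (hdρ : 2 * d ≤ c * ρ / 2)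
    (hηρ : η ≤ ρ / 2) (hε : 0 ≤ ε) (hεd : 2 * ε / c ≤ d / 2) {g : Eu N → ℝ≥0∞} (hg : Measurable g)
    {θ : ℝ≥0∞} (hθ : ∀ x, ∀ s ∈ Icc 0 (2 * ε / c), g x ≤ g (x + s • ν) + θ) :
    ∫⁻ x in {x | x ∈ Ω ∧ η - ε ≤ δ Ω x ∧ δ Ω x ≤ η} ∩ Metric.ball x₀ (d / 2), g x ≤
      ENNReal.ofReal (2 * ε / c) *
        ∫⁻ x in parallelSurface Ω η ∩ Metric.closedBall x₀ d, (g x + θ)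
          ∂(Measure.euclideanHausdorffMeasure (N - 1)) := by
  have hs0 : 0 ≤ 2 * ε / c := by positivity
  have hν : ‖ν‖ = 1 := hp.1
  obtain ⟨h, hh, hgr⟩ := exists_graph hν
    (inner_sub_le_of_mem_surface hΩ hN hρ hc hp hν hdr hdρ hηρ)
  set S := parallelSurface Ω η ∩ Metric.closedBall x₀ d with hS
  set U := {x | x ∈ Ω ∧ η - ε ≤ δ Ω x ∧ δ Ω x ≤ η} ∩ Metric.ball x₀ (d / 2) with hU
  have hUm : MeasurableSet U := by
    refine MeasurableSet.inter ?_ Metric.isOpen_ball.measurableSet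
    exact hΩ.isOpen.measurableSet.inter
      ((measurableSet_le measurable_const (continuous_δ Ω).measurable).inter
        (measurableSet_le (continuous_δ Ω).measurable measurable_const))
  rw [← lintegral_indicator hUm, lintegral_eq_lintegral_hyp hν (hg.indicator hUm)]
  have hgθ : Measurable fun x => g x + θ := hg.add_const θ
  refine le_trans ?_ (mul_le_mul_right (lintegral_graph_le hν hh hgr hgθ) _)
  -- The line through `e` meets the shell only in the segment of length `2 ε / c` below the graph.
  have hkey : ∀ e : Hyp ν, ∀ t : ℝ, U.indicator g ((e : Eu N) + t • ν) ≤
      (toHyp hν '' S).indicator (fun e => (Icc (h e - 2 * ε / c) (h e)).indicator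
        (fun _ => g ((e : Eu N) + h e • ν) + θ) t) e := by
    intro e t
    by_cases hx : (e : Eu N) + t • ν ∈ U
    · obtain ⟨⟨hxΩ, hx1, hx2⟩, hxb⟩ := hx
      obtain ⟨s, hs, hsS⟩ := exists_add_smul_mem_parallelSurface hΩ hN hρ hc hp hdr hηρ hε hεd
        (by linarith [div_nonneg (mul_nonneg zero_le_two hε) hc.le]) hxΩ hx1 hx2 hxb
      have hgs := hgr _ hsS
      have hpt : (e : Eu N) + t • ν + s • ν = (e : Eu N) + (t + s) • ν := by module
      rw [hpt] at hsS hgs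
      rw [toHyp_add_smul] at hgs
      have hts : h e = t + s := by
        have := congrArg (fun y => (inner ℝ ν y : ℝ)) hgs
        simpa only [inner_hyp_add_smul hν] using this
      have heS : e ∈ toHyp hν '' S := ⟨_, hsS, toHyp_add_smul hν e _⟩
      have htI : t ∈ Icc (h e - 2 * ε / c) (h e) := by
        rw [hts]; exact ⟨by linarith [hs.2], by linarith [hs.1]⟩
      rw [indicator_of_mem heS, indicator_of_mem htI,
        indicator_of_mem (show (e : Eu N) + t • ν ∈ U from ⟨⟨hxΩ, hx1, hx2⟩, hxb⟩), hts, ← hpt]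
      exact hθ _ s hs
    · rw [indicator_of_notMem hx]
      exact zero_le
  have hσ := (lipschitzWith_graph hν hh).continuous.measurable
  have hSc : MeasurableSet (toHyp hν '' S) :=
    (((isCompact_parallelSurface hΩ hη).inter_right Metric.isClosed_closedBall).image
      (lipschitzWith_toHyp hν).continuous).isClosed.measurableSet
  calc ∫⁻ e : Hyp ν, ∫⁻ t : ℝ, U.indicator g ((e : Eu N) + t • ν)
      ≤ ∫⁻ e : Hyp ν, (toHyp hν '' S).indicator
          (fun e => ENNReal.ofReal (2 * ε / c) * (g ((e : Eu N) + h e • ν) + θ)) e := by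
        refine lintegral_mono fun e => ?_
        refine (lintegral_mono (hkey e)).trans ?_
        by_cases he : e ∈ toHyp hν '' S
        · simp only [indicator_of_mem he]
          rw [lintegral_indicator measurableSet_Icc, lintegral_const, Measure.restrict_apply_univ,
            Real.volume_Icc, sub_sub_cancel, mul_comm]
        · simp only [indicator_of_notMem he, lintegral_zero, le_refl]
    _ = _ := by
        rw [lintegral_indicator hSc, lintegral_const_mul]
        exact hgθ.comp hσ

lemma mul_le_integral_add_abs_deriv {f : ℝ → ℝ} (hf : ContDiff ℝ 1 f) {a : ℝ} (ha : 0 ≤ a) :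
    a * f 0 ≤ ∫ t in (0 : ℝ)..a, (f t + a * |deriv f t|) := by
  have hd : Continuous (deriv f) := hf.continuous_deriv le_rfl
  have hda : Continuous fun t => |deriv f t| := hd.abs
  have h1 : ∀ s ∈ Icc 0 a, f 0 ≤ f s + ∫ t in (0 : ℝ)..a, |deriv f t| := by
    intro s hs
    have h2 := intervalIntegral.integral_deriv_eq_sub' f rfl
      (fun x _ => hf.differentiable one_ne_zero x) hd.continuousOn (a := 0) (b := s)
    have h3 := intervalIntegral.norm_integral_le_integral_norm (f := deriv f) (μ := volume) hs.1
    have h4 : ∫ t in (0 : ℝ)..s, |deriv f t| ≤ ∫ t in (0 : ℝ)..a, |deriv f t| :=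
      intervalIntegral.integral_mono_interval le_rfl hs.1 hs.2
        (ae_of_all _ fun t => abs_nonneg _) (hda.intervalIntegrable _ _)
    rw [h2] at h3
    simp only [Real.norm_eq_abs] at h3
    linarith [(abs_le.1 h3).1]
  have h5 := intervalIntegral.integral_mono_on ha
    (intervalIntegrable_const (c := f 0) (μ := volume))
    ((hf.continuous.intervalIntegrable (μ := volume) 0 a).add
      (intervalIntegrable_const (c := ∫ t in (0 : ℝ)..a, |deriv f t|))) h1
  rw [intervalIntegral.integral_add (hf.continuous.intervalIntegrable _ _)
    intervalIntegrable_const] at h5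
  simp only [intervalIntegral.integral_const, smul_eq_mul, sub_zero] at h5
  rw [intervalIntegral.integral_add (hf.continuous.intervalIntegrable _ _)
    ((hda.intervalIntegrable _ _).const_mul a), intervalIntegral.integral_const_mul]
  exact h5

/-- The trace inequality in `L¹` on one patch of the parallel surface: a value on the surface is
compared with the values on the segment of length `c ρ / 2` above it. -/
lemma lintegral_parallelSurface_patch_le {N : ℕ} {Ω : Set (Eu N)} (hΩ : IsBoundedC2Domain Ω)
    (hN : 1 ≤ N) {ρ c r d η : ℝ} (hρ : 0 < ρ) (hc : 0 < c) {ν x₀ : Eu N}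
    (hp : IsPatch Ω ρ c r ν x₀) (hη : 0 < η) (hdr : d + η < r) (hdρ : 2 * d ≤ c * ρ / 2)
    (hηρ : η ≤ ρ / 2) {g : Eu N → ℝ} (hg : ContDiff ℝ 1 g) (hg0 : ∀ x, 0 ≤ g x) :
    ENNReal.ofReal (c * ρ / 2) *
      ∫⁻ x in parallelSurface Ω η ∩ Metric.closedBall x₀ d, ENNReal.ofReal (g x)
        ∂(Measure.euclideanHausdorffMeasure (N - 1)) ≤
      ((1 + (2 / c).toNNReal : NNReal) : ℝ≥0∞) ^ ((N - 1 : ℕ) : ℝ) *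
        ∫⁻ x in {x | x ∈ Ω ∧ η ≤ δ Ω x},
          ENNReal.ofReal (g x + c * ρ / 2 * ‖fderiv ℝ g x‖) := by
  have hν : ‖ν‖ = 1 := hp.1
  obtain ⟨h, hh, hgr⟩ := exists_graph hν
    (inner_sub_le_of_mem_surface hΩ hN hρ hc hp hν hdr hdρ hηρ)
  set a := c * ρ / 2 with ha
  have ha0 : 0 ≤ a := by positivity
  set S := parallelSurface Ω η ∩ Metric.closedBall x₀ d with hS
  set W := {x | x ∈ Ω ∧ η ≤ δ Ω x} with hW
  have hWm : MeasurableSet W := hΩ.isOpen.measurableSet.inter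
    (measurableSet_le measurable_const (continuous_δ Ω).measurable)
  set k : Eu N → ℝ := fun x => g x + a * ‖fderiv ℝ g x‖ with hk
  have hkc : Continuous k := by
    have := hg.continuous
    have := hg.continuous_fderiv one_ne_zero
    fun_prop
  have hgm : Measurable fun x => ENNReal.ofReal (g x) := hg.continuous.measurable.ennreal_ofReal
  have hkm : Measurable fun x => ENNReal.ofReal (k x) := hkc.measurable.ennreal_ofReal
  have hσ := (lipschitzWith_graph hν hh).continuous.measurable
  refine (mul_le_mul_right (lintegral_le_lintegral_graph hν hh hgr hgm) _).trans ?_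
  rw [mul_left_comm]
  gcongr
  have hgσ : Measurable fun e : Hyp ν => ENNReal.ofReal (g ((e : Eu N) + h e • ν)) := hgm.comp hσ
  rw [← lintegral_const_mul _ hgσ, ← lintegral_indicator hWm,
    lintegral_eq_lintegral_hyp hν (hkm.indicator hWm)]
  refine le_trans (setLIntegral_mono_ae' ?_ ?_) (setLIntegral_le_lintegral _ _)
  · exact (((isCompact_parallelSurface hΩ hη).inter_right Metric.isClosed_closedBall).image
      (lipschitzWith_toHyp hν).continuous).isClosed.measurableSet
  refine ae_of_all _ ?_
  rintro e ⟨x, hx, rfl⟩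
  have hgx := hgr x hx
  rw [hgx]
  have hmem : ∀ t ∈ Icc 0 a, x + t • ν ∈ W := by
    intro t ht
    have hxη : δ Ω x = η := hx.1.2
    have hxd := Metric.mem_closedBall.1 hx.2
    have hgrow : ∀ s, 0 ≤ s → s ≤ a → η ≤ δ Ω (x + s • ν) := fun s h0 h1 => by
      have := δ_growth hΩ hN hρ hc hp hx.1.1 (by linarith) (by linarith) h0 h1
      have : 0 ≤ c / 2 * s := by positivity
      linarith
    exact ⟨segment_subset_of_δ_pos hΩ hx.1.1 ht.1
      (fun s hs => hη.trans_le (hgrow s hs.1 (hs.2.trans ht.2))) t ⟨ht.1, le_rfl⟩,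
      hgrow t ht.1 ht.2⟩
  have hf : ContDiff ℝ 1 fun t : ℝ => g (x + t • ν) := hg.comp (by fun_prop)
  have h1 := mul_le_integral_add_abs_deriv hf ha0
  simp only [zero_smul, add_zero] at h1
  have hcont : Continuous fun t : ℝ => k (x + t • ν) := by fun_prop
  have hderiv : ∀ t : ℝ, |deriv (fun t : ℝ => g (x + t • ν)) t| ≤ ‖fderiv ℝ g (x + t • ν)‖ := by
    intro t
    have hl : HasDerivAt (fun t : ℝ => x + t • ν) ν t := by
      simpa using ((hasDerivAt_id t).smul_const ν).const_add x
    have := ((hg.differentiable one_ne_zero _).hasFDerivAt.comp_hasDerivAt t hl).deriv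
    change deriv (fun t : ℝ => g (x + t • ν)) t = _ at this
    rw [this]
    simpa [hν] using (fderiv ℝ g (x + t • ν)).le_opNorm ν
  have h2 : a * g x ≤ ∫ t in (0 : ℝ)..a, k (x + t • ν) := by
    refine h1.trans (intervalIntegral.integral_mono_on ha0 ?_ (hcont.intervalIntegrable _ _) ?_)
    · refine Continuous.intervalIntegrable ?_ _ _
      have := hf.continuous
      have := hf.continuous_deriv le_rfl
      fun_prop
    · intro t _
      simp only [hk]
      gcongr
      exact hderiv t
  have hk0 : ∀ y, 0 ≤ k y := fun y => add_nonneg (hg0 y) (by positivity)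
  rw [← ENNReal.ofReal_mul ha0]
  refine (ENNReal.ofReal_le_ofReal h2).trans ?_
  rw [intervalIntegral.integral_of_le ha0, ofReal_integral_eq_lintegral_ofReal
    (hcont.integrableOn_Icc.mono_set Ioc_subset_Icc_self) (ae_of_all _ fun t => hk0 _)]
  rw [← lintegral_add_right_eq_self (μ := (volume : Measure ℝ)) (fun t : ℝ =>
    W.indicator (fun x => ENNReal.ofReal (k x)) ((toHyp hν x : Eu N) + t • ν)) (h (toHyp hν x))]
  refine le_trans ?_ (setLIntegral_le_lintegral (Ioc 0 a) _)
  refine setLIntegral_mono_ae' measurableSet_Ioc (ae_of_all _ fun t ht => ?_)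
  have hpt : (toHyp hν x : Eu N) + (t + h (toHyp hν x)) • ν = x + t • ν := by
    nth_rewrite 3 [← hgx]; module
  rw [hpt, indicator_of_mem (hmem t ⟨ht.1.le, ht.2⟩)]

lemma exists_finite_patch_cover {N : ℕ} {Ω : Set (Eu N)} (hΩ : IsBoundedC2Domain Ω) (hN : 1 ≤ N)
    {d : ℝ} (hd : 0 < d) :
    ∃ T : Finset (Eu N), (∀ y ∈ T, y ∈ frontier Ω) ∧
      ∀ x, δ Ω x < d / 4 → ∃ y ∈ T, x ∈ Metric.ball y (d / 2) := by
  have hcomp : IsCompact (frontier Ω) :=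
    Metric.isCompact_of_isClosed_isBounded isClosed_frontier
      (hΩ.isBounded.closure.subset frontier_subset_closure)
  obtain ⟨t, ht, htf, hcov⟩ := hcomp.finite_cover_balls (by positivity : 0 < d / 4)
  refine ⟨htf.toFinset, fun y hy => ht (htf.mem_toFinset.1 hy), fun x hx => ?_⟩
  obtain ⟨z, hz, hxz⟩ := isClosed_frontier.exists_infDist_eq_dist (hΩ.frontier_nonempty hN) x
  change δ Ω x = _ at hxz
  obtain ⟨y, hy, hzy⟩ := mem_iUnion₂.1 (hcov hz)
  refine ⟨y, htf.mem_toFinset.2 hy, ?_⟩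
  rw [Metric.mem_ball] at *
  linarith [dist_triangle x z y]

/-- The parallel surfaces close to the boundary have finite area, satisfy an `L¹` trace inequality,
and dominate averages over thin shells; the constant depends on the domain only. -/
lemma exists_parallelSurface_bounds {N : ℕ} {Ω : Set (Eu N)} (hΩ : IsBoundedC2Domain Ω)
    (hN : 1 ≤ N) {ρ c r : ℝ} (hu : HasUniformPatches Ω ρ c r) :
    ∃ η₁ > 0, ∃ C : ℝ, 0 < C ∧ ∀ η, 0 < η → η < η₁ →
      surfaceMeasure Ω η univ ≠ ∞ ∧
      (∀ g : Eu N → ℝ, ContDiff ℝ 1 g → (∀ x, 0 ≤ g x) →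
        ∫⁻ x, ENNReal.ofReal (g x) ∂(surfaceMeasure Ω η) ≤ ENNReal.ofReal C *
          ∫⁻ x in {x | x ∈ Ω ∧ η ≤ δ Ω x},
            ENNReal.ofReal (g x + C * ‖fderiv ℝ g x‖)) ∧
      (∀ g : Eu N → ℝ, Continuous g → HasCompactSupport g → (∀ x, 0 ≤ g x) →
        ∀ θ > 0, ∃ ε₀ > 0, ∀ ε, 0 < ε → ε < ε₀ →
          ∫⁻ x in {x | x ∈ Ω ∧ η - ε ≤ δ Ω x ∧ δ Ω x ≤ η}, ENNReal.ofReal (g x) ≤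
            ENNReal.ofReal (C * ε) *
              (∫⁻ x, ENNReal.ofReal (g x) ∂(surfaceMeasure Ω η) + ENNReal.ofReal θ)) := by
  obtain ⟨hρ, hc, hr, hpatch⟩ := hu
  set d := min (r / 4) (c * ρ / 4) with hd
  have hd0 : 0 < d := by positivity
  have hdr : d ≤ r / 4 := min_le_left _ _
  have hdc : d ≤ c * ρ / 4 := min_le_right _ _
  obtain ⟨T, hTf, hTc⟩ := exists_finite_patch_cover hΩ hN hd0
  have hν : ∀ y : T, ∃ ν, IsPatch Ω ρ c r ν y := fun y => hpatch y (hTf y y.2)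
  choose ν hνp using hν
  set a := c * ρ / 2 with ha
  have ha0 : 0 < a := by positivity
  set B : NNReal := (1 + (2 / c).toNNReal) ^ ((N - 1 : ℕ) : ℝ) with hB
  set n : ℝ := (Fintype.card T : ℝ) with hn
  have hn0 : 0 ≤ n := Nat.cast_nonneg _
  -- `C` dominates the constants of the shell and trace estimates on one patch, summed over the
  -- `n` patches of the cover.
  set C : ℝ := n * (2 / c) + n * B / a + a + 1 with hC
  have hC1 : n * (2 / c) ≤ C := by
    have : 0 ≤ n * B / a := by positivity
    linarith
  have hC2 : n * B / a ≤ C := by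
    have : 0 ≤ n * (2 / c) := by positivity
    linarith
  have hC3 : a ≤ C := by
    have : 0 ≤ n * (2 / c) := by positivity
    have : 0 ≤ n * B / a := by positivity
    linarith
  have hC0 : 0 < C := ha0.trans_le hC3
  refine ⟨min (d / 4) (ρ / 2), by positivity, C, hC0, fun η hη hηlt => ?_⟩
  have hηd : η < d / 4 := hηlt.trans_le (min_le_left _ _)
  have hηρ : η ≤ ρ / 2 := hηlt.le.trans (min_le_right _ _)
  set H : Measure (Eu N) := Measure.euclideanHausdorffMeasure (N - 1) with hH
  set P := parallelSurface Ω η with hP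
  have hPc : IsCompact P := isCompact_parallelSurface hΩ hη
  have hcov : P ⊆ ⋃ y : T, P ∩ Metric.closedBall (y : Eu N) d := by
    intro x hx
    obtain ⟨y, hy, hxy⟩ := hTc x (by rw [hx.2]; exact hηd)
    refine mem_iUnion.2 ⟨⟨y, hy⟩, hx, Metric.ball_subset_closedBall
      (Metric.ball_subset_ball (by linarith) hxy)⟩
  have htrace : ∀ g : Eu N → ℝ, ContDiff ℝ 1 g → (∀ x, 0 ≤ g x) →
      ∫⁻ x, ENNReal.ofReal (g x) ∂(surfaceMeasure Ω η) ≤ ENNReal.ofReal C *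
        ∫⁻ x in {x | x ∈ Ω ∧ η ≤ δ Ω x}, ENNReal.ofReal (g x + C * ‖fderiv ℝ g x‖) := by
    intro g hg hg0
    set J := ∫⁻ x in {x | x ∈ Ω ∧ η ≤ δ Ω x}, ENNReal.ofReal (g x + a * ‖fderiv ℝ g x‖) with hJ
    have hpiece : ∀ y : T, ∫⁻ x in P ∩ Metric.closedBall (y : Eu N) d, ENNReal.ofReal (g x) ∂H ≤
        ENNReal.ofReal (B / a) * J := by
      intro y
      have h1 := lintegral_parallelSurface_patch_le hΩ hN hρ hc (hνp y) hη
        (by linarith : d + η < r) (by linarith) hηρ hg hg0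
      have hBe : ((1 + (2 / c).toNNReal : NNReal) : ℝ≥0∞) ^ ((N - 1 : ℕ) : ℝ) =
          ENNReal.ofReal (B : ℝ) := by
        rw [ENNReal.ofReal_coe_nnreal, hB, ENNReal.coe_rpow_of_nonneg _ (Nat.cast_nonneg _)]
      rw [hBe] at h1
      rw [ENNReal.ofReal_div_of_pos ha0, ENNReal.mul_div_right_comm.symm]
      rwa [ENNReal.le_div_iff_mul_le (Or.inl (by simpa using ha0)) (Or.inl ENNReal.ofReal_ne_top),
        mul_comm]
    calc ∫⁻ x, ENNReal.ofReal (g x) ∂(surfaceMeasure Ω η)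
        ≤ ∫⁻ x in ⋃ y : T, P ∩ Metric.closedBall (y : Eu N) d, ENNReal.ofReal (g x) ∂H :=
          lintegral_mono_set hcov
      _ ≤ ∑' y : T, ∫⁻ x in P ∩ Metric.closedBall (y : Eu N) d, ENNReal.ofReal (g x) ∂H :=
          lintegral_iUnion_le _ _
      _ ≤ ∑' _ : T, ENNReal.ofReal (B / a) * J := ENNReal.tsum_le_tsum hpiece
      _ = ENNReal.ofReal (n * B / a) * J := by
          rw [tsum_fintype, Finset.sum_const, Finset.card_univ, nsmul_eq_mul, ← mul_assoc,
            mul_div_assoc, ENNReal.ofReal_mul hn0, hn, ENNReal.ofReal_natCast]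
      _ ≤ _ := by
          gcongr
          rw [hJ]
          gcongr
  have hfin : surfaceMeasure Ω η univ ≠ ∞ := by
    -- The area is the integral of `1`.
    have h1 := htrace (fun _ => 1) contDiff_const (fun _ => zero_le_one)
    simp only [ENNReal.ofReal_one, lintegral_const, one_mul, fderiv_fun_const, Pi.zero_apply,
      norm_zero, mul_zero, add_zero, Measure.restrict_apply_univ] at h1
    refine (h1.trans_lt (ENNReal.mul_lt_top ENNReal.ofReal_lt_top ?_)).ne
    exact (hΩ.isBounded.subset fun x hx => hx.1).measure_lt_top
  refine ⟨hfin, htrace, fun g hg hgc hg0 θ hθ => ?_⟩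
  set m : ℝ := (surfaceMeasure Ω η univ).toReal with hm
  have hm0 : 0 ≤ m := ENNReal.toReal_nonneg
  -- The oscillation `θ'` of `g` across the shell integrates to at most `θ` over the surface.
  set θ' := θ / (m + 1) with hθ'
  have hθ'0 : 0 < θ' := by positivity
  obtain ⟨τ, hτ, hunif⟩ := Metric.uniformContinuous_iff.1
    (hgc.uniformContinuous_of_continuous hg) θ' hθ'0
  refine ⟨min (c * τ / 4) (c * d / 4), by positivity, fun ε hε hεlt => ?_⟩
  have hε1 : 2 * ε / c < τ := by
    rw [div_lt_iff₀ hc]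
    have := hεlt.trans_le (min_le_left _ _)
    nlinarith
  have hε2 : 2 * ε / c ≤ d / 2 := by
    rw [div_le_iff₀ hc]
    have := hεlt.trans_le (min_le_right _ _)
    nlinarith
  set U := {x | x ∈ Ω ∧ η - ε ≤ δ Ω x ∧ δ Ω x ≤ η} with hU
  set I := ∫⁻ x, ENNReal.ofReal (g x) ∂(surfaceMeasure Ω η) with hI
  have hgm : Measurable fun x => ENNReal.ofReal (g x) := hg.measurable.ennreal_ofReal
  have hUcov : U ⊆ ⋃ y : T, U ∩ Metric.ball (y : Eu N) (d / 2) := by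
    intro x hx
    obtain ⟨y, hy, hxy⟩ := hTc x (hx.2.2.trans_lt hηd)
    exact mem_iUnion.2 ⟨⟨y, hy⟩, hx, hxy⟩
  have hpiece : ∀ y : T, ∫⁻ x in U ∩ Metric.ball (y : Eu N) (d / 2), ENNReal.ofReal (g x) ≤
      ENNReal.ofReal (2 * ε / c) * (I + ENNReal.ofReal θ) := by
    intro y
    have h1 := lintegral_shell_patch_le hΩ hN hρ hc (hνp y) hη
      (by linarith : d + η < r) (by linarith) hηρ hε.le hε2 hgm (θ := ENNReal.ofReal θ') (by
        intro x s hs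
        rw [← ENNReal.ofReal_add (hg0 _) hθ'0.le]
        apply ENNReal.ofReal_le_ofReal
        have h2 := hunif (a := x) (b := x + s • ν y) (by
          rw [dist_eq_norm, sub_add_cancel_left, norm_neg, norm_smul, (hνp y).1,
            Real.norm_of_nonneg hs.1, mul_one]
          exact hs.2.trans_lt hε1)
        rw [Real.dist_eq] at h2
        linarith [(abs_lt.1 h2).2])
    refine h1.trans ?_
    gcongr
    refine (lintegral_mono_set inter_subset_left).trans ?_
    change ∫⁻ x, _ ∂(surfaceMeasure Ω η) ≤ _
    rw [lintegral_add_right _ measurable_const, lintegral_const]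
    gcongr
    rw [← ENNReal.ofReal_toReal hfin, ← ENNReal.ofReal_mul hθ'0.le]
    apply ENNReal.ofReal_le_ofReal
    rw [← hm, hθ', div_mul_eq_mul_div, div_le_iff₀ (by positivity)]
    nlinarith
  calc ∫⁻ x in U, ENNReal.ofReal (g x)
      ≤ ∫⁻ x in ⋃ y : T, U ∩ Metric.ball (y : Eu N) (d / 2), ENNReal.ofReal (g x) :=
        lintegral_mono_set hUcov
    _ ≤ ∑' y : T, ∫⁻ x in U ∩ Metric.ball (y : Eu N) (d / 2), ENNReal.ofReal (g x) :=
        lintegral_iUnion_le _ _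
    _ ≤ ∑' _ : T, ENNReal.ofReal (2 * ε / c) * (I + ENNReal.ofReal θ) :=
        ENNReal.tsum_le_tsum hpiece
    _ = ENNReal.ofReal (n * (2 / c) * ε) * (I + ENNReal.ofReal θ) := by
        rw [tsum_fintype, Finset.sum_const, Finset.card_univ, nsmul_eq_mul, ← mul_assoc,
          mul_assoc n, ENNReal.ofReal_mul hn0, hn, ENNReal.ofReal_natCast, div_mul_eq_mul_div]
    _ ≤ _ := by gcongr

/-! ### The inequality for test functions -/

/-- Young's inequality in the form that optimizes `p a^(p-1) b q` against the weight `w`. -/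
lemma young_weighted {p : ℝ} (hp : 1 < p) {a b q w z : ℝ} (ha : 0 ≤ a) (hb : 0 ≤ b)
    (hq : 0 ≤ q) (hw : 0 ≤ w) (hz : 0 ≤ z) (h : q ^ p ≤ w * z ^ (p - 1)) :
    p * a ^ (p - 1) * b * q ≤ b ^ p * w + (p - 1) * z * a ^ p := by
  have hp0 : 0 < p := by linarith
  have hp1 : 0 < p - 1 := by linarith
  have hconj : p.HolderConjugate (p / (p - 1)) := Real.HolderConjugate.conjExponent hp
  have hq' : q ≤ w ^ (1 / p) * z ^ ((p - 1) / p) := by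
    have h1 : (q ^ p) ^ (1 / p) ≤ (w * z ^ (p - 1)) ^ (1 / p) :=
      Real.rpow_le_rpow (by positivity) h (by positivity)
    rwa [← Real.rpow_mul hq, mul_one_div_cancel hp0.ne', Real.rpow_one,
      Real.mul_rpow hw (by positivity), ← Real.rpow_mul hz, mul_one_div] at h1
  have hy := Real.young_inequality_of_nonneg (a := b * w ^ (1 / p))
    (b := a ^ (p - 1) * z ^ ((p - 1) / p)) (by positivity) (by positivity) hconj
  rw [Real.mul_rpow hb (by positivity), ← Real.rpow_mul hw, one_div_mul_cancel hp0.ne',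
    Real.rpow_one, Real.mul_rpow (by positivity) (by positivity), ← Real.rpow_mul ha,
    ← Real.rpow_mul hz, mul_div_cancel₀ _ hp1.ne',
    show (p - 1) / p * (p / (p - 1)) = 1 by field_simp, Real.rpow_one] at hy
  calc p * a ^ (p - 1) * b * q
      ≤ p * a ^ (p - 1) * b * (w ^ (1 / p) * z ^ ((p - 1) / p)) := by gcongr
    _ = p * (b * w ^ (1 / p) * (a ^ (p - 1) * z ^ ((p - 1) / p))) := by ring
    _ ≤ p * (b ^ p * w / p + a ^ p * z / (p / (p - 1))) := by gcongr
    _ = _ := by field_simp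

lemma exists_bound_deriv_smoothTransition :
    ∃ B : ℝ, 0 < B ∧ ∀ x, |deriv Real.smoothTransition x| ≤ B := by
  have hc : Continuous (deriv Real.smoothTransition) :=
    (Real.smoothTransition.contDiff (n := 1)).continuous_deriv le_rfl
  obtain ⟨B, hB⟩ := isCompact_Icc.exists_bound_of_continuousOn (s := Icc (0 : ℝ) 1) hc.continuousOn
  refine ⟨|B| + 1, by positivity, fun x => ?_⟩
  by_cases hx : x ∈ Icc (0 : ℝ) 1
  · exact (hB x hx).trans (by linarith [le_abs_self B])
  · have h0 : deriv Real.smoothTransition x = 0 := by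
      rw [mem_Icc, not_and_or, not_le, not_le] at hx
      rcases hx with hx | hx
      · have : Real.smoothTransition =ᶠ[𝓝 x] fun _ => 0 := by
          filter_upwards [Iio_mem_nhds hx] with y hy
          exact Real.smoothTransition.zero_of_nonpos (le_of_lt hy)
        rw [this.deriv_eq, deriv_const]
      · have : Real.smoothTransition =ᶠ[𝓝 x] fun _ => 1 := by
          filter_upwards [Ioi_mem_nhds hx] with y hy
          exact Real.smoothTransition.one_of_one_le (le_of_lt hy)
        rw [this.deriv_eq, deriv_const]
    rw [h0, abs_zero]
    positivity

/-- Integration of `a ≤ L + b` when `∫ L ≤ 0`; the integral of `b` may be infinite. -/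
lemma lintegral_ofReal_le_of_le_add {X : Type*} [MeasurableSpace X] {μ : Measure X}
    {a b L : X → ℝ} (hL : Integrable L μ) (hL0 : ∫ x, L x ∂μ ≤ 0) (hb : AEStronglyMeasurable b μ)
    (hb0 : ∀ x, 0 ≤ b x) (ha0 : ∀ x, 0 ≤ a x) (hab : ∀ x, a x ≤ L x + b x) :
    ∫⁻ x, ENNReal.ofReal (a x) ∂μ ≤ ∫⁻ x, ENNReal.ofReal (b x) ∂μ := by
  by_cases htop : ∫⁻ x, ENNReal.ofReal (b x) ∂μ = ∞
  · rw [htop]; exact le_top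
  have hbi : Integrable b μ :=
    (lintegral_ofReal_ne_top_iff_integrable hb (ae_of_all _ hb0)).1 htop
  calc ∫⁻ x, ENNReal.ofReal (a x) ∂μ ≤ ∫⁻ x, ENNReal.ofReal (L x + b x) ∂μ :=
        lintegral_mono fun x => ENNReal.ofReal_le_ofReal (hab x)
    _ = ENNReal.ofReal (∫ x, (L x + b x) ∂μ) :=
        (ofReal_integral_eq_lintegral_ofReal (hL.add hbi)
          (ae_of_all _ fun x => (ha0 x).trans (hab x))).symm
    _ ≤ ENNReal.ofReal (∫ x, b x ∂μ) := by
        apply ENNReal.ofReal_le_ofReal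
        rw [integral_add hL hbi]
        linarith
    _ = _ := ofReal_integral_eq_lintegral_ofReal hbi (ae_of_all _ hb0)

lemma measurableSet_nbhd {N : ℕ} {Ω : Set (Eu N)} (hΩ : IsBoundedC2Domain Ω) (η : ℝ) :
    MeasurableSet (nbhd Ω η) :=
  hΩ.isOpen.measurableSet.inter (measurableSet_lt (continuous_δ Ω).measurable measurable_const)

/-- The data of a radial supersolution: `q(δ) ∇δ` is the vector field against which test functions
are compared; `z` is the dual quantity in Young's inequality, `K` bounds `-Δδ`, and `V` is the
resulting potential. The field has values bounded by `M` on `(0, η]`. -/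
structure RadialField (p K M η : ℝ) (w V : ℝ → ℝ) : Type where
  /-- the size of the field -/
  q : ℝ → ℝ
  /-- the dual quantity -/
  z : ℝ → ℝ
  /-- the endpoint of an interval on which `q` is `C¹`, beyond `η` to allow for a cutoff there -/
  b : ℝ
  lt_b : η < b
  contDiffOn : ContDiffOn ℝ 1 q (Ioo 0 b)
  nonneg : ∀ t, 0 < t → t ≤ η → 0 ≤ q t
  le_M : ∀ t, 0 < t → t ≤ η → q t ≤ M
  z_nonneg : ∀ t, 0 < t → t < η → 0 ≤ z t
  young : ∀ t, 0 < t → t < η → q t ^ p ≤ w t * z t ^ (p - 1)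
  V_le : ∀ t, 0 < t → t < η → V t ≤ deriv q t - K * q t - (p - 1) * z t

/-- The inequality on `{δ < η - ε}`, with the shell `η - ε ≤ δ ≤ η` in place of the surface. -/
lemma lintegral_le_of_radialField_shell {N : ℕ} {Ω : Set (Eu N)} (hΩ : IsBoundedC2Domain Ω)
    (hN : 1 ≤ N) {ρ c r : ℝ} (hu : HasUniformPatches Ω ρ c r) {p M η : ℝ} (hp : 1 < p)
    (hη : 0 < η) (hηρ : η ≤ ρ / 2) {w V : ℝ → ℝ} (hw : Measurable w) (hw0 : ∀ t, 0 < t → 0 ≤ w t)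
    (hV0 : ∀ t, 0 < t → t < η → 0 ≤ V t) (F : RadialField p (N * (2 / ρ)) M η w V) {B : ℝ}
    (hB0 : 0 ≤ B)
    (hB : ∀ x, |deriv Real.smoothTransition x| ≤ B) {φ : Eu N → ℝ} (hφ : IsTestFunction Ω φ)
    {ε : ℝ} (hε : 0 < ε) :
    ∫⁻ x in nbhd Ω (η - ε), ENNReal.ofReal (V (δ Ω x) * |φ x| ^ p) ≤
      (∫⁻ x in nbhd Ω η, ENNReal.ofReal (‖fderiv ℝ φ x‖ ^ p * w (δ Ω x))) +
      ENNReal.ofReal (M * B / ε) *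
        ∫⁻ x in {x | x ∈ Ω ∧ η - ε ≤ δ Ω x ∧ δ Ω x ≤ η}, ENNReal.ofReal (|φ x| ^ p) := by
  have hp0 : p ≠ 0 := by linarith
  have hM0 : 0 ≤ M := (F.nonneg η hη le_rfl).trans (F.le_M η hη le_rfl)
  set K : ℝ := N * (2 / ρ) with hK
  have hδc := continuous_δ Ω
  have hφ1 : ContDiff ℝ 1 φ := hφ.1.of_le (by exact_mod_cast le_top)
  have hsupp : ∀ {x}, φ x ≠ 0 → x ∈ Ω := fun {x} hx => hφ.2.2 (subset_tsupport _ hx)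
  obtain ⟨d, hd0, hd⟩ : ∃ d > 0, ∀ x, φ x ≠ 0 → 2 * d < δ Ω x := by
    rcases (tsupport φ).eq_empty_or_nonempty with h | h
    · refine ⟨1, one_pos, fun x hx => ?_⟩
      have := subset_tsupport _ (Function.mem_support.2 hx)
      simp [h] at this
    · obtain ⟨y, hy, hmin⟩ := hφ.2.1.isCompact.exists_isMinOn h hδc.continuousOn
      have hy0 := δ_pos hΩ hN (hφ.2.2 hy)
      refine ⟨δ Ω y / 3, by positivity, fun x hx => ?_⟩
      have := hmin (subset_tsupport _ (Function.mem_support.2 hx))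
      simp only [mem_ofPred_eq] at this
      linarith
  set S := Real.smoothTransition with hS
  have hSd : ContDiff ℝ 1 S := Real.smoothTransition.contDiff
  -- The derivative of the upper cutoff `ψ` lives in the shell and is at least `-B / ε`.
  set ψ : ℝ → ℝ := fun t => S ((η - t) / ε) with hψ
  -- The lower cutoff `χ` makes `Q` regular at `0`; `φ` vanishes where `χ(δ)` differs from `1`.
  set χ : ℝ → ℝ := fun t => S ((t - d) / d) with hχ
  have hψ1 : ContDiff ℝ 1 ψ := hSd.comp (by fun_prop)
  have hχ1 : ContDiff ℝ 1 χ := hSd.comp (by fun_prop)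
  have hψ0 : ∀ t, η ≤ t → ψ t = 0 := fun t ht =>
    Real.smoothTransition.zero_of_nonpos (div_nonpos_of_nonpos_of_nonneg (by linarith) hε.le)
  have hψone : ∀ t, t ≤ η - ε → ψ t = 1 := fun t ht =>
    Real.smoothTransition.one_of_one_le (by rw [le_div_iff₀ hε]; linarith)
  have hχ0 : ∀ t, t ≤ d → χ t = 0 := fun t ht =>
    Real.smoothTransition.zero_of_nonpos (div_nonpos_of_nonpos_of_nonneg (by linarith) hd0.le)
  have hχone : ∀ t, 2 * d ≤ t → χ t = 1 := fun t ht =>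
    Real.smoothTransition.one_of_one_le (by rw [le_div_iff₀ hd0]; linarith)
  have hψnn : ∀ t, 0 ≤ ψ t := fun t => Real.smoothTransition.nonneg _
  have hψle : ∀ t, ψ t ≤ 1 := fun t => Real.smoothTransition.le_one _
  have hχnn : ∀ t, 0 ≤ χ t := fun t => Real.smoothTransition.nonneg _
  set Q : ℝ → ℝ := fun t => F.q t * ψ t * χ t with hQ
  have hQd : ContDiff ℝ 1 Q := by
    refine contDiff_iff_contDiffAt.2 fun t => ?_
    by_cases h1 : t < d
    · refine (contDiffAt_const (c := (0 : ℝ))).congr_of_eventuallyEq ?_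
      filter_upwards [Iio_mem_nhds h1] with s hs
      simp [hQ, hχ0 s (le_of_lt hs)]
    by_cases h2 : η < t
    · refine (contDiffAt_const (c := (0 : ℝ))).congr_of_eventuallyEq ?_
      filter_upwards [Ioi_mem_nhds h2] with s hs
      simp [hQ, hψ0 s (le_of_lt hs)]
    · have hq := F.contDiffOn.contDiffAt (Ioo_mem_nhds (a := 0) (b := F.b) (x := t)
        (by linarith) (by linarith [F.lt_b]))
      exact (hq.mul hψ1.contDiffAt).mul hχ1.contDiffAt
  have hQsupp : ∀ t, Q t ≠ 0 → t ∈ Icc d η := by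
    intro t ht
    constructor
    · by_contra! h
      exact ht (by simp [hQ, hχ0 t h.le])
    · by_contra! h
      exact ht (by simp [hQ, hψ0 t h.le])
  have hQc : HasCompactSupport Q :=
    HasCompactSupport.of_support_subset_isCompact isCompact_Icc hQsupp
  have hQ0 : ∀ t, 0 ≤ Q t := by
    intro t
    by_cases h : Q t = 0
    · exact h.ge
    · have ht := hQsupp t h
      exact mul_nonneg (mul_nonneg (F.nonneg t (hd0.trans_le ht.1) ht.2) (hψnn t)) (hχnn t)
  have hibp := integral_deriv_comp_δ_le hΩ hN hu hp hQd hQc hQ0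
    (fun t ht => (hQsupp t ht).2.trans hηρ) hφ
  have hdQ : Continuous (deriv Q) := hQd.continuous_deriv le_rfl
  have hdφ : Continuous (fderiv ℝ φ) := hφ1.continuous_fderiv one_ne_zero
  have hφp : Continuous fun x => |φ x| ^ p :=
    hφ1.continuous.abs.rpow_const fun x => Or.inr (by linarith)
  have hφp1 : Continuous fun x => |φ x| ^ (p - 1) :=
    hφ1.continuous.abs.rpow_const fun x => Or.inr (by linarith)
  have hi1 : Integrable fun x => |φ x| ^ p * deriv Q (δ Ω x) := by
    refine Continuous.integrable_of_hasCompactSupport (by fun_prop) (HasCompactSupport.mul_right ?_)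
    refine hφ.2.1.comp_left (g := fun t : ℝ => |t| ^ p) ?_
    simp [Real.zero_rpow hp0]
  have hi2 : Integrable fun x =>
      (K * |φ x| ^ p + p * |φ x| ^ (p - 1) * ‖fderiv ℝ φ x‖) * Q (δ Ω x) := by
    have := hQd.continuous
    refine Continuous.integrable_of_hasCompactSupport (by fun_prop) ?_
    refine HasCompactSupport.mono hφ.2.1 fun x hx => ?_
    contrapose! hx
    simp only [Function.mem_support, not_not] at hx
    simp [hx, Real.zero_rpow hp0, Real.zero_rpow (by linarith : p - 1 ≠ 0)]
  set T := {x | x ∈ Ω ∧ η - ε ≤ δ Ω x ∧ δ Ω x ≤ η} with hT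
  have hTm : MeasurableSet T := hΩ.isOpen.measurableSet.inter
    ((measurableSet_le measurable_const hδc.measurable).inter
      (measurableSet_le hδc.measurable measurable_const))
  have hnm := measurableSet_nbhd hΩ
  set b₁ : Eu N → ℝ := (nbhd Ω η).indicator fun x => ‖fderiv ℝ φ x‖ ^ p * w (δ Ω x) with hb₁
  set b₂ : Eu N → ℝ := T.indicator fun x => M * B / ε * |φ x| ^ p with hb₂
  have hb₁m : Measurable b₁ := by
    refine Measurable.indicator ?_ (hnm η)
    exact ((hdφ.norm.measurable).pow_const p).mul (hw.comp hδc.measurable)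
  have hb₂m : Measurable b₂ := (hφp.measurable.const_mul _).indicator hTm
  have hb₁0 : ∀ x, 0 ≤ b₁ x := fun x => by
    refine indicator_nonneg (fun y hy => ?_) x
    exact mul_nonneg (by positivity) (hw0 _ (δ_pos hΩ hN hy.1))
  have hb₂0 : ∀ x, 0 ≤ b₂ x := fun x => indicator_nonneg (fun y hy => by positivity) x
  have hmain := lintegral_ofReal_le_of_le_add (μ := (volume : Measure (Eu N)))
    (a := (nbhd Ω (η - ε)).indicator fun x => V (δ Ω x) * |φ x| ^ p) (b := fun x => b₁ x + b₂ x)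
    (hi1.sub hi2) (by
      simp only [Pi.sub_apply]
      rw [integral_sub hi1 hi2]; linarith)
    (hb₁m.add hb₂m).aestronglyMeasurable (fun x => add_nonneg (hb₁0 x) (hb₂0 x))
    (fun x => by
      refine indicator_nonneg (fun y hy => ?_) x
      exact mul_nonneg (hV0 _ (δ_pos hΩ hN hy.1) (by linarith [hy.2])) (by positivity))
    (by
      intro x
      simp only [Pi.sub_apply]
      by_cases hx0 : φ x = 0
      · have e1 : |φ x| ^ p = 0 := by simp [hx0, Real.zero_rpow hp0]
        have e2 : |φ x| ^ (p - 1) = 0 := by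
          simp [hx0, Real.zero_rpow (by linarith : p - 1 ≠ 0)]
        have e3 : (nbhd Ω (η - ε)).indicator (fun x => V (δ Ω x) * |φ x| ^ p) x = 0 := by
          rw [indicator_apply_eq_zero]
          intro _
          rw [e1, mul_zero]
        rw [e1, e2, e3]
        have := hb₁0 x
        have := hb₂0 x
        simp only [zero_mul, mul_zero, add_zero, sub_zero, zero_add]
        positivity
      have hxΩ := hsupp hx0
      have hxd := hd x hx0
      set t := δ Ω x with ht
      have ht0 : 0 < t := by linarith
      rcases le_or_gt η t with hηt | htη
      · have hQt : Q t = 0 := by simp [hQ, hψ0 t hηt]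
        have hQ't : deriv Q t = 0 := by
          refine IsLocalMin.deriv_eq_zero (Eventually.of_forall fun s => ?_)
          rw [hQt]; exact hQ0 s
        have e3 : (nbhd Ω (η - ε)).indicator (fun x => V (δ Ω x) * |φ x| ^ p) x = 0 :=
          indicator_of_notMem (fun h => by have := h.2; linarith) _
        rw [hQt, hQ't, e3]
        have := hb₁0 x
        have := hb₂0 x
        simp only [mul_zero, sub_zero, zero_add]
        positivity
      have hQev : Q =ᶠ[𝓝 t] fun s => F.q s * ψ s := by
        filter_upwards [Ioi_mem_nhds hxd] with s hs
        simp [hQ, hχone s (le_of_lt hs)]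
      have hqd : HasDerivAt F.q (deriv F.q t) t :=
        ((F.contDiffOn.contDiffAt (Ioo_mem_nhds ht0 (htη.trans F.lt_b))).differentiableAt
          one_ne_zero).hasDerivAt
      have hψd : HasDerivAt ψ (deriv ψ t) t :=
        (hψ1.differentiable one_ne_zero t).hasDerivAt
      have hQ't : deriv Q t = deriv F.q t * ψ t + F.q t * deriv ψ t := by
        rw [hQev.deriv_eq]; exact (hqd.mul hψd).deriv
      have hQt : Q t = F.q t * ψ t := hQev.self_of_nhds
      have hq0 := F.nonneg t ht0 htη.le
      have hqM := F.le_M t ht0 htη.le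
      have hyoung := young_weighted hp (abs_nonneg (φ x)) (norm_nonneg (fderiv ℝ φ x)) hq0
        (hw0 t ht0) (F.z_nonneg t ht0 htη) (F.young t ht0 htη)
      have hVt := F.V_le t ht0 htη
      have hVt0 := hV0 t ht0 htη
      have hb₁x : b₁ x = ‖fderiv ℝ φ x‖ ^ p * w t :=
        indicator_of_mem (show x ∈ nbhd Ω η from ⟨hxΩ, htη⟩) _
      set u := |φ x| ^ p with hu'
      have hu0 : 0 ≤ u := by positivity
      have hax : (nbhd Ω (η - ε)).indicator (fun x => V (δ Ω x) * |φ x| ^ p) x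
          ≤ ψ t * (V t * u) := by
        by_cases h : x ∈ nbhd Ω (η - ε)
        · rw [indicator_of_mem h, hψone t h.2.le, one_mul]
        · rw [indicator_of_notMem h]
          exact mul_nonneg (hψnn t) (mul_nonneg hVt0 hu0)
      have hshell : -b₂ x ≤ u * (F.q t * deriv ψ t) := by
        by_cases h : t < η - ε
        · have : deriv ψ t = 0 := by
            have : ψ =ᶠ[𝓝 t] fun _ => 1 := by
              filter_upwards [Iio_mem_nhds h] with s hs
              exact hψone s (le_of_lt hs)
            rw [this.deriv_eq, deriv_const]
          rw [this, mul_zero, mul_zero]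
          linarith [hb₂0 x]
        · have hxT : x ∈ T := ⟨hxΩ, not_lt.1 h, htη.le⟩
          have hb₂x : b₂ x = M * B / ε * u := indicator_of_mem hxT _
          have hder : deriv ψ t = deriv S ((η - t) / ε) * (-1 / ε) := by
            have h1 : HasDerivAt (fun t => (η - t) / ε) (-1 / ε) t :=
              ((hasDerivAt_id t).const_sub η).div_const ε
            exact (((hSd.differentiable one_ne_zero _).hasDerivAt).comp t h1).deriv
          have habs : -(B / ε) ≤ deriv ψ t := by
            have h2 := (abs_le.1 (hB ((η - t) / ε))).2
            rw [hder, neg_div, mul_neg, neg_le_neg_iff, mul_one_div]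
            gcongr
          have h3 : F.q t * (B / ε) ≤ M * (B / ε) := by gcongr
          have h4 : -(M * (B / ε)) ≤ F.q t * deriv ψ t := by
            have := mul_le_mul_of_nonneg_left habs hq0
            linarith
          rw [hb₂x]
          have := mul_le_mul_of_nonneg_left h4 hu0
          rw [mul_div_assoc]
          linarith
      refine hax.trans ?_
      rw [hQ't, hQt, hb₁x]
      have h5 : ψ t * (V t * u) ≤ ψ t * (u * deriv F.q t - K * u * F.q t
          - p * |φ x| ^ (p - 1) * ‖fderiv ℝ φ x‖ * F.q t + ‖fderiv ℝ φ x‖ ^ p * w t) := by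
        refine mul_le_mul_of_nonneg_left ?_ (hψnn t)
        have := mul_le_mul_of_nonneg_right hVt hu0
        linarith
      have h6 : ψ t * (‖fderiv ℝ φ x‖ ^ p * w t) ≤ ‖fderiv ℝ φ x‖ ^ p * w t :=
        mul_le_of_le_one_left (mul_nonneg (by positivity) (hw0 t ht0)) (hψle t)
      linarith)
  have e1 : ∀ (A : Set (Eu N)) (f : Eu N → ℝ), (fun x => ENNReal.ofReal (A.indicator f x)) =
      A.indicator fun x => ENNReal.ofReal (f x) := by
    intro A f
    ext x
    by_cases h : x ∈ A <;> simp [h]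
  have hsum : ∀ x, ENNReal.ofReal (b₁ x + b₂ x) = ENNReal.ofReal (b₁ x) + ENNReal.ofReal (b₂ x) :=
    fun x => ENNReal.ofReal_add (hb₁0 x) (hb₂0 x)
  simp only [hsum] at hmain
  rw [lintegral_add_left hb₁m.ennreal_ofReal, hb₁, hb₂, e1, e1, e1, lintegral_indicator (hnm _),
    lintegral_indicator (hnm _), lintegral_indicator hTm] at hmain
  refine hmain.trans_eq ?_
  congr 1
  rw [← lintegral_const_mul _ hφp.measurable.ennreal_ofReal]
  refine lintegral_congr fun x => ?_
  rw [ENNReal.ofReal_mul (by positivity)]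

/-- The inequality for test functions: the shell of `lintegral_le_of_radialField_shell` shrinks to
the parallel surface. -/
lemma lintegral_le_of_radialField {N : ℕ} {Ω : Set (Eu N)} (hΩ : IsBoundedC2Domain Ω)
    (hN : 1 ≤ N) {ρ c r : ℝ} (hu : HasUniformPatches Ω ρ c r) {p M η : ℝ} (hp : 1 < p)
    (hη : 0 < η) (hηρ : η ≤ ρ / 2) {w V : ℝ → ℝ} (hw : Measurable w) (hw0 : ∀ t, 0 < t → 0 ≤ w t)
    (hV0 : ∀ t, 0 < t → t < η → 0 ≤ V t) (F : RadialField p (N * (2 / ρ)) M η w V) {B C : ℝ}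
    (hB0 : 0 ≤ B) (hB : ∀ x, |deriv Real.smoothTransition x| ≤ B) (hC : 0 ≤ C)
    {φ : Eu N → ℝ} (hφ : IsTestFunction Ω φ)
    (hshell : ∀ θ > 0, ∃ ε₀ > 0, ∀ ε, 0 < ε → ε < ε₀ →
      ∫⁻ x in {x | x ∈ Ω ∧ η - ε ≤ δ Ω x ∧ δ Ω x ≤ η}, ENNReal.ofReal (|φ x| ^ p) ≤
        ENNReal.ofReal (C * ε) * (∫⁻ x, ENNReal.ofReal (|φ x| ^ p) ∂(surfaceMeasure Ω η) +
          ENNReal.ofReal θ)) :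
    ∫⁻ x in nbhd Ω η, ENNReal.ofReal (V (δ Ω x) * |φ x| ^ p) ≤
      (∫⁻ x in nbhd Ω η, ENNReal.ofReal (‖fderiv ℝ φ x‖ ^ p * w (δ Ω x))) +
      ENNReal.ofReal (M * B * C) * ∫⁻ x, ENNReal.ofReal (|φ x| ^ p) ∂(surfaceMeasure Ω η) := by
  have hM0 : 0 ≤ M := (F.nonneg η hη le_rfl).trans (F.le_M η hη le_rfl)
  set I := ∫⁻ x, ENNReal.ofReal (|φ x| ^ p) ∂(surfaceMeasure Ω η) with hI
  set G := ∫⁻ x in nbhd Ω η, ENNReal.ofReal (‖fderiv ℝ φ x‖ ^ p * w (δ Ω x)) with hG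
  have hmono : ∀ {s t : ℝ}, s ≤ t → nbhd Ω s ⊆ nbhd Ω t := fun hst x hx =>
    ⟨hx.1, hx.2.trans_le hst⟩
  -- The factor `1 / ε` of the cutoff cancels the width `ε` of the shell.
  have hcut : ∀ n : ℕ, ∫⁻ x in nbhd Ω (η - 1 / (n + 1)), ENNReal.ofReal (V (δ Ω x) * |φ x| ^ p) ≤
      G + ENNReal.ofReal (M * B * C) * I := by
    intro n
    refine ENNReal.le_of_forall_pos_le_add fun κ hκ _ => ?_
    have hD : 0 < M * B * C + 1 := by positivity
    have hκ' : (0 : ℝ) < κ := hκ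
    obtain ⟨ε₀, hε₀, h⟩ := hshell (κ / (M * B * C + 1)) (by positivity)
    have hn : (0 : ℝ) < 1 / (n + 1) := by positivity
    set ε := min (ε₀ / 2) (1 / ((n : ℝ) + 1)) with hε
    have hε0 : 0 < ε := by positivity
    have hεlt : ε < ε₀ := (min_le_left _ _).trans_lt (by linarith)
    have h1 := lintegral_le_of_radialField_shell hΩ hN hu hp hη hηρ hw hw0 hV0 F hB0 hB hφ hε0
    refine (lintegral_mono_set (hmono (by linarith [min_le_right (ε₀ / 2) (1 / ((n : ℝ) + 1))] :
      η - 1 / ((n : ℝ) + 1) ≤ η - ε))).trans (h1.trans ?_)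
    rw [add_assoc]
    gcongr
    refine (mul_le_mul_right (h ε hε0 hεlt) _).trans ?_
    rw [← mul_assoc, ← ENNReal.ofReal_mul (by positivity),
      show M * B / ε * (C * ε) = M * B * C by field_simp, mul_add]
    gcongr
    rw [← ENNReal.ofReal_mul (by positivity), ← ENNReal.ofReal_coe_nnreal]
    apply ENNReal.ofReal_le_ofReal
    rw [mul_div_assoc', div_le_iff₀ hD]
    nlinarith
  have hU : nbhd Ω η = ⋃ n : ℕ, nbhd Ω (η - 1 / ((n : ℝ) + 1)) := by
    ext x
    simp only [mem_iUnion]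
    refine ⟨fun hx => ?_, fun ⟨n, hx⟩ => hmono (by
      have : (0 : ℝ) < 1 / (n + 1) := by positivity
      linarith) hx⟩
    obtain ⟨n, hn⟩ := exists_nat_one_div_lt (sub_pos.2 hx.2)
    exact ⟨n, hx.1, by linarith⟩
  conv_lhs => rw [hU]
  rw [setLIntegral_iUnion_of_directed]
  · exact iSup_le hcut
  · refine Monotone.directed_le (f := fun n : ℕ => nbhd Ω (η - 1 / ((n : ℝ) + 1))) ?_
    intro m n hmn
    refine hmono ?_
    have : (1 : ℝ) / (n + 1) ≤ 1 / (m + 1) := by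
      have : (m : ℝ) ≤ n := by exact_mod_cast hmn
      gcongr
    linarith

/-! ### The radial supersolutions -/

lemma one_add_rpow_le {s h : ℝ} (hs : 0 ≤ s) (hh : 0 ≤ h) (hsh : s * h ≤ 1) :
    (1 + h) ^ s ≤ 1 + s * h + s ^ 2 * h ^ 2 := by
  have h1 : (1 + h) ^ s ≤ Real.exp (s * h) := by
    rw [mul_comm, Real.exp_mul]
    exact Real.rpow_le_rpow (by linarith) (by linarith [Real.add_one_le_exp h]) hs
  have h2 := Real.abs_exp_sub_one_sub_id_le (x := s * h) (by
    rwa [abs_of_nonneg (by positivity)])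
  have h3 := (abs_le.1 h2).2
  nlinarith

/-- Close to the boundary `A₁` is at least `e`, and `t A₁(t)³` is as small as desired. -/
lemma exists_forall_A₁ {R : ℝ} (hR : 0 < R) (D : ℝ) {θ : ℝ} (hθ : 0 < θ) :
    ∃ η₂ > 0, ∀ t, 0 < t → t ≤ η₂ → t < R / Real.exp 1 ∧ Real.exp 1 ≤ A₁ R t ∧
      D * (t * A₁ R t ^ 3) ≤ θ := by
  have hlim : Tendsto (fun t : ℝ => R / t) (𝓝[>] 0) atTop := by
    simpa only [div_eq_mul_inv] using tendsto_inv_nhdsGT_zero.const_mul_atTop hR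
  have h3 : Tendsto (fun t : ℝ => D * (t * A₁ R t ^ 3)) (𝓝[>] 0) (𝓝 0) := by
    have h4 := (Real.tendsto_pow_log_div_mul_add_atTop 1 0 3 one_ne_zero).comp hlim
    have h5 := h4.const_mul (D * R)
    rw [mul_zero] at h5
    refine h5.congr' ?_
    filter_upwards [self_mem_nhdsWithin] with t ht
    rw [mem_Ioi] at ht
    simp only [Function.comp, A₁, one_mul, add_zero]
    field_simp
  have hev : ∀ᶠ t in 𝓝[>] (0 : ℝ), t < R / Real.exp 1 ∧ Real.exp 1 ≤ A₁ R t ∧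
      D * (t * A₁ R t ^ 3) ≤ θ := by
    filter_upwards [Ioo_mem_nhdsGT (show 0 < R / Real.exp 1 by positivity),
      (Real.tendsto_log_atTop.comp hlim).eventually_ge_atTop (Real.exp 1),
      h3.eventually (gt_mem_nhds hθ)] with t h1 h2 h3
    exact ⟨h1.2, h2, h3.le⟩
  obtain ⟨u, hu, hsub⟩ := mem_nhdsGT_iff_exists_Ioc_subset.1 hev
  exact ⟨u, hu, fun t h0 h1 => hsub ⟨h0, h1⟩⟩

lemma hasDerivAt_A₁ {R t : ℝ} (hR : 0 < R) (ht : 0 < t) : HasDerivAt (A₁ R) (-(1 / t)) t := by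
  have h1 : HasDerivAt (fun t : ℝ => R / t) (-(R / t ^ 2)) t := by
    simpa [div_eq_mul_inv, mul_comm] using (hasDerivAt_inv ht.ne').const_mul R
  have h2 := h1.log (by positivity)
  refine h2.congr_deriv ?_
  field_simp

lemma A₁_pos {R t : ℝ} (ht : 0 < t) (htR : t < R) : 0 < A₁ R t :=
  Real.log_pos ((one_lt_div ht).2 htR)

lemma contDiffAt_A₁ {R t : ℝ} (hR : 0 < R) (ht : 0 < t) : ContDiffAt ℝ 1 (A₁ R) t :=
  (contDiffAt_const.div contDiffAt_id ht.ne').log (div_pos hR ht).ne'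

/-- The field is that of the pure power `t^(-β)`, `β = α - 1 + 1/p`, which yields the constant
`Λ = β^p`, perturbed by the factor `1 + a / A₁`. As the derivative of `1 / A₁` is `1 / (t A₁²)`,
the perturbation leaves a remainder of order `1 / A₁²`. -/
lemma exists_radialField_supercritical {p α R : ℝ} (hp : 1 < p) (hα : 1 - 1 / p < α) :
    ∃ C₂ > 0, ∃ M : ℝ → ℝ, (∀ η, 0 < η → 0 < M η) ∧
      ∀ K, 0 ≤ K → 0 < R → ∃ η₂ > 0, ∀ η, 0 < η → η < η₂ →
        Nonempty (RadialField p K (M η) η (fun t => t ^ (α * p))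
          (fun t => (Λ α p + C₂ * (1 / A₁ R t ^ 2)) * (t ^ (α * p) / t ^ p))) := by
  have hp0 : 0 < p := by linarith
  have hp1 : 0 < p - 1 := by linarith
  set β := α - 1 + 1 / p with hβ
  have hβ0 : 0 < β := by linarith
  have hαp : α * p = p * β + p - 1 := by rw [hβ]; field_simp; ring
  have hΛ : Λ α p = β ^ p := by
    rw [Λ, if_neg hα.ne', abs_of_neg (by linarith)]
    congr 1; rw [hβ]; ring
  set s := p / (p - 1) with hs
  have hs0 : 0 < s := by positivity
  have hs1 : (p - 1) * s = p := mul_div_cancel₀ _ hp1.ne'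
  have hsge : 1 ≤ s := by rw [hs, le_div_iff₀ hp1]; linarith
  -- `s a ≤ 1` is needed to expand `(1 + a / A₁)^s`; the second bound lets the quadratic term of
  -- the expansion consume at most half of `a / A₁²`.
  set a := min (1 / s) (1 / (2 * β * p * s)) with ha
  have ha0 : 0 < a := by positivity
  have hsa : s * a ≤ 1 := by
    have := min_le_left (1 / s) (1 / (2 * β * p * s))
    rw [← ha, le_div_iff₀ hs0] at this
    linarith
  have ha1 : a ≤ 1 := by nlinarith
  have hβa : β * p * s * a ≤ 1 / 2 := by
    have := min_le_right (1 / s) (1 / (2 * β * p * s))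
    rw [← ha, le_div_iff₀ (by positivity)] at this
    linarith
  refine ⟨β ^ (p - 1) * (a / 4), by positivity, fun η => 2 * β ^ (p - 1) * η ^ (p * β),
    fun η hη => by positivity, fun K hK hR => ?_⟩
  obtain ⟨η₂, hη₂, hsmall⟩ := exists_forall_A₁ hR (8 * K) ha0
  refine ⟨η₂, hη₂, fun η hη hηlt => ?_⟩
  have he1 : (1 : ℝ) ≤ Real.exp 1 := Real.one_le_exp zero_le_one
  have hge : ∀ t, 0 < t → t ≤ η → 1 ≤ A₁ R t := fun t h0 h1 =>
    he1.trans (hsmall t h0 (h1.trans hηlt.le)).2.1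
  have hηR : η < R := (hsmall η hη hηlt.le).1.trans_le (div_le_self hR.le he1)
  have hhle : ∀ t, 0 < t → t ≤ η → a / A₁ R t ≤ 1 := fun t h0 h1 =>
    (div_le_one (by linarith [hge t h0 h1])).2 (ha1.trans (hge t h0 h1))
  refine ⟨{ q := fun t => β ^ (p - 1) * (t ^ (p * β) * (1 + a / A₁ R t))
            z := fun t => β ^ p * (t ^ (p * β - 1) * (1 + a / A₁ R t) ^ s)
            b := R
            lt_b := hηR
            contDiffOn := ?_
            nonneg := ?_
            le_M := ?_
            z_nonneg := ?_
            young := ?_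
            V_le := ?_ }⟩
  · intro t ht
    have hA := A₁_pos ht.1 ht.2
    exact (contDiffAt_const.mul ((Real.contDiffAt_rpow_const_of_ne ht.1.ne').mul
      (contDiffAt_const.add (contDiffAt_const.div (contDiffAt_A₁ hR ht.1)
        hA.ne')))).contDiffWithinAt
  · intro t h0 h1
    have := hge t h0 h1
    positivity
  · intro t h0 h1
    have h2 := hhle t h0 h1
    have h3 : 0 ≤ a / A₁ R t := by
      have := hge t h0 h1
      positivity
    calc β ^ (p - 1) * (t ^ (p * β) * (1 + a / A₁ R t)) ≤ β ^ (p - 1) * (η ^ (p * β) * 2) := by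
          gcongr
          linarith
      _ = _ := by ring
  · intro t h0 h1
    have := hge t h0 h1.le
    positivity
  · intro t h0 h1
    have h2 : 0 ≤ a / A₁ R t := by
      have := hge t h0 h1.le
      positivity
    have h3 : 0 < 1 + a / A₁ R t := by linarith
    apply le_of_eq
    rw [Real.mul_rpow (by positivity) (by positivity),
      Real.mul_rpow (by positivity) (by positivity),
      Real.mul_rpow (by positivity) (by positivity), Real.mul_rpow (by positivity) (by positivity),
      ← Real.rpow_mul hβ0.le, ← Real.rpow_mul hβ0.le, ← Real.rpow_mul h0.le, ← Real.rpow_mul h0.le,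
      ← Real.rpow_mul h3.le, mul_comm s, hs1, mul_left_comm (t ^ (α * p)),
      ← mul_assoc (t ^ (α * p)), ← Real.rpow_add h0, mul_comm (p - 1) p]
    congr 3
    rw [hαp]; ring
  · intro t h0 h1
    have hA := hge t h0 h1.le
    have hA0 : 0 < A₁ R t := by linarith
    set A := A₁ R t with hAdef
    have hh0 : 0 ≤ a / A := by positivity
    have hd : deriv (fun t => β ^ (p - 1) * (t ^ (p * β) * (1 + a / A₁ R t))) t =
        β ^ (p - 1) * t ^ (p * β - 1) * (p * β * (1 + a / A) + a / A ^ 2) := by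
      have hd1 : HasDerivAt (fun t : ℝ => t ^ (p * β)) (p * β * t ^ (p * β - 1)) t :=
        Real.hasDerivAt_rpow_const (Or.inl h0.ne')
      have hd2 : HasDerivAt (fun t : ℝ => 1 + a / A₁ R t) (a / A ^ 2 * t⁻¹) t := by
        have := (((hasDerivAt_A₁ hR h0).inv hA0.ne').const_mul a).const_add 1
        simp only [Pi.inv_apply, ← div_eq_mul_inv] at this
        refine this.congr_deriv ?_
        rw [← hAdef]
        field_simp
      refine ((hd1.mul hd2).const_mul (β ^ (p - 1))).deriv.trans ?_
      rw [← hAdef]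
      have : t ^ (p * β) = t ^ (p * β - 1) * t := by
        rw [← Real.rpow_add_one h0.ne']; congr 1; ring
      rw [this]
      field_simp
    rw [hd]
    have hpow := one_add_rpow_le hs0.le hh0 (by
      have : a / A ≤ a := div_le_self ha0.le hA
      nlinarith)
    have htq : t ^ (p * β) = t ^ (p * β - 1) * t := by
      rw [← Real.rpow_add_one h0.ne']; congr 1; ring
    have hβp : β ^ p = β ^ (p - 1) * β := by
      rw [← Real.rpow_add_one hβ0.ne']; congr 1; ring
    have hwt : t ^ (α * p) / t ^ p = t ^ (p * β - 1) := by
      rw [← Real.rpow_sub h0]; congr 1; rw [hαp]; ring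
    rw [hΛ, hwt, hβp, htq]
    set Y := (1 + a / A) ^ s with hY
    have hP : 0 ≤ β ^ (p - 1) * t ^ (p * β - 1) := by positivity
    have hsm := (hsmall t h0 (h1.le.trans hηlt.le)).2.2
    rw [← hAdef] at hsm
    have hKt : 8 * (K * t) ≤ a / A ^ 2 := by
      rw [le_div_iff₀ (by positivity)]
      have : A ^ 2 ≤ A ^ 3 := pow_le_pow_right₀ hA (by norm_num)
      have : K * t * A ^ 2 ≤ K * t * A ^ 3 := by gcongr
      linarith
    have hlow : β + a / 4 * (1 / A ^ 2) ≤
        p * β * (1 + a / A) + a / A ^ 2 - K * t * (1 + a / A) - (p - 1) * β * Y := by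
      have e1 : (p - 1) * β * Y ≤ (p - 1) * β * (1 + s * (a / A) + s ^ 2 * (a / A) ^ 2) := by
        gcongr
      have e2 : (p - 1) * β * (1 + s * (a / A) + s ^ 2 * (a / A) ^ 2) =
          p * β * (1 + a / A) - β + (β * p * s * a) * (a / A ^ 2) := by
        have : (p - 1) * β * (1 + s * (a / A) + s ^ 2 * (a / A) ^ 2) =
          (p - 1) * β + β * ((p - 1) * s) * (a / A) + β * ((p - 1) * s) * s * (a / A) ^ 2 := by ring
        rw [this, hs1]
        field_simp
        ring
      have e3 : (β * p * s * a) * (a / A ^ 2) ≤ 1 / 2 * (a / A ^ 2) := by gcongr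
      have e4 : K * t * (1 + a / A) ≤ K * t * 2 := by
        have := hhle t h0 h1.le
        gcongr
        linarith
      have e5 : a / 4 * (1 / A ^ 2) = 1 / 4 * (a / A ^ 2) := by ring
      linarith
    calc (β ^ (p - 1) * β + β ^ (p - 1) * (a / 4) * (1 / A ^ 2)) * t ^ (p * β - 1)
        = β ^ (p - 1) * t ^ (p * β - 1) * (β + a / 4 * (1 / A ^ 2)) := by ring
      _ ≤ β ^ (p - 1) * t ^ (p * β - 1) * (p * β * (1 + a / A) + a / A ^ 2
          - K * t * (1 + a / A) - (p - 1) * β * Y) := mul_le_mul_of_nonneg_left hlow hP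
      _ = _ := by ring

/-- The field is that of the critical solution `A₁^(1 - 1/p)`, perturbed by the factor
`1 + a / A₂`. The derivative of `1 / A₂` is `1 / (t A₁ A₂²)`, which leaves a remainder of order
`1 / A₂²` relative to the leading term. -/
lemma exists_radialField_critical {p α R : ℝ} (hp : 1 < p) (hα : α = 1 - 1 / p) :
    ∃ C₂ > 0, ∃ M : ℝ → ℝ, (∀ η, 0 < η → 0 < M η) ∧
      ∀ K, 0 ≤ K → 0 < R → ∃ η₂ > 0, ∀ η, 0 < η → η < η₂ →
        Nonempty (RadialField p K (M η) η (fun t => t ^ (α * p))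
          (fun t => (Λ α p * (1 / A₁ R t ^ p) + C₂ * (1 / A₁ R t ^ p * (1 / A₂ R t ^ 2))) *
            (t ^ (α * p) / t ^ p))) := by
  have hp0 : 0 < p := by linarith
  have hp1 : 0 < p - 1 := by linarith
  have hαp : α * p = p - 1 := by rw [hα]; field_simp
  set κ := 1 - 1 / p with hκ
  have hκp : κ * p = p - 1 := by rw [hκ]; field_simp
  have hκ0 : 0 < κ := by
    rw [hκ, sub_pos, div_lt_one hp0]; exact hp
  have hΛ : Λ α p = κ ^ p := by rw [Λ, if_pos hα]
  set s := p / (p - 1) with hs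
  have hs0 : 0 < s := by positivity
  have hs1 : (p - 1) * s = p := mul_div_cancel₀ _ hp1.ne'
  have hκs : κ * s = 1 := by
    have : κ = (p - 1) / p := by rw [← hκp]; field_simp
    rw [this, hs]; field_simp
  have hsge : 1 ≤ s := by rw [hs, le_div_iff₀ hp1]; linarith
  -- `s a ≤ 1` is needed to expand `(1 + a / A₂)^s`; the second bound lets the quadratic term of
  -- the expansion consume at most half of `a / A₂²`.
  set a := min (1 / s) (1 / (2 * p)) with ha
  have ha0 : 0 < a := by positivity
  have hsa : s * a ≤ 1 := by
    have := min_le_left (1 / s) (1 / (2 * p))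
    rw [← ha, le_div_iff₀ hs0] at this
    linarith
  have ha1 : a ≤ 1 := by nlinarith
  have hpa : p * a ≤ 1 / 2 := by
    have := min_le_right (1 / s) (1 / (2 * p))
    rw [← ha, le_div_iff₀ (by positivity)] at this
    linarith
  refine ⟨κ ^ (p - 1) * (a / 4), by positivity, fun _ => 2 * κ ^ (p - 1),
    fun η hη => by positivity, fun K hK hR => ?_⟩
  obtain ⟨η₂, hη₂, hsmall⟩ := exists_forall_A₁ hR (8 * K) ha0
  refine ⟨η₂, hη₂, fun η hη hηlt => ?_⟩
  have he1 : (1 : ℝ) ≤ Real.exp 1 := Real.one_le_exp zero_le_one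
  have hge : ∀ t, 0 < t → t ≤ η → 1 ≤ A₁ R t := fun t h0 h1 =>
    he1.trans (hsmall t h0 (h1.trans hηlt.le)).2.1
  have hge2 : ∀ t, 0 < t → t ≤ η → 1 ≤ A₂ R t := fun t h0 h1 => by
    rw [A₂, Real.le_log_iff_exp_le (by linarith [hge t h0 h1])]
    exact (hsmall t h0 (h1.trans hηlt.le)).2.1
  have hηR : η < R / Real.exp 1 := (hsmall η hη hηlt.le).1
  have hhle : ∀ t, 0 < t → t ≤ η → a / A₂ R t ≤ 1 := fun t h0 h1 =>
    (div_le_one (by linarith [hge2 t h0 h1])).2 (ha1.trans (hge2 t h0 h1))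
  refine ⟨{ q := fun t => κ ^ (p - 1) * (A₁ R t ^ (1 - p) * (1 + a / A₂ R t))
            z := fun t => κ ^ p * (A₁ R t ^ (-p) * t⁻¹ * (1 + a / A₂ R t) ^ s)
            b := R / Real.exp 1
            lt_b := hηR
            contDiffOn := ?_
            nonneg := ?_
            le_M := ?_
            z_nonneg := ?_
            young := ?_
            V_le := ?_ }⟩
  · intro t ht
    have hA1 : 1 < A₁ R t := by
      rw [A₁, Real.lt_log_iff_exp_lt (div_pos hR ht.1), lt_div_iff₀ ht.1, mul_comm]
      exact (lt_div_iff₀ (Real.exp_pos 1)).1 ht.2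
    have hA2 : 0 < A₂ R t := Real.log_pos hA1
    have hc := contDiffAt_A₁ hR ht.1
    have hA0 : A₁ R t ≠ 0 := by linarith
    exact (contDiffAt_const.mul ((hc.rpow_const_of_ne hA0).mul
      (contDiffAt_const.add (contDiffAt_const.div (hc.log hA0) hA2.ne')))).contDiffWithinAt
  · intro t h0 h1
    have := hge t h0 h1
    have := hge2 t h0 h1
    positivity
  · intro t h0 h1
    have h2 := hhle t h0 h1
    have h3 : 0 ≤ a / A₂ R t := by
      have := hge2 t h0 h1
      positivity
    have h4 : A₁ R t ^ (1 - p) ≤ 1 :=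
      Real.rpow_le_one_of_one_le_of_nonpos (hge t h0 h1) (by linarith)
    calc κ ^ (p - 1) * (A₁ R t ^ (1 - p) * (1 + a / A₂ R t)) ≤ κ ^ (p - 1) * (1 * 2) := by
          gcongr
          linarith
      _ = _ := by ring
  · intro t h0 h1
    have := hge t h0 h1.le
    have := hge2 t h0 h1.le
    positivity
  · intro t h0 h1
    have hA : 0 < A₁ R t := by linarith [hge t h0 h1.le]
    have h2 : 0 ≤ a / A₂ R t := by
      have := hge2 t h0 h1.le
      positivity
    have h3 : 0 < 1 + a / A₂ R t := by linarith
    apply le_of_eq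
    rw [Real.mul_rpow (by positivity) (by positivity),
      Real.mul_rpow (by positivity) (by positivity),
      Real.mul_rpow (by positivity) (by positivity), Real.mul_rpow (by positivity) (by positivity),
      Real.mul_rpow (by positivity) (by positivity),
      ← Real.rpow_mul hκ0.le, ← Real.rpow_mul hκ0.le, ← Real.rpow_mul hA.le, ← Real.rpow_mul hA.le,
      ← Real.rpow_mul h3.le, mul_comm s, hs1, hαp, Real.inv_rpow h0.le, mul_comm (p - 1) p,
      show (1 - p) * p = -p * (p - 1) by ring]
    have : t ^ (p - 1) ≠ 0 := by positivity
    field_simp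
  · intro t h0 h1
    have hA := hge t h0 h1.le
    have hA' := hge2 t h0 h1.le
    have hA0 : 0 < A₁ R t := by linarith
    have hB0 : 0 < A₂ R t := by linarith
    have hBA : A₂ R t ≤ A₁ R t := Real.log_le_self hA0.le
    have hdB : HasDerivAt (A₂ R) (-(1 / t) / A₁ R t) t := (hasDerivAt_A₁ hR h0).log hA0.ne'
    have hdA := hasDerivAt_A₁ hR h0
    have hsm := (hsmall t h0 (h1.le.trans hηlt.le)).2.2
    have hhl := hhle t h0 h1.le
    set A := A₁ R t with hAdef
    set B := A₂ R t with hBdef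
    have hh0 : 0 ≤ a / B := by positivity
    have hAp : A ^ (1 - p) = A ^ (-p) * A := by
      rw [← Real.rpow_add_one hA0.ne']; congr 1; ring
    have hd : deriv (fun t => κ ^ (p - 1) * (A₁ R t ^ (1 - p) * (1 + a / A₂ R t))) t =
        κ ^ (p - 1) * (A ^ (-p) * t⁻¹) * ((p - 1) * (1 + a / B) + a / B ^ 2) := by
      have hd1 : HasDerivAt (fun t : ℝ => A₁ R t ^ (1 - p)) ((p - 1) * A ^ (-p) * t⁻¹) t := by
        refine (hdA.rpow_const (p := 1 - p) (Or.inl hA0.ne')).congr_deriv ?_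
        rw [← hAdef, show 1 - p - 1 = -p by ring]
        field_simp
        ring
      have hd2 : HasDerivAt (fun t : ℝ => 1 + a / A₂ R t) (a / B ^ 2 * (t⁻¹ / A)) t := by
        have := ((hdB.inv hB0.ne').const_mul a).const_add 1
        simp only [Pi.inv_apply, ← div_eq_mul_inv] at this
        refine this.congr_deriv ?_
        rw [← hBdef]
        field_simp
      refine ((hd1.mul hd2).const_mul (κ ^ (p - 1))).deriv.trans ?_
      rw [← hAdef, ← hBdef, hAp]
      field_simp
    rw [hd]
    have hpow := one_add_rpow_le hs0.le hh0 (by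
      have : a / B ≤ a := div_le_self ha0.le hA'
      nlinarith)
    have hκp' : κ ^ p = κ ^ (p - 1) * κ := by
      rw [← Real.rpow_add_one hκ0.ne']; congr 1; ring
    have hwt : t ^ (α * p) / t ^ p = t⁻¹ := by
      rw [← Real.rpow_sub h0, hαp, ← Real.rpow_neg_one]; congr 1; ring
    have hAinv : 1 / A ^ p = A ^ (-p) := by rw [Real.rpow_neg hA0.le, one_div]
    rw [hΛ, hwt, hκp', hAp, hAinv]
    set Y := (1 + a / B) ^ s with hY
    have hP : 0 ≤ κ ^ (p - 1) * (A ^ (-p) * t⁻¹) := by positivity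
    have hKt : 8 * (K * t * A) ≤ a / B ^ 2 := by
      rw [le_div_iff₀ (by positivity)]
      have : B ^ 2 ≤ A ^ 2 := by gcongr
      have : K * t * A * B ^ 2 ≤ K * t * A * A ^ 2 := by gcongr
      linarith
    have hlow : κ + a / 4 * (1 / B ^ 2) ≤
        (p - 1) * (1 + a / B) + a / B ^ 2 - K * t * A * (1 + a / B) - (p - 1) * κ * Y := by
      have e1 : (p - 1) * κ * Y ≤ (p - 1) * κ * (1 + s * (a / B) + s ^ 2 * (a / B) ^ 2) := by
        gcongr
      have e2 : (p - 1) * κ * (1 + s * (a / B) + s ^ 2 * (a / B) ^ 2) =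
          (p - 1) * (1 + a / B) - κ + (p * a) * (a / B ^ 2) := by
        have : (p - 1) * κ * (1 + s * (a / B) + s ^ 2 * (a / B) ^ 2) =
          (κ * p - κ) + (p - 1) * (κ * s) * (a / B) +
            ((p - 1) * s) * (κ * s) * (a / B) ^ 2 := by ring
        rw [this, hs1, hκs, hκp]
        field_simp
        ring
      have e3 : (p * a) * (a / B ^ 2) ≤ 1 / 2 * (a / B ^ 2) := by gcongr
      have e4 : K * t * A * (1 + a / B) ≤ K * t * A * 2 := by
        gcongr
        linarith
      have e5 : a / 4 * (1 / B ^ 2) = 1 / 4 * (a / B ^ 2) := by ring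
      linarith
    calc (κ ^ (p - 1) * κ * A ^ (-p) + κ ^ (p - 1) * (a / 4) * (A ^ (-p) * (1 / B ^ 2))) * t⁻¹
        = κ ^ (p - 1) * (A ^ (-p) * t⁻¹) * (κ + a / 4 * (1 / B ^ 2)) := by ring
      _ ≤ κ ^ (p - 1) * (A ^ (-p) * t⁻¹) * ((p - 1) * (1 + a / B) + a / B ^ 2
          - K * t * A * (1 + a / B) - (p - 1) * κ * Y) := mul_le_mul_of_nonneg_left hlow hP
      _ = _ := by field_simp

/-! ### Traces -/

lemma eLpNorm_rpow_eq {X E : Type*} [MeasurableSpace X] [NormedAddCommGroup E] {p : ℝ} (hp : 0 < p)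
    (f : X → E) (μ : Measure X) :
    eLpNorm f (ENNReal.ofReal p) μ ^ p = ∫⁻ x, ENNReal.ofReal (‖f x‖ ^ p) ∂μ := by
  rw [eLpNorm_eq_lintegral_rpow_enorm_toReal (by simpa using hp) ENNReal.ofReal_ne_top,
    ENNReal.toReal_ofReal hp.le, ← ENNReal.rpow_mul, one_div_mul_cancel hp.ne', ENNReal.rpow_one]
  refine lintegral_congr fun x => ?_
  rw [← ofReal_norm, ENNReal.ofReal_rpow_of_nonneg (norm_nonneg _) hp.le]

lemma measurable_δ_rpow {N : ℕ} (Ω : Set (Eu N)) (s : ℝ) : Measurable fun x => δ Ω x ^ s :=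
  (continuous_δ Ω).measurable.pow_const s

lemma setLIntegral_weightedMeasure {N : ℕ} {Ω A : Set (Eu N)} (hA : MeasurableSet A) (hAΩ : A ⊆ Ω)
    (α p : ℝ) (F : Eu N → ℝ≥0∞) :
    ∫⁻ x in A, F x ∂(weightedMeasure Ω α p) =
      ∫⁻ x in A, ENNReal.ofReal (δ Ω x ^ (α * p)) * F x := by
  rw [weightedMeasure, restrict_withDensity hA, Measure.restrict_restrict hA,
    inter_eq_self_of_subset_left hAΩ, lintegral_withDensity_eq_lintegral_mul_non_measurable _
      (measurable_δ_rpow Ω _).ennreal_ofReal (ae_of_all _ fun _ => ENNReal.ofReal_lt_top)]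
  rfl

lemma weightedMeasure_restrict_self {N : ℕ} {Ω : Set (Eu N)} (hΩ : MeasurableSet Ω) (α p : ℝ) :
    (weightedMeasure Ω α p).restrict Ω = weightedMeasure Ω α p := by
  rw [weightedMeasure, restrict_withDensity hΩ, Measure.restrict_restrict hΩ, inter_self]

lemma setLIntegral_rpow_mul {N : ℕ} {E : Type*} [NormedAddCommGroup E] {Ω A : Set (Eu N)}
    (hA : MeasurableSet A) (hAΩ : A ⊆ Ω) (α : ℝ) {p : ℝ} (hp : 0 < p) (f : Eu N → E) :
    ∫⁻ x in A, ENNReal.ofReal (‖f x‖ ^ p * δ Ω x ^ (α * p)) =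
      eLpNorm f (ENNReal.ofReal p) ((weightedMeasure Ω α p).restrict A) ^ p := by
  rw [eLpNorm_rpow_eq hp, setLIntegral_weightedMeasure hA hAΩ]
  refine lintegral_congr fun x => ?_
  rw [mul_comm, ENNReal.ofReal_mul (Real.rpow_nonneg (δ_nonneg Ω x) _)]

lemma absolutelyContinuous_weightedMeasure {N : ℕ} {Ω : Set (Eu N)} (hΩ : IsBoundedC2Domain Ω)
    (hN : 1 ≤ N) (α p : ℝ) : volume.restrict Ω ≪ weightedMeasure Ω α p := by
  refine withDensity_absolutelyContinuous' (measurable_δ_rpow Ω _).ennreal_ofReal.aemeasurable ?_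
  refine (ae_restrict_iff' hΩ.isOpen.measurableSet).2 (ae_of_all _ fun x hx => ?_)
  have := Real.rpow_pos_of_pos (δ_pos hΩ hN hx) (α * p)
  simpa using this

lemma norm_gradient_eq {N : ℕ} (φ : Eu N → ℝ) (x : Eu N) : ‖∇ φ x‖ = ‖fderiv ℝ φ x‖ := by
  rw [gradient, LinearIsometryEquiv.norm_map]

lemma IsTestFunction.continuous_gradient {N : ℕ} {Ω : Set (Eu N)} {φ : Eu N → ℝ}
    (h : IsTestFunction Ω φ) : Continuous (∇ φ) :=
  (InnerProductSpace.toDual ℝ (Eu N)).symm.continuous.comp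
    ((h.1.of_le (by exact_mod_cast le_top) : ContDiff ℝ 1 φ).continuous_fderiv one_ne_zero)

lemma IsTestFunction.differentiable {N : ℕ} {Ω : Set (Eu N)} {φ : Eu N → ℝ}
    (h : IsTestFunction Ω φ) : Differentiable ℝ φ :=
  (h.1.of_le (by exact_mod_cast le_top) : ContDiff ℝ 1 φ).differentiable one_ne_zero

lemma IsTestFunction.sub {N : ℕ} {Ω : Set (Eu N)} {φ χ : Eu N → ℝ}
    (h : IsTestFunction Ω φ) (h' : IsTestFunction Ω χ) : IsTestFunction Ω fun x => φ x - χ x :=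
  ⟨h.1.sub h'.1, h.2.1.sub h'.2.1, (tsupport_sub φ χ).trans (union_subset h.2.2 h'.2.2)⟩

lemma IsTestFunction.gradient_sub {N : ℕ} {Ω : Set (Eu N)} {φ χ : Eu N → ℝ}
    (h : IsTestFunction Ω φ) (h' : IsTestFunction Ω χ) :
    ∇ (fun x => φ x - χ x) = fun x => ∇ φ x - ∇ χ x := by
  ext1 x
  rw [gradient, gradient, gradient, ← map_sub]
  congr 1
  exact fderiv_fun_sub (h.differentiable x) (h'.differentiable x)

/-- The restriction to `Σ_η` is bounded on test functions, from the norm of `W^{1,p}_{α,0}(Ω)`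
to `L^p(Σ_η)`. -/
lemma exists_trace_bound {N : ℕ} {Ω : Set (Eu N)} (hΩ : IsBoundedC2Domain Ω) {p : ℝ} (hp : 1 < p)
    (α : ℝ) {η C : ℝ} (hη : 0 < η) (hC : 0 < C)
    (htr : ∀ g : Eu N → ℝ, ContDiff ℝ 1 g → (∀ x, 0 ≤ g x) →
        ∫⁻ x, ENNReal.ofReal (g x) ∂(surfaceMeasure Ω η) ≤ ENNReal.ofReal C *
          ∫⁻ x in {x | x ∈ Ω ∧ η ≤ δ Ω x}, ENNReal.ofReal (g x + C * ‖fderiv ℝ g x‖)) :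
    ∃ A : ℝ≥0∞, A ≠ ∞ ∧ ∀ φ, IsTestFunction Ω φ →
      eLpNorm φ (ENNReal.ofReal p) (surfaceMeasure Ω η) ≤
        A * (eLpNorm (∇ φ) (ENNReal.ofReal p) (weightedMeasure Ω α p) +
          eLpNorm φ (ENNReal.ofReal p) (weightedMeasure Ω α p)) := by
  have hp0 : 0 < p := by linarith
  have hΩm := hΩ.isOpen.measurableSet
  -- The weight is bounded below on the region `δ ≥ η` where the trace is estimated.
  have hK : IsCompact (closure Ω ∩ {x | η ≤ δ Ω x}) :=
    Metric.isCompact_of_isClosed_isBounded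
      (isClosed_closure.inter (isClosed_le continuous_const (continuous_δ Ω)))
      (hΩ.isBounded.closure.subset inter_subset_left)
  obtain ⟨m, hm, hmle⟩ : ∃ m, 0 < m ∧ ∀ x ∈ closure Ω ∩ {x | η ≤ δ Ω x}, m ≤ δ Ω x ^ (α * p) := by
    refine hK.exists_forall_le' (f := fun x => δ Ω x ^ (α * p)) ?_ (a := 0) fun x hx => ?_
    · refine (continuous_δ Ω).continuousOn.rpow_const fun x hx => Or.inl ?_
      have : η ≤ δ Ω x := hx.2
      linarith
    · have : η ≤ δ Ω x := hx.2
      exact Real.rpow_pos_of_pos (by linarith) _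
  set D := C * ((1 + C * p) / m) with hD
  have hD0 : 0 ≤ D := by positivity
  refine ⟨ENNReal.ofReal D ^ (1 / p),
    ENNReal.rpow_ne_top_of_nonneg (by positivity) ENNReal.ofReal_ne_top, fun φ hφ => ?_⟩
  have hφ1 : ContDiff ℝ 1 φ := hφ.1.of_le (by exact_mod_cast le_top)
  have h1 := htr (fun x => ‖φ x‖ ^ p) ((contDiff_norm_rpow hp).comp hφ1) (fun x => by positivity)
  set X := eLpNorm (∇ φ) (ENNReal.ofReal p) (weightedMeasure Ω α p) with hX
  set Y := eLpNorm φ (ENNReal.ofReal p) (weightedMeasure Ω α p) with hY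
  have hXp : ∫⁻ x in Ω, ENNReal.ofReal (‖∇ φ x‖ ^ p * δ Ω x ^ (α * p)) = X ^ p := by
    rw [setLIntegral_rpow_mul hΩm subset_rfl α hp0, weightedMeasure_restrict_self hΩm]
  have hYp : ∫⁻ x in Ω, ENNReal.ofReal (‖φ x‖ ^ p * δ Ω x ^ (α * p)) = Y ^ p := by
    rw [setLIntegral_rpow_mul hΩm subset_rfl α hp0, weightedMeasure_restrict_self hΩm]
  have hmeas : Measurable fun x => ENNReal.ofReal (‖∇ φ x‖ ^ p * δ Ω x ^ (α * p)) :=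
    ((hφ.continuous_gradient.norm.measurable.pow_const p).mul
      (measurable_δ_rpow Ω _)).ennreal_ofReal
  have h2 : ∫⁻ x in {x | x ∈ Ω ∧ η ≤ δ Ω x},
      ENNReal.ofReal (‖φ x‖ ^ p + C * ‖fderiv ℝ (fun x => ‖φ x‖ ^ p) x‖) ≤
      ENNReal.ofReal ((1 + C * p) / m) * (X ^ p + Y ^ p) := by
    rw [← hXp, ← hYp, ← lintegral_add_left hmeas, ← lintegral_const_mul' _ _ ENNReal.ofReal_ne_top]
    refine le_trans (setLIntegral_mono_ae' ?_ (ae_of_all _ ?_))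
      (lintegral_mono_set (fun x hx => hx.1))
    · exact hΩm.inter (measurableSet_le measurable_const (continuous_δ Ω).measurable)
    intro x hx
    have hw := hmle x ⟨subset_closure hx.1, hx.2⟩
    have h3 := norm_fderiv_norm_rpow_le hφ.differentiable (x := x) hp
    have h4 := young_weighted hp (norm_nonneg (φ x)) (norm_nonneg (fderiv ℝ φ x)) zero_le_one
      zero_le_one zero_le_one (by simp)
    rw [mul_one, mul_one, mul_one] at h4
    have hδ : 0 ≤ δ Ω x ^ (α * p) := Real.rpow_nonneg (δ_nonneg Ω x) _
    rw [← ENNReal.ofReal_add (by positivity) (by positivity), ← ENNReal.ofReal_mul (by positivity),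
      norm_gradient_eq]
    apply ENNReal.ofReal_le_ofReal
    set a := ‖φ x‖ ^ p
    set b := ‖fderiv ℝ φ x‖ ^ p
    have ha : 0 ≤ a := by positivity
    have hb : 0 ≤ b := by positivity
    calc a + C * ‖fderiv ℝ (fun x => ‖φ x‖ ^ p) x‖ ≤ a + C * (b + (p - 1) * a) := by
          gcongr
          exact h3.trans h4
      _ ≤ (1 + C * p) * (b + a) := by
          have : 0 ≤ C * p * b := by positivity
          have h5 : C * b ≤ C * p * b := by
            have : C * 1 ≤ C * p := by gcongr
            nlinarith
          have : 0 ≤ C * a := by positivity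
          linarith
      _ = (1 + C * p) / m * (m * (b + a)) := by field_simp
      _ ≤ (1 + C * p) / m * (δ Ω x ^ (α * p) * (b + a)) := by gcongr
      _ = _ := by ring
  have h3 : eLpNorm φ (ENNReal.ofReal p) (surfaceMeasure Ω η) ^ p ≤
      ENNReal.ofReal D * (X + Y) ^ p := by
    rw [eLpNorm_rpow_eq hp0]
    refine h1.trans ((mul_le_mul_right h2 _).trans ?_)
    rw [← mul_assoc, ← ENNReal.ofReal_mul hC.le]
    gcongr
    exact ENNReal.add_rpow_le_rpow_add X Y hp.le
  have h4 := ENNReal.rpow_le_rpow h3 (by positivity : 0 ≤ 1 / p)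
  rwa [ENNReal.mul_rpow_of_nonneg _ _ (by positivity), ← ENNReal.rpow_mul, ← ENNReal.rpow_mul,
    mul_one_div_cancel hp0.ne', ENNReal.rpow_one, ENNReal.rpow_one] at h4

/-- On `Σ_η`, two approximating sequences of the same function come close to each other. -/
lemma TestApproximates.eLpNorm_surface_sub_le {N : ℕ} {Ω : Set (Eu N)} {α p : ℝ} (hp : 1 < p)
    {u : Eu N → ℝ} {g : Eu N → Eu N} (hu : MemLp u (ENNReal.ofReal p) (weightedMeasure Ω α p))
    (hg : MemLp g (ENNReal.ofReal p) (weightedMeasure Ω α p)) {η : ℝ} {A : ℝ≥0∞}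
    (hA : ∀ φ, IsTestFunction Ω φ →
      eLpNorm φ (ENNReal.ofReal p) (surfaceMeasure Ω η) ≤
        A * (eLpNorm (∇ φ) (ENNReal.ofReal p) (weightedMeasure Ω α p) +
          eLpNorm φ (ENNReal.ofReal p) (weightedMeasure Ω α p)))
    {φ χ : ℕ → Eu N → ℝ} (hφ : TestApproximates Ω α p φ u g) (hχ : TestApproximates Ω α p χ u g)
    (k l : ℕ) :
    eLpNorm (fun x => φ k x - χ l x) (ENNReal.ofReal p) (surfaceMeasure Ω η) ≤
      A * ((eLpNorm (fun x => ∇ (φ k) x - g x) (ENNReal.ofReal p) (weightedMeasure Ω α p) +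
        eLpNorm (fun x => φ k x - u x) (ENNReal.ofReal p) (weightedMeasure Ω α p)) +
        (eLpNorm (fun x => ∇ (χ l) x - g x) (ENNReal.ofReal p) (weightedMeasure Ω α p) +
        eLpNorm (fun x => χ l x - u x) (ENNReal.ofReal p) (weightedMeasure Ω α p))) := by
  have hP1 : 1 ≤ ENNReal.ofReal p := by
    rw [← ENNReal.ofReal_one]; exact ENNReal.ofReal_le_ofReal hp.le
  have htri : ∀ {E : Type} [NormedAddCommGroup E] (a b c : Eu N → E),
      AEStronglyMeasurable a (weightedMeasure Ω α p) →
      AEStronglyMeasurable b (weightedMeasure Ω α p) →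
      AEStronglyMeasurable c (weightedMeasure Ω α p) →
      eLpNorm (fun x => a x - b x) (ENNReal.ofReal p) (weightedMeasure Ω α p) ≤
      eLpNorm (fun x => a x - c x) (ENNReal.ofReal p) (weightedMeasure Ω α p) +
      eLpNorm (fun x => b x - c x) (ENNReal.ofReal p) (weightedMeasure Ω α p) := by
    intro E _ a b c ha hb hc
    have h := eLpNorm_sub_le (ha.sub hc) (hb.sub hc) hP1
    have e : a - c - (b - c) = fun x => a x - b x := by
      ext x
      simp
    rw [e] at h
    exact h
  refine (hA _ ((hφ.1 k).sub (hχ.1 l))).trans ?_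
  rw [(hφ.1 k).gradient_sub (hχ.1 l)]
  have h1 := htri (∇ (φ k)) (∇ (χ l)) g (hφ.1 k).continuous_gradient.aestronglyMeasurable
    (hχ.1 l).continuous_gradient.aestronglyMeasurable hg.1
  have h2 := htri (φ k) (χ l) u (hφ.1 k).1.continuous.aestronglyMeasurable
    (hχ.1 l).1.continuous.aestronglyMeasurable hu.1
  rw [add_add_add_comm]
  gcongr

/-- Existence of the trace, from completeness of `L^p(Σ_η)`. -/
lemma exists_isTrace {N : ℕ} {Ω : Set (Eu N)} {α p : ℝ} (hp : 1 < p) {η : ℝ}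
    (hfin : surfaceMeasure Ω η univ ≠ ∞) {A : ℝ≥0∞} (hAtop : A ≠ ∞)
    (hA : ∀ φ, IsTestFunction Ω φ →
      eLpNorm φ (ENNReal.ofReal p) (surfaceMeasure Ω η) ≤
        A * (eLpNorm (∇ φ) (ENNReal.ofReal p) (weightedMeasure Ω α p) +
          eLpNorm φ (ENNReal.ofReal p) (weightedMeasure Ω α p)))
    {u : Eu N → ℝ} {g : Eu N → Eu N} (hW : MemW Ω α p u g) : ∃ τ, IsTrace Ω α p η u g τ := by
  obtain ⟨hu, hg, φ, hφ⟩ := hW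
  have hP1 : 1 ≤ ENNReal.ofReal p := by
    rw [← ENNReal.ofReal_one]; exact ENNReal.ofReal_le_ofReal hp.le
  have : Fact (1 ≤ ENNReal.ofReal p) := ⟨hP1⟩
  have : IsFiniteMeasure (surfaceMeasure Ω η) := ⟨lt_top_iff_ne_top.2 hfin⟩
  have hmem : ∀ {χ}, IsTestFunction Ω χ → MemLp χ (ENNReal.ofReal p) (surfaceMeasure Ω η) :=
    fun h => h.1.continuous.memLp_of_hasCompactSupport h.2.1
  set e : ℕ → ℝ≥0∞ := fun k =>
    eLpNorm (fun x => ∇ (φ k) x - g x) (ENNReal.ofReal p) (weightedMeasure Ω α p) +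
      eLpNorm (fun x => φ k x - u x) (ENNReal.ofReal p) (weightedMeasure Ω α p) with he
  have he0 : Tendsto e atTop (𝓝 0) := hφ.2
  have hmul : ∀ {f : ℕ → ℝ≥0∞}, Tendsto f atTop (𝓝 0) →
      Tendsto (fun k => A * f k) atTop (𝓝 0) := by
    intro f hf
    simpa using ENNReal.Tendsto.const_mul hf (Or.inr hAtop)
  set F : ℕ → Lp ℝ (ENNReal.ofReal p) (surfaceMeasure Ω η) := fun k => (hmem (hφ.1 k)).toLp (φ k)
    with hF
  have hcau : CauchySeq F := by
    refine EMetric.cauchySeq_iff.2 fun ε hε => ?_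
    have h2 : Tendsto (fun k => A * e k) atTop (𝓝 0) := hmul he0
    obtain ⟨n, hn⟩ := eventually_atTop.1
      (h2.eventually (gt_mem_nhds (ENNReal.half_pos hε.ne')))
    refine ⟨n, fun k hk l hl => ?_⟩
    rw [hF, Lp.edist_toLp_toLp]
    refine (TestApproximates.eLpNorm_surface_sub_le hp hu hg hA hφ hφ k l).trans_lt ?_
    rw [mul_add, ← ENNReal.add_halves ε]
    exact ENNReal.add_lt_add (hn k hk) (hn l hl)
  obtain ⟨τ, hτ⟩ := cauchySeq_tendsto_of_complete hcau
  have hτ' : Tendsto (fun k => eLpNorm (fun x => φ k x - τ x) (ENNReal.ofReal p)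
      (surfaceMeasure Ω η)) atTop (𝓝 0) := by
    refine ((Lp.tendsto_Lp_iff_tendsto_eLpNorm' F τ).1 hτ).congr fun k => ?_
    refine eLpNorm_congr_ae ?_
    filter_upwards [(hmem (hφ.1 k)).coeFn_toLp] with x hx
    simp only [Pi.sub_apply, hF, hx]
  refine ⟨τ, Lp.memLp τ, fun χ hχ => ?_⟩
  have hsum : Tendsto (fun k => A * ((eLpNorm (fun x => ∇ (χ k) x - g x) (ENNReal.ofReal p)
      (weightedMeasure Ω α p) + eLpNorm (fun x => χ k x - u x) (ENNReal.ofReal p)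
      (weightedMeasure Ω α p)) + e k) +
      eLpNorm (fun x => φ k x - τ x) (ENNReal.ofReal p) (surfaceMeasure Ω η)) atTop (𝓝 0) := by
    simpa using (hmul (by simpa using hχ.2.add he0)).add hτ'
  refine tendsto_of_tendsto_of_tendsto_of_le_of_le tendsto_const_nhds hsum
    (fun _ => zero_le) fun k => ?_
  have h1 := TestApproximates.eLpNorm_surface_sub_le hp hu hg hA hχ hφ k k
  have h2 := eLpNorm_add_le (μ := surfaceMeasure Ω η)
    (((hmem (hχ.1 k)).1).sub (hmem (hφ.1 k)).1)
    (((hmem (hφ.1 k)).1).sub (Lp.memLp τ).1) hP1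
  have h3 : (χ k - φ k + (φ k - (τ : Eu N → ℝ))) = fun x => χ k x - τ x := by
    ext x; simp
  rw [h3] at h2
  exact h2.trans (add_le_add h1 le_rfl)

/-! ### Passage from test functions to `W^{1,p}_{α,0}(Ω)` -/

lemma eLpNorm_le_add_eLpNorm_sub {X E : Type*} [MeasurableSpace X] [NormedAddCommGroup E]
    {μ : Measure X} {P : ℝ≥0∞} (hP : 1 ≤ P) {f g : X → E} (hf : AEStronglyMeasurable f μ)
    (hg : AEStronglyMeasurable g μ) :
    eLpNorm f P μ ≤ eLpNorm g P μ + eLpNorm (fun x => f x - g x) P μ := by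
  have h := eLpNorm_add_le hg (hf.sub hg) hP
  have e : g + (f - g) = f := by abel
  rw [e] at h
  exact h

lemma tendsto_add_rpow {a : ℝ≥0∞} {e : ℕ → ℝ≥0∞} (he : Tendsto e atTop (𝓝 0)) (p : ℝ) :
    Tendsto (fun k => (a + e k) ^ p) atTop (𝓝 (a ^ p)) := by
  have h : Tendsto (fun k => a + e k) atTop (𝓝 a) := by
    simpa using he.const_add a
  exact (ENNReal.continuous_rpow_const.tendsto a).comp h

/-- A weighted inequality that holds for test functions passes to the limit: along a subsequence
the approximating test functions converge almost everywhere, so that Fatou's lemma applies. -/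
lemma lintegral_le_of_forall_isTestFunction {N : ℕ} {Ω : Set (Eu N)} (hΩ : IsBoundedC2Domain Ω)
    (hN : 1 ≤ N) {α p η : ℝ} (hp : 1 < p) {W : Eu N → ℝ} (hWm : Measurable W) {L : ℝ}
    (htest : ∀ φ, IsTestFunction Ω φ →
      ∫⁻ x in nbhd Ω η, ENNReal.ofReal (W x * |φ x| ^ p) ≤
        (∫⁻ x in nbhd Ω η, ENNReal.ofReal (‖fderiv ℝ φ x‖ ^ p * δ Ω x ^ (α * p))) +
        ENNReal.ofReal L * ∫⁻ x, ENNReal.ofReal (|φ x| ^ p) ∂(surfaceMeasure Ω η))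
    {u : Eu N → ℝ} {g : Eu N → Eu N} (hW : MemW Ω α p u g) {τ : Eu N → ℝ}
    (hτ : IsTrace Ω α p η u g τ) :
    ∫⁻ x in nbhd Ω η, ENNReal.ofReal (W x * |u x| ^ p) ≤
      (∫⁻ x in nbhd Ω η, ENNReal.ofReal (‖g x‖ ^ p * δ Ω x ^ (α * p))) +
      ENNReal.ofReal L * ∫⁻ x, ENNReal.ofReal (|τ x| ^ p) ∂(surfaceMeasure Ω η) := by
  have hp0 : 0 < p := by linarith
  have hP1 : 1 ≤ ENNReal.ofReal p := by
    rw [← ENNReal.ofReal_one]; exact ENNReal.ofReal_le_ofReal hp.le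
  obtain ⟨hu, hg, φ, hφ⟩ := hW
  have hA : MeasurableSet (nbhd Ω η) := measurableSet_nbhd hΩ η
  have hAΩ : nbhd Ω η ⊆ Ω := fun x hx => hx.1
  set μ := weightedMeasure Ω α p with hμ
  set σ := surfaceMeasure Ω η with hσ
  have hgrad : Tendsto (fun k => eLpNorm (fun x => ∇ (φ k) x - g x) (ENNReal.ofReal p) μ)
      atTop (𝓝 0) :=
    tendsto_of_tendsto_of_tendsto_of_le_of_le tendsto_const_nhds hφ.2 (fun _ => zero_le)
      fun _ => le_self_add
  have hval : Tendsto (fun k => eLpNorm (fun x => φ k x - u x) (ENNReal.ofReal p) μ)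
      atTop (𝓝 0) :=
    tendsto_of_tendsto_of_tendsto_of_le_of_le tendsto_const_nhds hφ.2 (fun _ => zero_le)
      fun _ => le_add_self
  have htr := hτ.2 φ hφ
  obtain ⟨ns, hns, hae⟩ := (tendstoInMeasure_of_tendsto_eLpNorm (f := φ) (g := u)
    (by simpa using hp0) (fun k => (hφ.1 k).1.continuous.aestronglyMeasurable) hu.1
    hval).exists_seq_tendsto_ae
  have hae' : ∀ᵐ x ∂(volume.restrict (nbhd Ω η)),
      Tendsto (fun k => φ (ns k) x) atTop (𝓝 (u x)) :=
    ae_mono (Measure.restrict_mono hAΩ le_rfl)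
      ((absolutelyContinuous_weightedMeasure hΩ hN α p).ae_le hae)
  set X := eLpNorm g (ENNReal.ofReal p) (μ.restrict (nbhd Ω η)) with hX
  set Y := eLpNorm τ (ENNReal.ofReal p) σ with hY
  have hXp : ∫⁻ x in nbhd Ω η, ENNReal.ofReal (‖g x‖ ^ p * δ Ω x ^ (α * p)) = X ^ p :=
    setLIntegral_rpow_mul hA hAΩ α hp0 g
  have hYp : ∫⁻ x, ENNReal.ofReal (|τ x| ^ p) ∂σ = Y ^ p := (eLpNorm_rpow_eq hp0 τ σ).symm
  have hbound : ∀ k, ∫⁻ x in nbhd Ω η, ENNReal.ofReal (W x * |φ k x| ^ p) ≤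
      (X + eLpNorm (fun x => ∇ (φ k) x - g x) (ENNReal.ofReal p) μ) ^ p + ENNReal.ofReal L *
        (Y + eLpNorm (fun x => φ k x - τ x) (ENNReal.ofReal p) σ) ^ p := by
    intro k
    refine (htest (φ k) (hφ.1 k)).trans ?_
    have e1 : ∫⁻ x in nbhd Ω η, ENNReal.ofReal (‖fderiv ℝ (φ k) x‖ ^ p * δ Ω x ^ (α * p)) =
        eLpNorm (∇ (φ k)) (ENNReal.ofReal p) (μ.restrict (nbhd Ω η)) ^ p := by
      rw [← setLIntegral_rpow_mul hA hAΩ α hp0]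
      simp only [norm_gradient_eq]
    have e2 : ∫⁻ x, ENNReal.ofReal (|φ k x| ^ p) ∂σ = eLpNorm (φ k) (ENNReal.ofReal p) σ ^ p :=
      (eLpNorm_rpow_eq hp0 (φ k) σ).symm
    rw [e1, e2]
    gcongr
    · exact (eLpNorm_le_add_eLpNorm_sub hP1
        (hφ.1 k).continuous_gradient.aestronglyMeasurable hg.1.restrict).trans
        (add_le_add le_rfl (eLpNorm_mono_measure _ Measure.restrict_le_self))
    · exact eLpNorm_le_add_eLpNorm_sub hP1 (hφ.1 k).1.continuous.aestronglyMeasurable hτ.1.1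
  have hlim : Tendsto (fun k =>
      (X + eLpNorm (fun x => ∇ (φ (ns k)) x - g x) (ENNReal.ofReal p) μ) ^ p + ENNReal.ofReal L *
        (Y + eLpNorm (fun x => φ (ns k) x - τ x) (ENNReal.ofReal p) σ) ^ p) atTop
      (𝓝 (X ^ p + ENNReal.ofReal L * Y ^ p)) :=
    (tendsto_add_rpow (hgrad.comp hns.tendsto_atTop) p).add
      (ENNReal.Tendsto.const_mul (tendsto_add_rpow (htr.comp hns.tendsto_atTop) p)
        (Or.inr ENNReal.ofReal_ne_top))
  rw [hXp, hYp]
  calc ∫⁻ x in nbhd Ω η, ENNReal.ofReal (W x * |u x| ^ p)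
      = ∫⁻ x in nbhd Ω η, liminf (fun k => ENNReal.ofReal (W x * |φ (ns k) x| ^ p)) atTop := by
        refine lintegral_congr_ae ?_
        filter_upwards [hae'] with x hx
        refine (Tendsto.liminf_eq ?_).symm
        exact ENNReal.tendsto_ofReal
          ((hx.abs.rpow_const (Or.inr hp0.le)).const_mul (W x))
    _ ≤ liminf (fun k => ∫⁻ x in nbhd Ω η, ENNReal.ofReal (W x * |φ (ns k) x| ^ p)) atTop :=
        lintegral_liminf_le fun k => (hWm.mul
          ((hφ.1 (ns k)).1.continuous.abs.measurable.pow_const p)).ennreal_ofReal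
    _ ≤ _ := by
        rw [← hlim.liminf_eq]
        exact liminf_le_liminf (Eventually.of_forall fun k => hbound (ns k))

/-- The integrals are finite and the inequality extends, as soon as it holds for test functions.
The weight `δ^(αp)` equals `η^(αp)` on `Σ_η`, hence the comparison of `L'` with `L * η^(αp)`. -/
lemma hardy_of_forall_isTestFunction {N : ℕ} {Ω : Set (Eu N)} (hΩ : IsBoundedC2Domain Ω)
    (hN : 1 ≤ N) {α p η : ℝ} (hp : 1 < p) {P E : ℝ → ℝ}
    (hPm : Measurable P) (hEm : Measurable E) (hP0 : ∀ t, 0 < t → t < η → 0 ≤ P t)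
    (hE0 : ∀ t, 0 < t → t < η → 0 ≤ E t) {Λ₀ C₂ L' L : ℝ} (hΛ : 0 < Λ₀) (hC₂ : 0 < C₂)
    (hL' : 0 ≤ L') (hL : L' ≤ L * η ^ (α * p))
    (htest : ∀ φ, IsTestFunction Ω φ →
      ∫⁻ x in nbhd Ω η, ENNReal.ofReal ((Λ₀ * P (δ Ω x) + C₂ * E (δ Ω x)) *
          (δ Ω x ^ (α * p) / δ Ω x ^ p) * |φ x| ^ p) ≤
        (∫⁻ x in nbhd Ω η, ENNReal.ofReal (‖fderiv ℝ φ x‖ ^ p * δ Ω x ^ (α * p))) +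
        ENNReal.ofReal L' * ∫⁻ x, ENNReal.ofReal (|φ x| ^ p) ∂(surfaceMeasure Ω η))
    {u : Eu N → ℝ} {g : Eu N → Eu N} (hW : MemW Ω α p u g) {τ : Eu N → ℝ}
    (hτ : IsTrace Ω α p η u g τ) :
    IntegrableOn (fun x => ‖g x‖ ^ p * δ Ω x ^ (α * p)) (nbhd Ω η) ∧
    IntegrableOn (fun x => |u x / δ Ω x| ^ p * P (δ Ω x) * δ Ω x ^ (α * p)) (nbhd Ω η) ∧
    Integrable (fun x => |τ x| ^ p * δ Ω x ^ (α * p)) (surfaceMeasure Ω η) ∧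
    IntegrableOn (fun x => |u x / δ Ω x| ^ p * E (δ Ω x) * δ Ω x ^ (α * p)) (nbhd Ω η) ∧
    C₂ * ∫ x in nbhd Ω η, |u x / δ Ω x| ^ p * E (δ Ω x) * δ Ω x ^ (α * p) ≤
      (∫ x in nbhd Ω η, (‖g x‖ ^ p - Λ₀ * (|u x / δ Ω x| ^ p * P (δ Ω x))) * δ Ω x ^ (α * p)) +
      L * ∫ x, |τ x| ^ p * δ Ω x ^ (α * p) ∂(surfaceMeasure Ω η) := by
  have hp0 : 0 < p := by linarith
  have hA : MeasurableSet (nbhd Ω η) := measurableSet_nbhd hΩ η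
  have hAΩ : nbhd Ω η ⊆ Ω := fun x hx => hx.1
  have hδm : Measurable (δ Ω) := (continuous_δ Ω).measurable
  have hWm : Measurable fun x => (Λ₀ * P (δ Ω x) + C₂ * E (δ Ω x)) *
      (δ Ω x ^ (α * p) / δ Ω x ^ p) :=
    (((hPm.comp hδm).const_mul Λ₀).add ((hEm.comp hδm).const_mul C₂)).mul
      ((measurable_δ_rpow Ω _).div (measurable_δ_rpow Ω _))
  have hmain := lintegral_le_of_forall_isTestFunction hΩ hN hp hWm htest hW hτ
  obtain ⟨hu, hg, -⟩ := hW
  have hac : volume.restrict (nbhd Ω η) ≪ weightedMeasure Ω α p :=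
    (Measure.restrict_mono hAΩ le_rfl).absolutelyContinuous.trans
      (absolutelyContinuous_weightedMeasure hΩ hN α p)
  have hum : AEMeasurable u (volume.restrict (nbhd Ω η)) := (hu.1.mono_ac hac).aemeasurable
  have hgm : AEMeasurable (fun x => ‖g x‖) (volume.restrict (nbhd Ω η)) :=
    (hg.1.mono_ac hac).norm.aemeasurable
  have hδp : ∀ (s : ℝ) x, 0 ≤ δ Ω x ^ s := fun s x => Real.rpow_nonneg (δ_nonneg Ω x) s
  have hIg : IntegrableOn (fun x => ‖g x‖ ^ p * δ Ω x ^ (α * p)) (nbhd Ω η) := by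
    refine (lintegral_ofReal_ne_top_iff_integrable
      ((hgm.pow_const p).mul (measurable_δ_rpow Ω _).aemeasurable).aestronglyMeasurable
      (ae_of_all _ fun x => mul_nonneg (by positivity) (hδp _ x))).1 ?_
    refine ne_of_eq_of_ne (setLIntegral_rpow_mul hA hAΩ α hp0 g) ?_
    exact ENNReal.rpow_ne_top_of_nonneg hp0.le
      ((eLpNorm_mono_measure _ Measure.restrict_le_self).trans_lt hg.2).ne
  have hIτ : Integrable (fun x => |τ x| ^ p) (surfaceMeasure Ω η) := by
    refine (lintegral_ofReal_ne_top_iff_integrable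
      (hτ.1.1.norm.aemeasurable.pow_const p).aestronglyMeasurable
      (ae_of_all _ fun x => by positivity)).1 ?_
    refine ne_of_eq_of_ne (eLpNorm_rpow_eq hp0 τ (surfaceMeasure Ω η)).symm ?_
    exact ENNReal.rpow_ne_top_of_nonneg hp0.le hτ.1.2.ne
  have hση : ∀ᵐ x ∂(surfaceMeasure Ω η), |τ x| ^ p * δ Ω x ^ (α * p) =
      |τ x| ^ p * η ^ (α * p) := by
    have hS : MeasurableSet (parallelSurface Ω η) :=
      hΩ.isOpen.measurableSet.inter (measurableSet_eq_fun hδm measurable_const)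
    refine (ae_restrict_iff' hS).2 (ae_of_all _ fun x hx => ?_)
    rw [hx.2]
  have hIτ' : Integrable (fun x => |τ x| ^ p * δ Ω x ^ (α * p)) (surfaceMeasure Ω η) :=
    (integrable_congr hση).2 (hIτ.mul_const _)
  set H : Eu N → ℝ := fun x => (Λ₀ * P (δ Ω x) + C₂ * E (δ Ω x)) *
      (δ Ω x ^ (α * p) / δ Ω x ^ p) * |u x| ^ p with hH
  have hHm : AEStronglyMeasurable H (volume.restrict (nbhd Ω η)) :=
    (hWm.aemeasurable.mul (hum.norm.pow_const p)).aestronglyMeasurable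
  have hpos : ∀ x ∈ nbhd Ω η, 0 ≤ P (δ Ω x) ∧ 0 ≤ E (δ Ω x) := fun x hx =>
    ⟨hP0 _ (δ_pos hΩ hN hx.1) hx.2, hE0 _ (δ_pos hΩ hN hx.1) hx.2⟩
  have hH0 : 0 ≤ᵐ[volume.restrict (nbhd Ω η)] H := by
    refine (ae_restrict_iff' hA).2 (ae_of_all _ fun x hx => ?_)
    obtain ⟨h1, h2⟩ := hpos x hx
    exact mul_nonneg (mul_nonneg (by positivity) (div_nonneg (hδp _ x) (hδp _ x))) (by positivity)
  have hG0 : 0 ≤ᵐ[volume.restrict (nbhd Ω η)] fun x => ‖g x‖ ^ p * δ Ω x ^ (α * p) :=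
    ae_of_all _ fun x => mul_nonneg (by positivity) (hδp _ x)
  have hT0 : 0 ≤ᵐ[surfaceMeasure Ω η] fun x => |τ x| ^ p :=
    ae_of_all _ fun x => by positivity
  rw [← ofReal_integral_eq_lintegral_ofReal hIg hG0,
    ← ofReal_integral_eq_lintegral_ofReal hIτ hT0, ← ENNReal.ofReal_mul hL',
    ← ENNReal.ofReal_add (integral_nonneg_of_ae hG0)
      (mul_nonneg hL' (integral_nonneg_of_ae hT0))] at hmain
  have hIH : IntegrableOn H (nbhd Ω η) :=
    (lintegral_ofReal_ne_top_iff_integrable hHm hH0).1 (ne_top_of_le_ne_top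
      ENNReal.ofReal_ne_top hmain)
  rw [← ofReal_integral_eq_lintegral_ofReal hIH hH0, ENNReal.ofReal_le_ofReal_iff
    (add_nonneg (integral_nonneg_of_ae hG0) (mul_nonneg hL' (integral_nonneg_of_ae hT0)))] at hmain
  have hsplit : ∀ x, H x = Λ₀ * (|u x / δ Ω x| ^ p * P (δ Ω x) * δ Ω x ^ (α * p)) +
      C₂ * (|u x / δ Ω x| ^ p * E (δ Ω x) * δ Ω x ^ (α * p)) := by
    intro x
    rw [hH, abs_div, abs_of_nonneg (δ_nonneg Ω x), Real.div_rpow (abs_nonneg _) (δ_nonneg Ω x)]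
    ring
  have hterm : ∀ {Q : ℝ → ℝ}, Measurable Q → AEStronglyMeasurable
      (fun x => |u x / δ Ω x| ^ p * Q (δ Ω x) * δ Ω x ^ (α * p))
      (volume.restrict (nbhd Ω η)) := fun hQ =>
    ((((hum.div hδm.aemeasurable).norm.pow_const p).mul (hQ.comp hδm).aemeasurable).mul
      (measurable_δ_rpow Ω _).aemeasurable).aestronglyMeasurable
  have hnn : ∀ x ∈ nbhd Ω η, 0 ≤ |u x / δ Ω x| ^ p * P (δ Ω x) * δ Ω x ^ (α * p) ∧
      0 ≤ |u x / δ Ω x| ^ p * E (δ Ω x) * δ Ω x ^ (α * p) := by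
    intro x hx
    obtain ⟨h1, h2⟩ := hpos x hx
    exact ⟨mul_nonneg (by positivity) (hδp _ x), mul_nonneg (by positivity) (hδp _ x)⟩
  have hIP : IntegrableOn (fun x => |u x / δ Ω x| ^ p * P (δ Ω x) * δ Ω x ^ (α * p))
      (nbhd Ω η) := by
    refine Integrable.mono' (hIH.const_mul Λ₀⁻¹) (hterm hPm)
      ((ae_restrict_iff' hA).2 (ae_of_all _ fun x hx => ?_))
    obtain ⟨h1, h2⟩ := hnn x hx
    rw [Real.norm_of_nonneg h1, hsplit, le_inv_mul_iff₀ hΛ]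
    exact le_add_of_nonneg_right (mul_nonneg hC₂.le h2)
  have hIE : IntegrableOn (fun x => |u x / δ Ω x| ^ p * E (δ Ω x) * δ Ω x ^ (α * p))
      (nbhd Ω η) := by
    refine Integrable.mono' (hIH.const_mul C₂⁻¹) (hterm hEm)
      ((ae_restrict_iff' hA).2 (ae_of_all _ fun x hx => ?_))
    obtain ⟨h1, h2⟩ := hnn x hx
    rw [Real.norm_of_nonneg h2, hsplit, le_inv_mul_iff₀ hC₂]
    exact le_add_of_nonneg_left (mul_nonneg hΛ.le h1)
  refine ⟨hIg, hIP, hIτ', hIE, ?_⟩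
  have e1 : ∫ x in nbhd Ω η, H x =
      Λ₀ * (∫ x in nbhd Ω η, |u x / δ Ω x| ^ p * P (δ Ω x) * δ Ω x ^ (α * p)) +
      C₂ * ∫ x in nbhd Ω η, |u x / δ Ω x| ^ p * E (δ Ω x) * δ Ω x ^ (α * p) := by
    simp only [hsplit]
    rw [integral_add (hIP.const_mul _) (hIE.const_mul _), integral_const_mul, integral_const_mul]
  have e2 : ∫ x in nbhd Ω η, (‖g x‖ ^ p - Λ₀ * (|u x / δ Ω x| ^ p * P (δ Ω x))) *
      δ Ω x ^ (α * p) = (∫ x in nbhd Ω η, ‖g x‖ ^ p * δ Ω x ^ (α * p)) -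
      Λ₀ * ∫ x in nbhd Ω η, |u x / δ Ω x| ^ p * P (δ Ω x) * δ Ω x ^ (α * p) := by
    rw [← integral_const_mul, ← integral_sub hIg (hIP.const_mul _)]
    refine integral_congr_ae (ae_of_all _ fun x => ?_)
    ring
  have e3 : L' * ∫ x, |τ x| ^ p ∂(surfaceMeasure Ω η) ≤
      L * ∫ x, |τ x| ^ p * δ Ω x ^ (α * p) ∂(surfaceMeasure Ω η) := by
    rw [integral_congr_ae hση, integral_mul_const]
    have := integral_nonneg_of_ae hT0
    calc _ ≤ (L * η ^ (α * p)) * ∫ x, |τ x| ^ p ∂(surfaceMeasure Ω η) := by gcongr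
      _ = _ := by ring
  rw [e1] at hmain
  rw [e2]
  linarith

lemma measurable_A₁ (R : ℝ) : Measurable (A₁ R) :=
  Real.measurable_log.comp (measurable_const.div measurable_id)

lemma measurable_A₂ (R : ℝ) : Measurable (A₂ R) := Real.measurable_log.comp (measurable_A₁ R)

lemma Λ_pos {α p : ℝ} (hp : 1 < p) : 0 < Λ α p := by
  rw [Λ]
  split_ifs with h
  · have : 1 / p < 1 := (div_lt_one (by linarith)).2 hp
    exact Real.rpow_pos_of_pos (by linarith) _
  · exact Real.rpow_pos_of_pos (abs_pos.2 (by intro h'; apply h; linarith)) _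

/-- The Hardy inequality on `Ω_η` for a potential `(Λ₀ P + C₂ E) / t^p` admitting, for every bound
`K` on the curvature term, radial fields with a majorant `M` that does not depend on `Ω`. The
constants that depend on `Ω` are absorbed by the factor `1 / η` in `M η / (η * η ^ (α * p))`,
for `η` small. -/
lemma exists_hardy_of_radialField {α p R : ℝ} (hp : 1 < p) {P E : ℝ → ℝ} (hPm : Measurable P)
    (hEm : Measurable E) (hR : 0 < R) {t₀ : ℝ} (ht₀ : 0 < t₀)
    (hP0 : ∀ t, 0 < t → t < t₀ → 0 ≤ P t) (hE0 : ∀ t, 0 < t → t < t₀ → 0 ≤ E t)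
    {Λ₀ C₂ : ℝ} (hΛ : 0 < Λ₀) (hC₂ : 0 < C₂) {M : ℝ → ℝ} (hM : ∀ η, 0 < η → 0 < M η)
    (hF : ∀ K, 0 ≤ K → 0 < R → ∃ η₂ > 0, ∀ η, 0 < η → η < η₂ →
      Nonempty (RadialField p K (M η) η (fun t => t ^ (α * p))
        (fun t => (Λ₀ * P t + C₂ * E t) * (t ^ (α * p) / t ^ p))))
    {N : ℕ} {Ω : Set (Eu N)} (hN : 1 ≤ N) (hΩ : IsBoundedC2Domain Ω) :
    ∃ η₀ : ℝ, 0 < η₀ ∧ ∀ η : ℝ, 0 < η → η < η₀ →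
      ∀ (u : Eu N → ℝ) (g : Eu N → Eu N), MemW Ω α p u g →
        (∃ τ : Eu N → ℝ, IsTrace Ω α p η u g τ) ∧
        ∀ τ : Eu N → ℝ, IsTrace Ω α p η u g τ →
          IntegrableOn (fun x => ‖g x‖ ^ p * δ Ω x ^ (α * p)) (nbhd Ω η) ∧
          IntegrableOn (fun x => |u x / δ Ω x| ^ p * P (δ Ω x) * δ Ω x ^ (α * p)) (nbhd Ω η) ∧
          Integrable (fun x => |τ x| ^ p * δ Ω x ^ (α * p)) (surfaceMeasure Ω η) ∧
          IntegrableOn (fun x => |u x / δ Ω x| ^ p * E (δ Ω x) * δ Ω x ^ (α * p)) (nbhd Ω η) ∧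
          C₂ * ∫ x in nbhd Ω η, |u x / δ Ω x| ^ p * E (δ Ω x) * δ Ω x ^ (α * p) ≤
            (∫ x in nbhd Ω η,
              (‖g x‖ ^ p - Λ₀ * (|u x / δ Ω x| ^ p * P (δ Ω x))) * δ Ω x ^ (α * p)) +
            M η / (η * η ^ (α * p)) *
              ∫ x, |τ x| ^ p * δ Ω x ^ (α * p) ∂(surfaceMeasure Ω η) := by
  have hp0 : 0 < p := by linarith
  obtain ⟨ρ, hρ, c, hc, r, hr, hpatch⟩ := exists_uniform_isPatch hΩ
  have hu : HasUniformPatches Ω ρ c r := ⟨hρ, hc, hr, hpatch⟩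
  obtain ⟨η₁, hη₁, C, hC, hsurf⟩ := exists_parallelSurface_bounds hΩ hN hu
  obtain ⟨B, hB0, hB⟩ := exists_bound_deriv_smoothTransition
  obtain ⟨η₂, hη₂, hfield⟩ := hF (N * (2 / ρ)) (by positivity) hR
  refine ⟨min (min (ρ / 2) (1 / (B * C))) (min t₀ (min η₁ η₂)), by positivity,
    fun η hη hlt u g hW => ?_⟩
  obtain ⟨⟨hηρ, hηBC⟩, hηt, hη1, hη2⟩ :
      (η < ρ / 2 ∧ η < 1 / (B * C)) ∧ η < t₀ ∧ η < η₁ ∧ η < η₂ := by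
    simpa only [lt_min_iff] using hlt
  obtain ⟨hfin, htr, hshell⟩ := hsurf η hη hη1
  obtain ⟨F⟩ := hfield η hη hη2
  obtain ⟨A, hAtop, hA⟩ := exists_trace_bound hΩ hp α hη hC htr
  refine ⟨exists_isTrace hp hfin hAtop hA hW, fun τ hτ => ?_⟩
  have hM0 := hM η hη
  have hP0' : ∀ t, 0 < t → t < η → 0 ≤ P t := fun t h0 h1 => hP0 t h0 (h1.trans hηt)
  have hE0' : ∀ t, 0 < t → t < η → 0 ≤ E t := fun t h0 h1 => hE0 t h0 (h1.trans hηt)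
  refine hardy_of_forall_isTestFunction hΩ hN hp hPm hEm hP0' hE0' hΛ hC₂
    (L' := M η * B * C) (by positivity) ?_ (fun φ hφ => ?_) hW hτ
  · have hηp : 0 < η ^ (α * p) := Real.rpow_pos_of_pos hη _
    have h1 : B * C ≤ 1 / η := by
      rw [le_div_iff₀ hη]
      have := (lt_div_iff₀ (by positivity)).1 hηBC
      linarith
    calc M η * B * C = M η * (B * C) := by ring
      _ ≤ M η * (1 / η) := by gcongr
      _ = _ := by field_simp
  · refine lintegral_le_of_radialField hΩ hN hu hp hη hηρ.le
      (measurable_id.pow_const (α * p)) (fun t ht => Real.rpow_nonneg ht.le _) ?_ F hB0.le hB hC.le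
      hφ ?_
    · intro t h0 h1
      have h2 := hP0' t h0 h1
      have h3 := hE0' t h0 h1
      positivity
    · exact hshell (fun x => |φ x| ^ p)
        (hφ.1.continuous.abs.rpow_const fun _ => Or.inr hp0.le)
        (hφ.2.1.comp_left (g := fun s : ℝ => |s| ^ p) (by simp [hp0.ne']))
        (fun x => by positivity)

lemma pos_of_exp_mul_sSup_lt {N : ℕ} {Ω : Set (Eu N)} {R : ℝ}
    (h : Real.exp (Real.exp 1) * sSup (δ Ω '' Ω) < R) : 0 < R := by
  refine lt_of_le_of_lt (mul_nonneg (Real.exp_pos _).le (Real.sSup_nonneg ?_)) h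
  rintro _ ⟨x, -, rfl⟩
  exact δ_nonneg Ω x

end CriticalHardy

open CriticalHardy in
theorem theorem2p5 (p : ℝ) (hp : 1 < p) (α R : ℝ) :
    -- the case `α > 1 - 1/p`
    (1 - 1 / p < α →
      ∃ C₂ L : ℝ → ℝ, (∀ η, 0 < η → 0 < C₂ η ∧ 0 < L η) ∧
        ∀ (N : ℕ) (Ω : Set (Eu N)), 1 ≤ N → IsBoundedC2Domain Ω →
          Real.exp (Real.exp 1) * sSup (δ Ω '' Ω) < R →
          ∃ η₀ : ℝ, 0 < η₀ ∧ ∀ η : ℝ, 0 < η → η < η₀ →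
            ∀ (u : Eu N → ℝ) (g : Eu N → Eu N), MemW Ω α p u g →
              (∃ τ : Eu N → ℝ, IsTrace Ω α p η u g τ) ∧
              ∀ τ : Eu N → ℝ, IsTrace Ω α p η u g τ →
                IntegrableOn (fun x => ‖g x‖ ^ p * δ Ω x ^ (α * p)) (nbhd Ω η) ∧
                IntegrableOn (fun x => |u x / δ Ω x| ^ p * δ Ω x ^ (α * p)) (nbhd Ω η) ∧
                Integrable (fun x => |τ x| ^ p * δ Ω x ^ (α * p)) (surfaceMeasure Ω η) ∧
                IntegrableOn (fun x => |u x / δ Ω x| ^ p *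
                  (δ Ω x ^ (α * p) / A₁ R (δ Ω x) ^ 2)) (nbhd Ω η) ∧
                C₂ η * ∫ x in nbhd Ω η, |u x / δ Ω x| ^ p *
                    (δ Ω x ^ (α * p) / A₁ R (δ Ω x) ^ 2) ≤
                  (∫ x in nbhd Ω η,
                    (‖g x‖ ^ p - Λ α p * |u x / δ Ω x| ^ p) * δ Ω x ^ (α * p)) +
                  L η * ∫ x, |τ x| ^ p * δ Ω x ^ (α * p) ∂(surfaceMeasure Ω η)) ∧
    -- the case `α = 1 - 1/p`
    (α = 1 - 1 / p →
      ∃ C₂ L : ℝ → ℝ, (∀ η, 0 < η → 0 < C₂ η ∧ 0 < L η) ∧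
        ∀ (N : ℕ) (Ω : Set (Eu N)), 1 ≤ N → IsBoundedC2Domain Ω →
          Real.exp (Real.exp 1) * sSup (δ Ω '' Ω) < R →
          ∃ η₀ : ℝ, 0 < η₀ ∧ ∀ η : ℝ, 0 < η → η < η₀ →
            ∀ (u : Eu N → ℝ) (g : Eu N → Eu N), MemW Ω α p u g →
              (∃ τ : Eu N → ℝ, IsTrace Ω α p η u g τ) ∧
              ∀ τ : Eu N → ℝ, IsTrace Ω α p η u g τ →
                IntegrableOn (fun x => ‖g x‖ ^ p * δ Ω x ^ (p - 1)) (nbhd Ω η) ∧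
                IntegrableOn (fun x => |u x / δ Ω x| ^ p * (1 / A₁ R (δ Ω x) ^ p) *
                  δ Ω x ^ (p - 1)) (nbhd Ω η) ∧
                Integrable (fun x => |τ x| ^ p * δ Ω x ^ (p - 1)) (surfaceMeasure Ω η) ∧
                IntegrableOn (fun x => |u x / δ Ω x| ^ p * (1 / A₁ R (δ Ω x) ^ p) *
                  (1 / A₂ R (δ Ω x) ^ 2) * δ Ω x ^ (p - 1)) (nbhd Ω η) ∧
                C₂ η * ∫ x in nbhd Ω η, |u x / δ Ω x| ^ p * (1 / A₁ R (δ Ω x) ^ p) *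
                    (1 / A₂ R (δ Ω x) ^ 2) * δ Ω x ^ (p - 1) ≤
                  (∫ x in nbhd Ω η,
                    (‖g x‖ ^ p - Λ α p * |u x / δ Ω x| ^ p * (1 / A₁ R (δ Ω x) ^ p)) *
                      δ Ω x ^ (p - 1)) +
                  L η * ∫ x, |τ x| ^ p * δ Ω x ^ (p - 1) ∂(surfaceMeasure Ω η)) := by
  have hp0 : 0 < p := by linarith
  refine ⟨fun hα => ?_, fun hα => ?_⟩
  · obtain ⟨C₂, hC₂, M, hM, hF⟩ := exists_radialField_supercritical (R := R) hp hα
    refine ⟨fun _ => C₂, fun η => M η / (η * η ^ (α * p)), fun η hη => ⟨hC₂, ?_⟩,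
      fun N Ω hN hΩ hδR => ?_⟩
    · have := hM η hη
      positivity
    have hR := pos_of_exp_mul_sSup_lt hδR
    obtain ⟨η₀, hη₀, h⟩ := exists_hardy_of_radialField (P := fun _ => 1)
      (E := fun t => 1 / A₁ R t ^ 2) hp measurable_const
      (measurable_const.div ((measurable_A₁ R).pow_const 2)) hR one_pos
      (fun _ _ _ => zero_le_one) (fun _ _ _ => by positivity) (Λ_pos hp) hC₂ hM
      (by simpa only [mul_one] using hF) hN hΩ
    refine ⟨η₀, hη₀, fun η h1 h2 u g hu => ⟨(h η h1 h2 u g hu).1, fun τ hτ => ?_⟩⟩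
    have key := (h η h1 h2 u g hu).2 τ hτ
    have e : ∀ x, |u x / δ Ω x| ^ p * (1 / A₁ R (δ Ω x) ^ 2) * δ Ω x ^ (α * p) =
        |u x / δ Ω x| ^ p * (δ Ω x ^ (α * p) / A₁ R (δ Ω x) ^ 2) := fun x => by ring
    simpa only [mul_one, e] using key
  · have hαp : α * p = p - 1 := by rw [hα]; field_simp
    obtain ⟨C₂, hC₂, M, hM, hF⟩ := exists_radialField_critical (R := R) hp hα
    refine ⟨fun _ => C₂, fun η => M η / (η * η ^ (p - 1)), fun η hη => ⟨hC₂, ?_⟩,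
      fun N Ω hN hΩ hδR => ?_⟩
    · have := hM η hη
      positivity
    have hR := pos_of_exp_mul_sSup_lt hδR
    have hA : ∀ t, 0 < t → t < R → 0 ≤ 1 / A₁ R t ^ p := fun t h0 h1 =>
      one_div_nonneg.2 (Real.rpow_nonneg (A₁_pos h0 h1).le p)
    obtain ⟨η₀, hη₀, h⟩ := exists_hardy_of_radialField (P := fun t => 1 / A₁ R t ^ p)
      (E := fun t => 1 / A₁ R t ^ p * (1 / A₂ R t ^ 2)) hp
      (measurable_const.div ((measurable_A₁ R).pow_const p))
      ((measurable_const.div ((measurable_A₁ R).pow_const p)).mul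
        (measurable_const.div ((measurable_A₂ R).pow_const 2))) hR hR hA
      (fun t h0 h1 => mul_nonneg (hA t h0 h1) (by positivity)) (Λ_pos hp) hC₂ hM hF hN hΩ
    refine ⟨η₀, hη₀, fun η h1 h2 u g hu => ⟨(h η h1 h2 u g hu).1, fun τ hτ => ?_⟩⟩
    have key := (h η h1 h2 u g hu).2 τ hτ
    simpa only [hαp, ← mul_assoc] using key
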